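/- Let $\mathfrak g$ be the real Lie algebra with basis $A,B,P,Q,R,S$ and non-zero brackets $[P,Q]=R$, $[P,R]=S$, $[A,P]=\tfrac12P$, $[B,P]=-\tfrac12P$, $[B,Q]=Q$, $[A,R]=[B,R]=\tfrac12R$, $[A,S]=S$; let $G$ be the simply connected Lie group with Lie algebra $\mathfrak g$, $X=A+B$, $H=\exp(\mathbb RQ+\mathbb RR+\mathbb RS)$, and let $G_0$ be the subgroup of the elements $(x,b,p):=\exp(xX)\exp(bB)\exp(pP)$, so that $G=G_0H$ and Lebesgue measure $dx\,db\,dp$ is a left Haar measure of $G_0$. Let $Q^*,R^*,S^*$ be the dual basis of $Q,R,S$. For $l\in\mathbb RQ^*+\mathbb RR^*+\mathbb RS^*$ let $\chi_l(\exp V)=e^{-2\pi i\,l(V)}$ and $\sigma_l=\operatorname{ind}_H^G\chi_l$, realised on $L^2(G/H,\chi_l)=L^2(G_0)=L^2(\mathbb R^3)$ by restricting functions to $G_0$; write $\sigma_l$ also for its extension to $C^*(G)$. Fix $\varepsilon\in\{1,-1\}$, $D>0$, and a function $\delta\mapsto r_\delta>0$ on $(0,\infty)$ such that $\lim_{\delta\to0}r_\delta=+\infty$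 and $\lim_{\delta\to0}e^{r_\delta}\delta^{1/2}=0$. Put $I_{c,n}=[cn,cn+c)$ for $c>0$, $n\in\mathbb Z$. For $\delta>0$, $D'>0$ and $k\in\mathbb Z^3$ let $$S_{\delta,D',k}=\{(x,b,p):\ e^{-x}\le\delta^6,\ x\in I_{r_\delta,k_1},\ b\in I_{r_\delta,k_2},\ p\in I_{D'\delta^2e^{r_\delta(k_1+k_2)/2},\,k_3}\},$$ $$R_{\delta,D,k}=\bigcup_{j\in\{-1,0,1\}^3}S_{\delta,\,De^{r_\delta(-j_1-j_2)/2},\,k+j},$$ let $M_{\delta,D,k}$ and $P_{\delta,D,k}$ be the operators on $L^2(\mathbb R^3)$ of multiplication by the characteristic functions of $S_{\delta,D,k}$ and of $R_{\delta,D,k}$, and for $a\in C^*(G)$ let $$\sigma_{\varepsilon,\delta,D}(a)=\sum_{k\in\mathbb Z^3}P_{\delta,D,k}\circ\sigma_{c_k\varepsilon Q^*}(a)\circ M_{\delta,D,k},\qquad c_k=\tfrac12k_3^2\delta^4D^2e^{r_\delta(k_1+k_2)}.$$ Let $U:L^2(\mathbb R^3)\to L^2(\mathbb R,L^2(\mathbb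 R^2))$ be the unitary operator $$(U\xi)(b^*)(x,p)=\int_{\mathbb R}\xi\big(\exp(xX)\exp(pP)\exp(bB)\big)\,e^{b/4}e^{-2\pi i b^*b}\,db$$ (in the sense of the $L^2$ Fourier transform), let $\rho_{\varepsilon S^*}(T)=UTU^*$, let $\mathcal K$ be the algebra of compact operators on $L^2(\mathbb R^2)$, and regard $\varphi\in C_0(\mathbb R,\mathcal K)$ as the operator $(\varphi\xi)(b^*)=\varphi(b^*)(\xi(b^*))$ on $L^2(\mathbb R,L^2(\mathbb R^2))$. Then for every $a\in C^*(G)$ and every $\delta>0$ the sum defining $\sigma_{\varepsilon,\delta,D}(a)$ converges unconditionally in the strong operator topology to a bounded operator, and $$\lim_{\delta\to0}\operatorname{dis}\Big(\rho_{\varepsilon S^*}\big(\sigma_{\varepsilon S^*}(a)-\sigma_{\varepsilon,\delta,D}(a)\big),\,C_0(\mathbb R,\mathcal K)\Big)=0,$$ the distance being taken in the operator norm. -/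

import Mathlib

open MeasureTheory Filter Topology
open scoped ENNReal FourierTransform

noncomputable section

namespace N628

/-! ### The C*-algebra of a locally compact group -/

/-- A strongly continuous unitary representation of `G` on a Hilbert space. Each `ρ g` is a linear
isometry with inverse `ρ g⁻¹`, hence unitary. -/
structure UnitaryRep (G : Type) [Group G] [TopologicalSpace G] where
  H : Type
  [nacg : NormedAddCommGroup H]
  [ips : InnerProductSpace ℂ H]
  [complete : CompleteSpace H]
  ρ : G →* (H →L[ℂ] H)
  norm_map : ∀ g ξ, ‖ρ g ξ‖ = ‖ξ‖
  continuous_orbit : ∀ ξ, Continuous fun g => ρ g ξ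

attribute [instance] UnitaryRep.nacg UnitaryRep.ips UnitaryRep.complete

section CStar

variable {G : Type} [Group G] [TopologicalSpace G] [SecondCountableTopology G]
  [MeasurableSpace G] [BorelSpace G]

theorem UnitaryRep.integrable (π : UnitaryRep G) (μ : Measure G) (F : Lp ℂ 1 μ) (ξ : π.H) :
    Integrable (fun g => F g • π.ρ g ξ) μ := by
  have hF : Integrable F μ := L1.integrable_coeFn F
  refine (hF.norm.mul_const ‖ξ‖).mono
    (hF.1.smul (π.continuous_orbit ξ).aestronglyMeasurable) (ae_of_all _ fun g => ?_)
  simp [norm_smul, π.norm_map]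

/-- The integrated form `π(F) ξ = ∫ F(g) π(g) ξ dg` for `F ∈ L¹(G)`. -/
def UnitaryRep.integrated (π : UnitaryRep G) (μ : Measure G) (F : Lp ℂ 1 μ) :
    π.H →L[ℂ] π.H :=
  LinearMap.mkContinuous
    { toFun := fun ξ => ∫ g, F g • π.ρ g ξ ∂μ
      map_add' := fun ξ η => by
        rw [← integral_add (π.integrable μ F ξ) (π.integrable μ F η)]
        simp
      map_smul' := fun c ξ => by
        rw [RingHom.id_apply, ← integral_smul]
        simp only [map_smul, smul_comm c] }
    ‖F‖ (fun ξ => by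
      refine (norm_integral_le_integral_norm _).trans (le_of_eq ?_)
      simp only [norm_smul, π.norm_map]
      rw [integral_mul_const, L1.norm_eq_integral_norm])

theorem UnitaryRep.integrated_apply (π : UnitaryRep G) (μ : Measure G) (F : Lp ℂ 1 μ)
    (ξ : π.H) : π.integrated μ F ξ = ∫ g, F g • π.ρ g ξ ∂μ := rfl

theorem UnitaryRep.norm_integrated_le (π : UnitaryRep G) (μ : Measure G) (F : Lp ℂ 1 μ) :
    ‖π.integrated μ F‖ ≤ ‖F‖ :=
  LinearMap.mkContinuous_norm_le _ (norm_nonneg _) _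

/-- The universal representation of `L¹(G)`: `F` is sent to the field of operators `π(F)`, with `π`
running through all unitary representations; the norm of the image is `sup_π ‖π(F)‖`. -/
def universalRep (μ : Measure G) :
    Lp ℂ 1 μ →ₗ[ℂ] lp (fun π : UnitaryRep G => π.H →L[ℂ] π.H) ∞ where
  toFun F := ⟨fun π => π.integrated μ F, memℓp_infty ⟨‖F‖, by
    rintro _ ⟨π, rfl⟩
    exact π.norm_integrated_le μ F⟩⟩
  map_add' F F' := by
    ext π ξ
    have h : ∫ g, (F + F' : Lp ℂ 1 μ) g • π.ρ g ξ ∂μ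
        = ∫ g, (F g • π.ρ g ξ + F' g • π.ρ g ξ) ∂μ := by
      refine integral_congr_ae ?_
      filter_upwards [Lp.coeFn_add F F'] with g hg
      rw [hg, Pi.add_apply, add_smul]
    change π.integrated μ (F + F') ξ = π.integrated μ F ξ + π.integrated μ F' ξ
    rw [π.integrated_apply, h, integral_add (π.integrable μ F ξ) (π.integrable μ F' ξ)]
    rfl
  map_smul' c F := by
    ext π ξ
    have h : ∫ g, (c • F : Lp ℂ 1 μ) g • π.ρ g ξ ∂μ = ∫ g, c • (F g • π.ρ g ξ) ∂μ := by
      refine integral_congr_ae ?_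
      filter_upwards [Lp.coeFn_smul c F] with g hg
      rw [hg, Pi.smul_apply, smul_assoc]
    change π.integrated μ (c • F) ξ = c • π.integrated μ F ξ
    rw [π.integrated_apply, h, integral_smul]
    rfl

/-- The group C*-algebra `C*(G)`, for a left Haar measure `μ` of `G`: the completion of `L¹(G)` for
the norm `sup_π ‖π(F)‖`, realised as the closure of the image of the *-algebra `L¹(G)` in the
C*-algebra of bounded operator fields over all unitary representations. The value of `a ∈ C*(G)`
at the index `π` is the operator `π(a)`, i.e. the continuous extension of `F ↦ π(F)`. -/
def GroupCStar (μ : Measure G) [μ.IsHaarMeasure] :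
    Submodule ℂ (lp (fun π : UnitaryRep G => π.H →L[ℂ] π.H) ∞) :=
  (LinearMap.range (universalRep μ)).topologicalClosure

end CStar

/-! ### Multiplication operators -/

theorem eLpNorm_two_sq {α E : Type} [MeasurableSpace α] [NormedAddCommGroup E] (μ : Measure α)
    (f : α → E) : eLpNorm f 2 μ ^ (2 : ℝ) = ∫⁻ x, ‖f x‖ₑ ^ (2 : ℝ) ∂μ := by
  rw [eLpNorm_eq_lintegral_rpow_enorm_toReal (by simp) (by simp), ENNReal.toReal_ofNat,
    ← ENNReal.rpow_mul]
  norm_num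

theorem eLpNorm_two {α E : Type} [MeasurableSpace α] [NormedAddCommGroup E] (μ : Measure α)
    (f : α → E) : eLpNorm f 2 μ = (∫⁻ x, ‖f x‖ₑ ^ (2 : ℝ) ∂μ) ^ ((2 : ℝ)⁻¹) := by
  rw [← eLpNorm_two_sq, ← ENNReal.rpow_mul]
  norm_num

section Mul

variable {α : Type} [MeasurableSpace α] {μ : Measure α}

/-- Multiplication by a measurable function of modulus at most one, on `L²`. -/
def mulOp (μ : Measure α) (m : α → ℂ) (hm : Measurable m) (hb : ∀ x, ‖m x‖ ≤ 1) :
    Lp ℂ 2 μ →L[ℂ] Lp ℂ 2 μ :=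
  have key : ∀ ξ : Lp ℂ 2 μ, MemLp (fun x => m x * ξ x) 2 μ := fun ξ =>
    (Lp.memLp ξ).mono (hm.aestronglyMeasurable.mul (Lp.aestronglyMeasurable ξ))
      (ae_of_all _ fun x => by
        rw [norm_mul]
        exact mul_le_of_le_one_left (norm_nonneg _) (hb x))
  LinearMap.mkContinuous
    { toFun := fun ξ => (key ξ).toLp _
      map_add' := fun ξ η => by
        rw [← MemLp.toLp_add]
        refine MemLp.toLp_congr _ _ ?_
        filter_upwards [Lp.coeFn_add ξ η] with x hx
        rw [hx, Pi.add_apply]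
        exact mul_add _ _ _
      map_smul' := fun c ξ => by
        rw [RingHom.id_apply, ← MemLp.toLp_const_smul]
        refine MemLp.toLp_congr _ _ ?_
        filter_upwards [Lp.coeFn_smul c ξ] with x hx
        rw [hx, Pi.smul_apply]
        simp [mul_left_comm] }
    1 (fun ξ => by
      rw [one_mul]
      refine Lp.norm_le_norm_of_ae_le ?_
      filter_upwards [(key ξ).coeFn_toLp] with x hx
      simp only [LinearMap.coe_mk, AddHom.coe_mk]
      rw [hx, norm_mul]
      exact mul_le_of_le_one_left (norm_nonneg _) (hb x))

theorem mulOp_coeFn (m : α → ℂ) (hm : Measurable m) (hb : ∀ x, ‖m x‖ ≤ 1) (ξ : Lp ℂ 2 μ) :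
    mulOp μ m hm hb ξ =ᵐ[μ] fun x => m x * ξ x :=
  MemLp.coeFn_toLp (f := fun x => m x * ξ x) ((Lp.memLp ξ).mono
    (hm.aestronglyMeasurable.mul (Lp.aestronglyMeasurable ξ)) (ae_of_all _ fun x => by
      rw [norm_mul]
      exact mul_le_of_le_one_left (norm_nonneg _) (hb x)))

/-- `M_S`: multiplication by the characteristic function of `S` on `L²`. -/
def mulInd (μ : Measure α) (S : Set α) (hS : MeasurableSet S) : Lp ℂ 2 μ →L[ℂ] Lp ℂ 2 μ :=
  mulOp μ (S.indicator fun _ => 1) (measurable_const.indicator hS) (fun x => by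
    by_cases hx : x ∈ S <;> simp [hx])

end Mul

/-! ### The group

The Lie algebra has basis `A, B, P, Q, R, S` with `[P,Q]=R`, `[P,R]=S`, `[A,P]=P/2`, `[B,P]=-P/2`,
`[B,Q]=Q`, `[A,R]=R/2`, `[B,R]=R/2`, `[A,S]=S`. With `X = A + B` one has `[X,P]=0`, `[X,Q]=Q`,
`[X,R]=R`, `[X,S]=S`. The simply connected group `G` is written in the global coordinates
`exp(xX) exp(bB) exp(pP) exp(qQ + rR + sS)`. -/

/-- The subgroup `G₀` of the elements `(x, b, p) = exp(xX) exp(bB) exp(pP)`. -/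
def G0 : Type := ℝ × ℝ × ℝ

instance : TopologicalSpace G0 := inferInstanceAs (TopologicalSpace (ℝ × ℝ × ℝ))
instance : MeasureSpace G0 := inferInstanceAs (MeasureSpace (ℝ × ℝ × ℝ))
instance : BorelSpace G0 := inferInstanceAs (BorelSpace (ℝ × ℝ × ℝ))
instance : T2Space G0 := inferInstanceAs (T2Space (ℝ × ℝ × ℝ))
instance : SecondCountableTopology G0 := inferInstanceAs (SecondCountableTopology (ℝ × ℝ × ℝ))
instance : SigmaFinite (volume : Measure G0) :=
  inferInstanceAs (SigmaFinite (volume : Measure (ℝ × ℝ × ℝ)))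
instance : IsLocallyFiniteMeasure (volume : Measure G0) :=
  inferInstanceAs (IsLocallyFiniteMeasure (volume : Measure (ℝ × ℝ × ℝ)))
instance : IsFiniteMeasureOnCompacts (volume : Measure G0) :=
  inferInstanceAs (IsFiniteMeasureOnCompacts (volume : Measure (ℝ × ℝ × ℝ)))
instance : (volume : Measure G0).IsOpenPosMeasure :=
  inferInstanceAs ((volume : Measure (ℝ × ℝ × ℝ)).IsOpenPosMeasure)
instance : (volume : Measure G0).InnerRegularCompactLTTop :=
  inferInstanceAs ((volume : Measure (ℝ × ℝ × ℝ)).InnerRegularCompactLTTop)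

/-- The element `exp(xX) exp(bB) exp(pP)`. -/
def G0.mk (x b p : ℝ) : G0 := ((x, b, p) : ℝ × ℝ × ℝ)
/-- The coordinate `x`. -/
def G0.x (u : G0) : ℝ := Prod.fst (u : ℝ × ℝ × ℝ)
/-- The coordinate `b`. -/
def G0.b (u : G0) : ℝ := Prod.fst (Prod.snd (u : ℝ × ℝ × ℝ))
/-- The coordinate `p`. -/
def G0.p (u : G0) : ℝ := Prod.snd (Prod.snd (u : ℝ × ℝ × ℝ))

@[simp] theorem G0.x_mk (x b p : ℝ) : (G0.mk x b p).x = x := rfl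
@[simp] theorem G0.b_mk (x b p : ℝ) : (G0.mk x b p).b = b := rfl
@[simp] theorem G0.p_mk (x b p : ℝ) : (G0.mk x b p).p = p := rfl

@[ext] theorem G0.ext {u v : G0} (h1 : u.x = v.x) (h2 : u.b = v.b) (h3 : u.p = v.p) : u = v :=
  Prod.ext h1 (Prod.ext h2 h3)

@[fun_prop] theorem G0.continuous_x : Continuous G0.x :=
  (continuous_fst : Continuous (Prod.fst : ℝ × ℝ × ℝ → ℝ))
@[fun_prop] theorem G0.continuous_b : Continuous G0.b :=
  (continuous_fst.comp continuous_snd : Continuous fun z : ℝ × ℝ × ℝ => z.2.1)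
@[fun_prop] theorem G0.continuous_p : Continuous G0.p :=
  (continuous_snd.comp continuous_snd : Continuous fun z : ℝ × ℝ × ℝ => z.2.2)
theorem G0.continuous_mk {Y : Type} [TopologicalSpace Y] {f g h : Y → ℝ} (hf : Continuous f)
    (hg : Continuous g) (hh : Continuous h) : Continuous fun y => G0.mk (f y) (g y) (h y) :=
  (hf.prodMk (hg.prodMk hh) : Continuous fun y => ((f y, g y, h y) : ℝ × ℝ × ℝ))

/-- `exp(sX) exp(tB) exp(vP) exp(xX) exp(bB) exp(pP) = exp((s+x)X) exp((t+b)B) exp((e^{b/2}v+p)P)`,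
because `X` commutes with `B` and `P`, and `[B,P] = -P/2`. -/
instance : Mul G0 := ⟨fun g u => G0.mk (g.x + u.x) (g.b + u.b) (Real.exp (u.b / 2) * g.p + u.p)⟩
instance : One G0 := ⟨G0.mk 0 0 0⟩
instance : Inv G0 := ⟨fun g => G0.mk (-g.x) (-g.b) (-(Real.exp (-g.b / 2) * g.p))⟩

@[simp] theorem G0.x_mul (g u : G0) : (g * u).x = g.x + u.x := rfl
@[simp] theorem G0.b_mul (g u : G0) : (g * u).b = g.b + u.b := rfl
@[simp] theorem G0.p_mul (g u : G0) : (g * u).p = Real.exp (u.b / 2) * g.p + u.p := rfl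
@[simp] theorem G0.x_one : (1 : G0).x = 0 := rfl
@[simp] theorem G0.b_one : (1 : G0).b = 0 := rfl
@[simp] theorem G0.p_one : (1 : G0).p = 0 := rfl
@[simp] theorem G0.x_inv (g : G0) : g⁻¹.x = -g.x := rfl
@[simp] theorem G0.b_inv (g : G0) : g⁻¹.b = -g.b := rfl
@[simp] theorem G0.p_inv (g : G0) : g⁻¹.p = -(Real.exp (-g.b / 2) * g.p) := rfl

instance : Group G0 :=
  Group.ofLeftAxioms
    (fun a b c => by
      ext
      · simp [add_assoc]
      · simp [add_assoc]
      · simp only [G0.p_mul, G0.b_mul, add_div, Real.exp_add]; ring)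
    (fun a => by ext <;> simp)
    (fun a => by
      ext
      · simp
      · simp
      · have : Real.exp (a.b / 2) * Real.exp (-a.b / 2) = 1 := by
          rw [← Real.exp_add, ← Real.exp_zero]; congr 1; ring
        simp only [G0.p_mul, G0.p_inv, G0.p_one]
        linear_combination -a.p * this)

instance : IsTopologicalGroup G0 where
  continuous_mul := G0.continuous_mk (f := fun z : G0 × G0 => z.1.x + z.2.x)
    (g := fun z : G0 × G0 => z.1.b + z.2.b)
    (h := fun z : G0 × G0 => Real.exp (z.2.b / 2) * z.1.p + z.2.p)
    (by fun_prop) (by fun_prop) (by fun_prop)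
  continuous_inv := G0.continuous_mk (f := fun g : G0 => -g.x) (g := fun g : G0 => -g.b)
    (h := fun g : G0 => -(Real.exp (-g.b / 2) * g.p))
    (by fun_prop) (by fun_prop) (by fun_prop)

/-- The adjoint action of `u⁻¹`, for `u = (x, b, p) ∈ G₀`, on the abelian ideal spanned by
`Q, R, S`: `Ad(u⁻¹) = exp(-p ad P) exp(-b ad B) exp(-x ad X)`, where a triple `(q, r, s)` stands for
`qQ + rR + sS`. -/
def adInv (u : G0) (h : ℝ × ℝ × ℝ) : ℝ × ℝ × ℝ :=
  let q := Real.exp (-u.x - u.b) * h.1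
  let r := Real.exp (-u.x - u.b / 2) * h.2.1
  let s := Real.exp (-u.x) * h.2.2
  (q, r - u.p * q, s - u.p * r + u.p ^ 2 / 2 * q)

theorem adInv_mul (u v : G0) (h : ℝ × ℝ × ℝ) : adInv (u * v) h = adInv v (adInv u h) := by
  have h1 : Real.exp (-(u.x + v.x) - (u.b + v.b))
      = Real.exp (-u.x - u.b) * Real.exp (-v.x - v.b) := by
    rw [← Real.exp_add]; congr 1; ring
  have h2 : Real.exp (-(u.x + v.x) - (u.b + v.b) / 2)
      = Real.exp (-u.x - u.b / 2) * Real.exp (-v.x - v.b / 2) := by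
    rw [← Real.exp_add]; congr 1; ring
  have h3 : Real.exp (-(u.x + v.x)) = Real.exp (-u.x) * Real.exp (-v.x) := by
    rw [← Real.exp_add]; congr 1; ring
  have h4 : Real.exp (-v.x - v.b / 2) = Real.exp (v.b / 2) * Real.exp (-v.x - v.b) := by
    rw [← Real.exp_add]; congr 1; ring
  have h5 : Real.exp (-v.x)
      = Real.exp (v.b / 2) * Real.exp (v.b / 2) * Real.exp (-v.x - v.b) := by
    rw [← Real.exp_add, ← Real.exp_add]; congr 1; ring
  simp only [adInv, G0.x_mul, G0.b_mul, G0.p_mul, Prod.mk.injEq, h1, h2, h3]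
  rw [h4, h5]
  refine ⟨by ring, by ring, by ring⟩

@[simp] theorem adInv_one (h : ℝ × ℝ × ℝ) : adInv 1 h = h := by
  simp [adInv]

theorem adInv_add (u : G0) (h k : ℝ × ℝ × ℝ) : adInv u (h + k) = adInv u h + adInv u k := by
  simp only [adInv, Prod.fst_add, Prod.snd_add, Prod.mk_add_mk, Prod.mk.injEq]
  refine ⟨by ring, by ring, by ring⟩

@[simp] theorem adInv_zero (u : G0) : adInv u 0 = 0 := by
  simp [adInv]

theorem adInv_neg (u : G0) (h : ℝ × ℝ × ℝ) : adInv u (-h) = -adInv u h := by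
  simp only [adInv, Prod.fst_neg, Prod.snd_neg, Prod.neg_mk, Prod.mk.injEq]
  refine ⟨by ring, by ring, by ring⟩

theorem continuous_adInv : Continuous fun z : G0 × (ℝ × ℝ × ℝ) => adInv z.1 z.2 := by
  unfold adInv
  fun_prop

/-- The group `G`: the pair `(u, (q, r, s))` is the element `u exp(qQ + rR + sS)`. -/
def G6 : Type := G0 × (ℝ × ℝ × ℝ)

instance : TopologicalSpace G6 := inferInstanceAs (TopologicalSpace (G0 × (ℝ × ℝ × ℝ)))
instance : MeasureSpace G6 := inferInstanceAs (MeasureSpace (G0 × (ℝ × ℝ × ℝ)))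
instance : BorelSpace G6 := inferInstanceAs (BorelSpace (G0 × (ℝ × ℝ × ℝ)))
instance : SecondCountableTopology G6 :=
  inferInstanceAs (SecondCountableTopology (G0 × (ℝ × ℝ × ℝ)))

/-- The element `u exp(qQ + rR + sS)`, for `h = (q, r, s)`. -/
def G6.mk (u : G0) (h : ℝ × ℝ × ℝ) : G6 := ((u, h) : G0 × (ℝ × ℝ × ℝ))
/-- The component in `G₀`. -/
def G6.u (g : G6) : G0 := Prod.fst (g : G0 × (ℝ × ℝ × ℝ))
/-- The coordinates `(q, r, s)`. -/
def G6.h (g : G6) : ℝ × ℝ × ℝ := Prod.snd (g : G0 × (ℝ × ℝ × ℝ))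

@[simp] theorem G6.u_mk (u : G0) (h : ℝ × ℝ × ℝ) : (G6.mk u h).u = u := rfl
@[simp] theorem G6.h_mk (u : G0) (h : ℝ × ℝ × ℝ) : (G6.mk u h).h = h := rfl

@[ext] theorem G6.ext {g k : G6} (h1 : g.u = k.u) (h2 : g.h = k.h) : g = k := Prod.ext h1 h2

@[fun_prop] theorem G6.continuous_u : Continuous G6.u :=
  (continuous_fst : Continuous (Prod.fst : G0 × (ℝ × ℝ × ℝ) → G0))
@[fun_prop] theorem G6.continuous_h : Continuous G6.h :=
  (continuous_snd : Continuous (Prod.snd : G0 × (ℝ × ℝ × ℝ) → ℝ × ℝ × ℝ))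

/-- `(u exp V) (u' exp V') = (u u') exp(Ad(u'⁻¹) V + V')`. -/
instance : Mul G6 := ⟨fun g k => G6.mk (g.u * k.u) (adInv k.u g.h + k.h)⟩
instance : One G6 := ⟨G6.mk 1 0⟩
instance : Inv G6 := ⟨fun g => G6.mk g.u⁻¹ (-adInv g.u⁻¹ g.h)⟩

@[simp] theorem G6.u_mul (g k : G6) : (g * k).u = g.u * k.u := rfl
@[simp] theorem G6.h_mul (g k : G6) : (g * k).h = adInv k.u g.h + k.h := rfl
@[simp] theorem G6.u_one : (1 : G6).u = 1 := rfl
@[simp] theorem G6.h_one : (1 : G6).h = 0 := rfl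
@[simp] theorem G6.u_inv (g : G6) : g⁻¹.u = g.u⁻¹ := rfl
@[simp] theorem G6.h_inv (g : G6) : g⁻¹.h = -adInv g.u⁻¹ g.h := rfl

instance : Group G6 :=
  Group.ofLeftAxioms
    (fun a b c => by
      apply G6.ext
      · simp [mul_assoc]
      · simp only [G6.h_mul, G6.u_mul, adInv_mul, adInv_add, add_assoc])
    (fun a => by apply G6.ext <;> simp)
    (fun a => by
      apply G6.ext
      · simp
      · simp only [G6.h_mul, G6.h_inv, adInv_neg, ← adInv_mul, inv_mul_cancel, adInv_one,
          neg_add_cancel, G6.h_one])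

/-- Lebesgue measure in the coordinates `(x, b, p)` is a left Haar measure of `G₀`. -/
theorem G0.measurePreserving_mul_left (g : G0) :
    MeasurePreserving (fun u : G0 => g * u) := by
  have h1 : MeasurePreserving
      (fun z : ℝ × ℝ => (g.b + z.1, Real.exp (z.1 / 2) * g.p + z.2)) :=
    (measurePreserving_add_left volume g.b).skew_product
      (g := fun b p => Real.exp (b / 2) * g.p + p) (by fun_prop)
      (ae_of_all _ fun b => map_add_left_eq_self volume _)
  exact (measurePreserving_add_left (volume : Measure ℝ) g.x).prod h1

/-- Lebesgue measure in the coordinates `(x, b, p, q, r, s)` is a left Haar measure of `G`. -/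
theorem G6.measurePreserving_mul_left (g : G6) :
    MeasurePreserving (fun k : G6 => g * k) := by
  have h1 : MeasurePreserving (fun z : G0 × (ℝ × ℝ × ℝ) => (g.u * z.1, adInv z.1 g.h + z.2))
      (Measure.prod volume volume) (Measure.prod volume volume) :=
    (G0.measurePreserving_mul_left g.u).skew_product
      (g := fun u h => adInv u g.h + h)
      ((continuous_adInv.comp (by fun_prop :
        Continuous fun z : G0 × (ℝ × ℝ × ℝ) => (z.1, g.h))).add continuous_snd).measurable
      (ae_of_all _ fun u => by
        have : (volume : Measure (ℝ × ℝ × ℝ)).IsAddLeftInvariant :=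
          Measure.prod.instIsAddLeftInvariant
        exact map_add_left_eq_self volume _)
  exact h1

theorem G6.volume_def :
    (volume : Measure G6) = (Measure.prod volume volume : Measure (G0 × (ℝ × ℝ × ℝ))) := rfl

instance : (volume : Measure G6).IsHaarMeasure where
  lt_top_of_isCompact := fun {K} hK => by
    have : IsFiniteMeasureOnCompacts (volume : Measure (G0 × (ℝ × ℝ × ℝ))) := inferInstance
    exact this.lt_top_of_isCompact hK
  map_mul_left_eq_self := fun g => (G6.measurePreserving_mul_left g).map_eq
  open_pos := by
    have : (volume : Measure (G0 × (ℝ × ℝ × ℝ))).IsOpenPosMeasure := inferInstance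
    exact this.open_pos

/-- `C*(G)`. -/
abbrev CStarG : Type 1 := GroupCStar (volume : Measure G6)

/-! ### The induced representations `σ_l` -/

/-- `L²(G₀) = L²(ℝ³)`, in the coordinates `(x, b, p)`. -/
abbrev L2G0 : Type := Lp ℂ 2 (volume : Measure G0)

/-- `χ_l(exp(qQ+rR+sS)) = exp(-2πi (l₁ q + l₂ r + l₃ s))`, for the linear functional
`l = l₁ Q* + l₂ R* + l₃ S*` on the span of `Q, R, S`. -/
def chi (l h : ℝ × ℝ × ℝ) : ℂ :=
  𝐞 (-(l.1 * h.1 + l.2.1 * h.2.1 + l.2.2 * h.2.2))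

theorem chi_add (l h k : ℝ × ℝ × ℝ) : chi l (h + k) = chi l h * chi l k := by
  simp only [chi, Prod.fst_add, Prod.snd_add]
  rw [← Circle.coe_mul, ← AddChar.map_add_eq_mul]
  congr 2; ring

theorem norm_chi (l h : ℝ × ℝ × ℝ) : ‖chi l h‖ = 1 := Circle.norm_coe _

theorem continuous_chi (l : ℝ × ℝ × ℝ) : Continuous (chi l) := by
  unfold chi
  exact continuous_induced_dom.comp (Real.continuous_fourierChar.comp (by fun_prop))

/-- The multiplier `χ_l(Ad((g₀⁻¹u)⁻¹) V)` of the induced representation, for `g = g₀ exp V`. -/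
def phase (l : ℝ × ℝ × ℝ) (g : G6) (u : G0) : ℂ := chi l (adInv (g.u⁻¹ * u) g.h)

theorem norm_phase (l : ℝ × ℝ × ℝ) (g : G6) (u : G0) : ‖phase l g u‖ = 1 := norm_chi _ _

theorem enorm_phase (l : ℝ × ℝ × ℝ) (g : G6) (u : G0) : ‖phase l g u‖ₑ = 1 := by
  rw [← ofReal_norm, norm_phase, ENNReal.ofReal_one]

theorem continuous_phase (l : ℝ × ℝ × ℝ) :
    Continuous fun z : G6 × G0 => phase l z.1 z.2 :=
  (continuous_chi l).comp (continuous_adInv.comp (by fun_prop :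
    Continuous fun z : G6 × G0 => (z.1.u⁻¹ * z.2, z.1.h)))

theorem measurable_phase (l : ℝ × ℝ × ℝ) (g : G6) : Measurable (phase l g) :=
  ((continuous_phase l).comp (by fun_prop : Continuous fun u : G0 => (g, u))).measurable

/-- Left translation `(λ(v) ξ)(u) = ξ(v⁻¹ u)` on `L²(G₀)`. -/
def leftTr (v : G0) : L2G0 →ₗᵢ[ℂ] L2G0 :=
  Lp.compMeasurePreservingₗᵢ ℂ (fun u : G0 => v⁻¹ * u) (G0.measurePreserving_mul_left v⁻¹)

theorem leftTr_coeFn (v : G0) (ξ : L2G0) : leftTr v ξ =ᵐ[volume] fun u => ξ (v⁻¹ * u) :=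
  Lp.coeFn_compMeasurePreserving ξ (G0.measurePreserving_mul_left v⁻¹)

/-- The operator `(σ_l(g) ξ)(u) = χ_l(Ad((g₀⁻¹u)⁻¹) V) ξ(g₀⁻¹ u)`, for `g = g₀ exp V`. -/
def indOp (l : ℝ × ℝ × ℝ) (g : G6) : L2G0 →L[ℂ] L2G0 :=
  mulOp volume (phase l g) (measurable_phase l g) (fun u => (norm_phase l g u).le) ∘L
    (leftTr g.u).toContinuousLinearMap

theorem indOp_coeFn' (l : ℝ × ℝ × ℝ) (g : G6) (ξ : L2G0) :
    indOp l g ξ =ᵐ[volume] fun u => phase l g u * leftTr g.u ξ u :=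
  mulOp_coeFn (phase l g) (measurable_phase l g) (fun u => (norm_phase l g u).le) (leftTr g.u ξ)

theorem indOp_coeFn (l : ℝ × ℝ × ℝ) (g : G6) (ξ : L2G0) :
    indOp l g ξ =ᵐ[volume] fun u => phase l g u * ξ (g.u⁻¹ * u) := by
  filter_upwards [indOp_coeFn' l g ξ, leftTr_coeFn g.u ξ] with u hu hu'
  rw [hu, hu']

theorem indOp_one (l : ℝ × ℝ × ℝ) : indOp l 1 = 1 := by
  ext1 ξ
  refine Lp.ext ((indOp_coeFn l 1 ξ).trans (ae_of_all _ fun u => ?_))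
  simp [phase, chi]

theorem indOp_mul (l : ℝ × ℝ × ℝ) (g k : G6) : indOp l (g * k) = indOp l g * indOp l k := by
  ext1 ξ
  refine Lp.ext ((indOp_coeFn l (g * k) ξ).trans ?_)
  have h2 := (G0.measurePreserving_mul_left g.u⁻¹).quasiMeasurePreserving.ae
    (indOp_coeFn l k ξ)
  refine EventuallyEq.trans ?_ (indOp_coeFn l g (indOp l k ξ)).symm
  filter_upwards [h2] with u hu
  rw [hu]
  simp only [phase, G6.u_mul, G6.h_mul, mul_inv_rev, adInv_add, chi_add]
  rw [← adInv_mul]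
  simp only [mul_assoc, mul_inv_cancel_left]

theorem norm_indOp (l : ℝ × ℝ × ℝ) (g : G6) (ξ : L2G0) : ‖indOp l g ξ‖ = ‖ξ‖ := by
  rw [← (leftTr g.u).norm_map ξ]
  refine le_antisymm (Lp.norm_le_norm_of_ae_le ?_) (Lp.norm_le_norm_of_ae_le ?_) <;>
  · filter_upwards [indOp_coeFn' l g ξ] with u hu
    rw [hu, norm_mul, norm_phase, one_mul]

theorem continuous_leftTr (ξ : L2G0) : Continuous fun v : G0 => leftTr v ξ := by
  let f : G0 → C(G0, G0) := fun v => ⟨fun u => v⁻¹ * u, by fun_prop⟩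
  have hf : Continuous f :=
    ContinuousMap.continuous_of_continuous_uncurry f
      (by fun_prop : Continuous fun z : G0 × G0 => z.1⁻¹ * z.2)
  exact (continuous_const (y := ξ)).compMeasurePreservingLp hf
    (fun v => G0.measurePreserving_mul_left v⁻¹) (by simp)

theorem continuous_mulPhase (l : ℝ × ℝ × ℝ) (η : L2G0) : Continuous fun g : G6 =>
    mulOp volume (phase l g) (measurable_phase l g) (fun u => (norm_phase l g u).le) η := by
  rw [continuous_iff_continuousAt]
  intro g
  have hm : ∀ k : G6, Measurable fun u => ‖phase l k u * η u - phase l g u * η u‖ₑ ^ (2 : ℝ) :=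
    fun k => (((measurable_phase l k).mul (Lp.stronglyMeasurable η).measurable).sub
      ((measurable_phase l g).mul (Lp.stronglyMeasurable η).measurable)).enorm.pow_const _
  have h1 : Tendsto (fun k : G6 => ∫⁻ u, ‖phase l k u * η u - phase l g u * η u‖ₑ ^ (2 : ℝ))
      (𝓝 g) (𝓝 (∫⁻ _ : G0, 0)) := by
    refine tendsto_lintegral_filter_of_dominated_convergence
      (fun u => (2 * ‖η u‖ₑ) ^ (2 : ℝ)) (Eventually.of_forall hm)
      (Eventually.of_forall fun k => ae_of_all _ fun u => ?_) ?_ (ae_of_all _ fun u => ?_)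
    · refine ENNReal.rpow_le_rpow ?_ (by norm_num)
      refine enorm_sub_le.trans ?_
      rw [enorm_mul, enorm_mul, enorm_phase, enorm_phase, one_mul, two_mul]
    · have : ∫⁻ u, (2 * ‖η u‖ₑ) ^ (2 : ℝ) = (2 : ℝ≥0∞) ^ (2 : ℝ) * eLpNorm η 2 volume ^ (2 : ℝ) := by
        rw [eLpNorm_two_sq, ← lintegral_const_mul' _ _ (by simp)]
        refine lintegral_congr fun u => ENNReal.mul_rpow_of_nonneg _ _ (by norm_num)
      rw [this]
      exact ENNReal.mul_ne_top (by simp)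
        (ENNReal.rpow_ne_top_of_nonneg (by norm_num) (Lp.memLp η).2.ne)
    · have hc : Continuous fun k : G6 => ‖phase l k u * η u - phase l g u * η u‖ₑ ^ (2 : ℝ) := by
        have := (continuous_phase l).comp (by fun_prop : Continuous fun k : G6 => (k, u))
        exact (ENNReal.continuous_rpow_const.comp
          ((this.mul continuous_const).sub continuous_const).enorm)
      simpa using hc.tendsto g
  rw [lintegral_zero] at h1
  refine (Lp.tendsto_Lp_iff_tendsto_eLpNorm' _ _).2 ?_
  have h2 := (ENNReal.continuous_rpow_const (y := (2 : ℝ)⁻¹)).tendsto 0 |>.comp h1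
  rw [ENNReal.zero_rpow_of_pos (by norm_num)] at h2
  refine h2.congr fun k => ?_
  rw [Function.comp_apply, ← eLpNorm_two]
  refine eLpNorm_congr_ae ?_
  filter_upwards [mulOp_coeFn (phase l k) (measurable_phase l k)
      (fun u => (norm_phase l k u).le) η, mulOp_coeFn (phase l g) (measurable_phase l g)
      (fun u => (norm_phase l g u).le) η] with u h3 h4
  rw [Pi.sub_apply, h3, h4]

theorem continuous_indOp (l : ℝ × ℝ × ℝ) (ξ : L2G0) : Continuous fun g => indOp l g ξ := by
  rw [continuous_iff_continuousAt]
  intro g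
  have h1 := (continuous_mulPhase l (leftTr g.u ξ)).tendsto g
  have h2 : Tendsto (fun k : G6 => ‖leftTr k.u ξ - leftTr g.u ξ‖) (𝓝 g) (𝓝 0) := by
    have := (((continuous_leftTr ξ).comp G6.continuous_u).sub
      (continuous_const (y := leftTr g.u ξ))).norm.tendsto g
    simpa using this
  have h3 : Tendsto (fun k : G6 => indOp l k ξ - mulOp volume (phase l k) (measurable_phase l k)
      (fun u => (norm_phase l k u).le) (leftTr g.u ξ)) (𝓝 g) (𝓝 0) := by
    refine squeeze_zero_norm (fun k => ?_) h2
    change ‖mulOp volume (phase l k) (measurable_phase l k)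
      (fun u => (norm_phase l k u).le) (leftTr k.u ξ) - _‖ ≤ _
    rw [← map_sub]
    refine Lp.norm_le_norm_of_ae_le ?_
    filter_upwards [mulOp_coeFn (phase l k) (measurable_phase l k)
      (fun u => (norm_phase l k u).le) (leftTr k.u ξ - leftTr g.u ξ)] with u hu
    rw [hu, norm_mul, norm_phase, one_mul]
  have h4 := h3.add h1
  simp only [sub_add_cancel, zero_add] at h4
  exact h4

/-- `σ_l = ind_H^G χ_l`, where `H = exp(span(Q, R, S))`. The space of the induced representation
consists of the functions on `G` with `ξ(u exp V) = χ_l(exp V)⁻¹ ξ(u)` that are square integrable on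
`G / H`, with `G` acting by left translation; it is identified with `L²(G₀)` by restricting
functions to `G₀`. -/
def sigmaRep (l : ℝ × ℝ × ℝ) : UnitaryRep G6 where
  H := L2G0
  ρ := { toFun := indOp l, map_one' := indOp_one l, map_mul' := indOp_mul l }
  norm_map := norm_indOp l
  continuous_orbit := continuous_indOp l

/-- The operator `σ_l(a)` for `a ∈ C*(G)`. -/
def sigma (l : ℝ × ℝ × ℝ) (a : CStarG) : L2G0 →L[ℂ] L2G0 := a.1 (sigmaRep l)

/-- On the image of `F ∈ L¹(G)`, `σ_l` is the integrated form `∫ F(g) σ_l(g) dg`. -/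
theorem sigma_universalRep (l : ℝ × ℝ × ℝ) (F : Lp ℂ 1 (volume : Measure G6)) :
    sigma l ⟨universalRep volume F, subset_closure ⟨F, rfl⟩⟩ = (sigmaRep l).integrated volume F :=
  rfl

/-- The functional `c Q*`. -/
def Qstar (c : ℝ) : ℝ × ℝ × ℝ := (c, 0, 0)

/-- The functional `c S*`. -/
def Sstar (c : ℝ) : ℝ × ℝ × ℝ := (0, 0, c)

/-! ### The Fourier transform in the direction of `B` -/

/-- `L²(ℝ²)`. -/
abbrev L2R2 : Type := Lp ℂ 2 (volume : Measure (ℝ × ℝ))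

/-- The Hilbert space `∫^⊕ L²(ℝ²) = L²(ℝ, L²(ℝ²))`. -/
abbrev HTau : Type := Lp L2R2 2 (volume : Measure ℝ)

/-- `L²(ℝ × ℝ²)`. -/
abbrev L2R3 : Type := Lp ℂ 2 (volume : Measure (ℝ × (ℝ × ℝ)))

open Classical in
/-- The slice `f(b, ·)` as an element of `L²(ℝ²)` (and `0` where it is not square integrable). -/
def slice (f : ℝ × (ℝ × ℝ) → ℂ) (b : ℝ) : L2R2 :=
  if h : MemLp (fun y => f (b, y)) 2 volume then h.toLp _ else 0

theorem slice_coeFn {f : ℝ × (ℝ × ℝ) → ℂ} {b : ℝ}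
    (h : MemLp (fun y => f (b, y)) 2 volume) : slice f b =ᵐ[volume] fun y => f (b, y) := by
  rw [slice, dif_pos h]
  exact h.coeFn_toLp

instance : SecondCountableTopology L2R2 :=
  have : Fact ((2 : ℝ≥0∞) ≠ ∞) := ⟨by simp⟩
  Lp.SecondCountableTopology

theorem measurable_of_edist {α E : Type} [MeasurableSpace α] [PseudoEMetricSpace E]
    [SecondCountableTopology E] [MeasurableSpace E] [BorelSpace E] {g : α → E}
    (h : ∀ c, Measurable fun a => edist (g a) c) : Measurable g := by
  refine measurable_of_isOpen fun U hU => ?_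
  have h1 : ∀ x : U, ∃ ε : ℝ≥0∞, 0 < ε ∧ Metric.eball (x : E) ε ⊆ U := fun x =>
    EMetric.isOpen_iff.1 hU x x.2
  choose ε hε hU' using h1
  obtain ⟨T, hT, hTU⟩ := TopologicalSpace.isOpen_iUnion_countable
    (fun x : U => Metric.eball (x : E) (ε x)) (fun x => Metric.isOpen_eball)
  have : U = ⋃ x ∈ T, Metric.eball (x : E) (ε x) := by
    rw [hTU]
    refine Set.Subset.antisymm (fun x hx => ?_) (Set.iUnion_subset fun x => hU' x)
    exact Set.mem_iUnion.2 ⟨⟨x, hx⟩, Metric.mem_eball_self (hε _)⟩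
  rw [this, Set.preimage_iUnion₂]
  exact MeasurableSet.biUnion hT fun x _ => (h x) measurableSet_Iio

theorem measurable_eLpNorm_slice {f : ℝ × (ℝ × ℝ) → ℂ} (hf : StronglyMeasurable f) (c : L2R2) :
    Measurable fun b => eLpNorm (fun y => f (b, y) - c y) 2 volume := by
  simp only [eLpNorm_two]
  have h1 : Measurable fun z : ℝ × (ℝ × ℝ) => ‖f z - c z.2‖ₑ ^ (2 : ℝ) :=
    ((hf.sub ((Lp.stronglyMeasurable c).comp_measurable measurable_snd)).enorm).pow_const _
  exact h1.lintegral_prod_right'.pow_const _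

theorem stronglyMeasurable_slice {f : ℝ × (ℝ × ℝ) → ℂ} (hf : StronglyMeasurable f) :
    StronglyMeasurable (slice f) := by
  let _ : MeasurableSpace L2R2 := borel _
  have : BorelSpace L2R2 := ⟨rfl⟩
  refine Measurable.stronglyMeasurable (measurable_of_edist fun c => ?_)
  have hs : ∀ b, AEStronglyMeasurable (fun y => f (b, y)) volume := fun b =>
    (hf.comp_measurable measurable_prodMk_left).aestronglyMeasurable
  have hN : MeasurableSet {b | MemLp (fun y => f (b, y)) 2 volume} := by
    have h0 := measurable_eLpNorm_slice hf 0
    have : {b | MemLp (fun y => f (b, y)) 2 volume}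
        = {b | eLpNorm (fun y => f (b, y) - (0 : L2R2) y) 2 volume < ∞} := by
      ext b
      have : eLpNorm (fun y => f (b, y) - (0 : L2R2) y) 2 volume
          = eLpNorm (fun y => f (b, y)) 2 volume := by
        refine eLpNorm_congr_ae ?_
        filter_upwards [Lp.coeFn_zero ℂ 2 (volume : Measure (ℝ × ℝ))] with y hy
        rw [hy]; simp
      change _ ↔ eLpNorm _ 2 volume < ∞
      rw [this]
      exact ⟨fun h => h.2, fun h => ⟨hs b, h⟩⟩
    rw [this]
    exact h0 measurableSet_Iio
  classical
  have : (fun b => edist (slice f b) c) = fun b =>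
      if b ∈ {b | MemLp (fun y => f (b, y)) 2 volume} then
        eLpNorm (fun y => f (b, y) - c y) 2 volume else edist 0 c := by
    ext b
    split_ifs with h
    · rw [Lp.edist_def]
      refine eLpNorm_congr_ae ?_
      filter_upwards [slice_coeFn h] with y hy
      simp [hy]
    · have h' : ¬ MemLp (fun y => f (b, y)) 2 volume := h
      rw [slice, dif_neg h']
  rw [this]
  exact Measurable.ite hN (measurable_eLpNorm_slice hf c) measurable_const

theorem lintegral_enorm_sq_prod {f : ℝ × (ℝ × ℝ) → ℂ} (hf : StronglyMeasurable f) :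
    ∫⁻ b, ∫⁻ y, ‖f (b, y)‖ₑ ^ (2 : ℝ) = eLpNorm f 2 volume ^ (2 : ℝ) := by
  rw [eLpNorm_two_sq]
  exact (lintegral_prod (μ := (volume : Measure ℝ)) (ν := (volume : Measure (ℝ × ℝ)))
    (fun z => ‖f z‖ₑ ^ (2 : ℝ)) (hf.enorm.pow_const _).aemeasurable).symm

theorem ae_memLp_slice (ξ : L2R3) :
    ∀ᵐ b : ℝ, MemLp (fun y => ξ (b, y)) 2 volume := by
  have hf := Lp.stronglyMeasurable ξ
  have h1 : ∫⁻ b, ∫⁻ y, ‖ξ (b, y)‖ₑ ^ (2 : ℝ) ≠ ∞ := by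
    rw [lintegral_enorm_sq_prod hf]
    exact ENNReal.rpow_ne_top_of_nonneg (by norm_num) (Lp.memLp ξ).2.ne
  have h2 : Measurable fun b : ℝ => ∫⁻ y : ℝ × ℝ, ‖ξ (b, y)‖ₑ ^ (2 : ℝ) :=
    (hf.enorm.pow_const _).lintegral_prod_right'
  filter_upwards [ae_lt_top h2 h1] with b hb
  refine ⟨(hf.comp_measurable measurable_prodMk_left).aestronglyMeasurable, ?_⟩
  rw [eLpNorm_two]
  exact ENNReal.rpow_lt_top_of_nonneg (by norm_num) hb.ne

theorem eLpNorm_slice (ξ : L2R3) : eLpNorm (slice ξ) 2 volume = eLpNorm ξ 2 volume := by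
  rw [eLpNorm_two]
  have : ∫⁻ b, ‖slice ξ b‖ₑ ^ (2 : ℝ) = ∫⁻ b, ∫⁻ y, ‖ξ (b, y)‖ₑ ^ (2 : ℝ) := by
    refine lintegral_congr_ae ?_
    filter_upwards [ae_memLp_slice ξ] with b hb
    rw [Lp.enorm_def, eLpNorm_congr_ae (slice_coeFn hb), eLpNorm_two_sq]
  rw [this, lintegral_enorm_sq_prod (Lp.stronglyMeasurable ξ), ← ENNReal.rpow_mul]
  norm_num

theorem memLp_slice (ξ : L2R3) : MemLp (slice ξ) 2 volume :=
  ⟨(stronglyMeasurable_slice (Lp.stronglyMeasurable ξ)).aestronglyMeasurable, by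
    rw [eLpNorm_slice]; exact (Lp.memLp ξ).2⟩

/-- The canonical isometry `L²(ℝ × ℝ²) → L²(ℝ, L²(ℝ²))`, `ξ ↦ (b ↦ ξ(b, ·))`. -/
def curryL2 : L2R3 →ₗᵢ[ℂ] HTau where
  toFun ξ := (memLp_slice ξ).toLp _
  map_add' ξ η := by
    rw [← MemLp.toLp_add]
    refine MemLp.toLp_congr _ _ ?_
    have h := Measure.ae_ae_of_ae_prod (Lp.coeFn_add ξ η)
    filter_upwards [h, ae_memLp_slice ξ, ae_memLp_slice η, ae_memLp_slice (ξ + η)]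
      with b hb h1 h2 h3
    rw [Pi.add_apply]
    refine Lp.ext ?_
    filter_upwards [hb, slice_coeFn h1, slice_coeFn h2, slice_coeFn h3,
      Lp.coeFn_add (slice ξ b) (slice η b)] with y e0 e1 e2 e3 e4
    rw [e3, e4, Pi.add_apply, e1, e2, e0, Pi.add_apply]
  map_smul' c ξ := by
    rw [RingHom.id_apply, ← MemLp.toLp_const_smul]
    refine MemLp.toLp_congr _ _ ?_
    have h := Measure.ae_ae_of_ae_prod (Lp.coeFn_smul c ξ)
    filter_upwards [h, ae_memLp_slice ξ, ae_memLp_slice (c • ξ)] with b hb h1 h3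
    rw [Pi.smul_apply]
    refine Lp.ext ?_
    filter_upwards [hb, slice_coeFn h1, slice_coeFn h3, Lp.coeFn_smul c (slice ξ b)]
      with y e0 e1 e3 e4
    rw [e3, e4, Pi.smul_apply, e1, e0, Pi.smul_apply]
  norm_map' ξ := by
    change ‖(memLp_slice ξ).toLp _‖ = ‖ξ‖
    rw [Lp.norm_toLp, eLpNorm_slice, Lp.norm_def]

theorem curryL2_coeFn (ξ : L2R3) :
    ∀ᵐ b : ℝ, ∀ᵐ y : ℝ × ℝ, curryL2 ξ b y = ξ (b, y) := by
  filter_upwards [(memLp_slice ξ).coeFn_toLp, ae_memLp_slice ξ] with b h1 h2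
  change ∀ᵐ y : ℝ × ℝ, ((memLp_slice ξ).toLp _) b y = ξ (b, y)
  rw [h1]
  exact slice_coeFn h2


/-- The change of coordinates `(b, (x, p)) ↦ exp(xX) exp(pP) exp(bB)`; this product equals
`exp(xX) exp(bB) exp(e^{b/2} pP)`. -/
def reorder (z : ℝ × (ℝ × ℝ)) : G0 := G0.mk z.2.1 z.1 (Real.exp (z.1 / 2) * z.2.2)

theorem measurable_reorder : Measurable reorder :=
  (G0.continuous_mk (f := fun z : ℝ × (ℝ × ℝ) => z.2.1) (g := fun z : ℝ × (ℝ × ℝ) => z.1)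
    (h := fun z : ℝ × (ℝ × ℝ) => Real.exp (z.1 / 2) * z.2.2)
    (by fun_prop) (by fun_prop) (by fun_prop)).measurable

theorem lintegral_mul_left_real {g : ℝ → ℝ≥0∞} (hg : Measurable g) {c : ℝ} (hc : 0 < c) :
    ∫⁻ p, ENNReal.ofReal c * g (c * p) = ∫⁻ p, g p := by
  have h := Real.smul_map_volume_mul_left hc.ne'
  rw [abs_of_pos hc] at h
  conv_rhs => rw [← h]
  rw [lintegral_smul_measure, lintegral_map hg (measurable_const_mul c), smul_eq_mul]
  exact lintegral_const_mul _ (hg.comp (measurable_const_mul c))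

theorem lintegral_reorder {g : G0 → ℝ≥0∞} (hg : Measurable g) :
    ∫⁻ z : ℝ × (ℝ × ℝ), ENNReal.ofReal (Real.exp (z.1 / 2)) * g (reorder z) = ∫⁻ u, g u := by
  have h1 : Measurable fun z : ℝ × (ℝ × ℝ) =>
      ENNReal.ofReal (Real.exp (z.1 / 2)) * g (reorder z) := by
    refine Measurable.mul ?_ (hg.comp measurable_reorder)
    fun_prop
  have h2 : ∫⁻ u, g u = ∫⁻ x : ℝ, ∫⁻ b : ℝ, ∫⁻ p : ℝ, g (G0.mk x b p) := by
    have e1 := lintegral_prod (μ := (volume : Measure ℝ)) (ν := (volume : Measure (ℝ × ℝ)))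
      (fun z : ℝ × (ℝ × ℝ) => g (G0.mk z.1 z.2.1 z.2.2)) hg.aemeasurable
    refine Eq.trans e1 (lintegral_congr fun x => ?_)
    exact lintegral_prod (μ := (volume : Measure ℝ)) (ν := (volume : Measure ℝ))
      (fun z : ℝ × ℝ => g (G0.mk x z.1 z.2)) (hg.comp measurable_prodMk_left).aemeasurable
  have h3 : ∫⁻ z : ℝ × (ℝ × ℝ), ENNReal.ofReal (Real.exp (z.1 / 2)) * g (reorder z)
      = ∫⁻ b : ℝ, ∫⁻ x : ℝ, ∫⁻ p : ℝ, g (G0.mk x b p) := by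
    have e1 := lintegral_prod (μ := (volume : Measure ℝ)) (ν := (volume : Measure (ℝ × ℝ)))
      (fun z : ℝ × (ℝ × ℝ) => ENNReal.ofReal (Real.exp (z.1 / 2)) * g (reorder z)) h1.aemeasurable
    refine Eq.trans e1 (lintegral_congr fun b => ?_)
    have e2 := lintegral_prod (μ := (volume : Measure ℝ)) (ν := (volume : Measure ℝ))
      (fun z : ℝ × ℝ => ENNReal.ofReal (Real.exp (b / 2)) * g (reorder (b, z)))
      (h1.comp measurable_prodMk_left).aemeasurable
    refine Eq.trans e2 (lintegral_congr fun x => ?_)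
    have hgx : Measurable fun p : ℝ => g (G0.mk x b p) :=
      hg.comp (G0.continuous_mk (f := fun _ : ℝ => x) (g := fun _ : ℝ => b) (h := fun p : ℝ => p)
        continuous_const continuous_const continuous_id).measurable
    exact lintegral_mul_left_real hgx (Real.exp_pos (b / 2))
  rw [h2, h3]
  refine lintegral_lintegral_swap ?_
  have hm : Measurable fun z : (ℝ × ℝ) × ℝ => g (G0.mk z.1.2 z.1.1 z.2) :=
    hg.comp (G0.continuous_mk (f := fun z : (ℝ × ℝ) × ℝ => z.1.2)
      (g := fun z : (ℝ × ℝ) × ℝ => z.1.1) (h := fun z : (ℝ × ℝ) × ℝ => z.2)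
      (by fun_prop) (by fun_prop) (by fun_prop)).measurable
  exact hm.lintegral_prod_right'.aemeasurable

theorem quasiMeasurePreserving_reorder : Measure.QuasiMeasurePreserving reorder := by
  refine ⟨measurable_reorder, Measure.AbsolutelyContinuous.mk fun A hA h0 => ?_⟩
  rw [Measure.map_apply measurable_reorder hA]
  have h1 := lintegral_reorder (measurable_const.indicator hA : Measurable
    (A.indicator fun _ => (1 : ℝ≥0∞)))
  have hm : Measurable fun z : ℝ × (ℝ × ℝ) =>
      ENNReal.ofReal (Real.exp (z.1 / 2)) * A.indicator (fun _ => (1 : ℝ≥0∞)) (reorder z) := by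
    refine Measurable.mul (by fun_prop) ?_
    exact (measurable_const.indicator hA).comp measurable_reorder
  rw [lintegral_indicator_const hA, h0, mul_zero, lintegral_eq_zero_iff hm] at h1
  refine measure_mono_null (fun z hz => ?_) h1
  have hz' : reorder z ∈ A := hz
  change ¬ (ENNReal.ofReal (Real.exp (z.1 / 2))
    * A.indicator (fun _ => (1 : ℝ≥0∞)) (reorder z) = 0)
  rw [Set.indicator_of_mem hz', mul_one, ENNReal.ofReal_eq_zero, not_le]
  exact Real.exp_pos _

/-- The function `(b, (x, p)) ↦ e^{b/4} ξ(exp(xX) exp(pP) exp(bB))`. -/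
def dilate (ξ : G0 → ℂ) (z : ℝ × (ℝ × ℝ)) : ℂ := (Real.exp (z.1 / 4) : ℂ) * ξ (reorder z)

theorem eLpNorm_dilate (ξ : L2G0) : eLpNorm (dilate ξ) 2 volume = eLpNorm ξ 2 volume := by
  rw [eLpNorm_two, eLpNorm_two, ← lintegral_reorder
    ((Lp.stronglyMeasurable ξ).enorm.pow_const _)]
  congr 1
  refine lintegral_congr fun z => ?_
  rw [dilate, enorm_mul, ENNReal.mul_rpow_of_nonneg _ _ (by norm_num)]
  congr 1
  rw [← ofReal_norm, Complex.norm_real, Real.norm_of_nonneg (Real.exp_pos _).le,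
    ENNReal.ofReal_rpow_of_pos (Real.exp_pos _), ← Real.exp_mul]
  congr 2; ring

theorem memLp_dilate (ξ : L2G0) : MemLp (dilate ξ) 2 volume := by
  refine ⟨?_, by rw [eLpNorm_dilate]; exact (Lp.memLp ξ).2⟩
  have h1 : Measurable fun z : ℝ × (ℝ × ℝ) => (Real.exp (z.1 / 4) : ℂ) := by fun_prop
  exact (h1.mul ((Lp.stronglyMeasurable ξ).measurable.comp
    measurable_reorder)).aestronglyMeasurable

/-- The isometry `L²(G₀) → L²(ℝ × ℝ²)`, `ξ ↦ dilate ξ`. -/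
def dilateL2 : L2G0 →ₗᵢ[ℂ] L2R3 where
  toFun ξ := (memLp_dilate ξ).toLp _
  map_add' ξ η := by
    rw [← MemLp.toLp_add]
    refine MemLp.toLp_congr _ _ ?_
    filter_upwards [quasiMeasurePreserving_reorder.ae (Lp.coeFn_add ξ η)] with z hz
    simp only [dilate, Pi.add_apply]
    rw [hz, Pi.add_apply, mul_add]
  map_smul' c ξ := by
    rw [RingHom.id_apply, ← MemLp.toLp_const_smul]
    refine MemLp.toLp_congr _ _ ?_
    filter_upwards [quasiMeasurePreserving_reorder.ae (Lp.coeFn_smul c ξ)] with z hz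
    simp only [dilate, Pi.smul_apply]
    rw [hz, Pi.smul_apply, smul_eq_mul, smul_eq_mul, mul_left_comm]
  norm_map' ξ := by
    change ‖(memLp_dilate ξ).toLp _‖ = ‖ξ‖
    rw [Lp.norm_toLp, eLpNorm_dilate, Lp.norm_def]

/-- The intertwining isometry `U : L²(G₀) → L²(ℝ, L²(ℝ²))`,
`(U ξ)(b*)(x, p) = ∫ ξ(exp(xX) exp(pP) exp(bB)) e^{b/4} e^{-2πi b* b} db`,
the integral being the `L²`-valued Plancherel–Fourier transform in the variable `b`. -/
def U : L2G0 →ₗᵢ[ℂ] HTau :=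
  (Lp.fourierTransformₗᵢ ℝ L2R2).toLinearIsometry.comp (curryL2.comp dilateL2)

/-- `ρ(T) = U T U*`. -/
def rho (T : L2G0 →L[ℂ] L2G0) : HTau →L[ℂ] HTau :=
  U.toContinuousLinearMap ∘L T ∘L ContinuousLinearMap.adjoint U.toContinuousLinearMap

/-- `C_0(ℝ, 𝒦)`, as a set of operators on `L²(ℝ, L²(ℝ²))`: the operators
`(T ξ)(b*) = φ(b*)(ξ(b*))`, for `φ` a norm-continuous map from `ℝ` to the compact operators on
`L²(ℝ²)` that vanishes at infinity. -/
def C0K : Set (HTau →L[ℂ] HTau) :=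
  {T | ∃ φ : C(ℝ, L2R2 →L[ℂ] L2R2), (∀ t, IsCompactOperator (φ t)) ∧
    Tendsto (fun t => ‖φ t‖) (cocompact ℝ) (𝓝 0) ∧ ∀ ξ : HTau, ∀ᵐ t : ℝ, T ξ t = φ t (ξ t)}

/-! ### The operators `σ_{ε,δ,D}(a)` -/

/-- The half-open interval `I_{c,n} = [cn, cn + c)`. -/
def I (c : ℝ) (n : ℤ) : Set ℝ := Set.Ico (c * n) (c * n + c)

/-- The set `S_{δ,D,3,k}`, where `r` stands for `r_δ`. -/
def setS (r δ D : ℝ) (k : ℤ × ℤ × ℤ) : Set G0 :=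
  {u | Real.exp (-u.x) ≤ δ ^ 6 ∧ u.x ∈ I r k.1 ∧ u.b ∈ I r k.2.1 ∧
    u.p ∈ I (D * δ ^ 2 * Real.exp (r / 2 * (k.1 + k.2.1))) k.2.2}

/-- The set `R_{δ,D,3,k}`, the union of the sets `S_{δ, D e^{r(-j₁-j₂)/2}, 3, k+j}` over the
`j ∈ {-1, 0, 1}³`. -/
def setR (r δ D : ℝ) (k : ℤ × ℤ × ℤ) : Set G0 :=
  ⋃ j ∈ {j : ℤ × ℤ × ℤ | |j.1| ≤ 1 ∧ |j.2.1| ≤ 1 ∧ |j.2.2| ≤ 1},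
    setS r δ (D * Real.exp (r / 2 * (-j.1 - j.2.1))) (k + j)

theorem measurableSet_setS (r δ D : ℝ) (k : ℤ × ℤ × ℤ) : MeasurableSet (setS r δ D k) := by
  refine MeasurableSet.inter ?_ (MeasurableSet.inter ?_ (MeasurableSet.inter ?_ ?_))
  · exact measurableSet_le (by fun_prop : Continuous fun u : G0 => Real.exp (-u.x)).measurable
      measurable_const
  · exact G0.continuous_x.measurable measurableSet_Ico
  · exact G0.continuous_b.measurable measurableSet_Ico
  · exact G0.continuous_p.measurable measurableSet_Ico

theorem measurableSet_setR (r δ D : ℝ) (k : ℤ × ℤ × ℤ) : MeasurableSet (setR r δ D k) :=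
  MeasurableSet.biUnion (Set.to_countable _) fun _ _ => measurableSet_setS _ _ _ _

/-- The `k`-th term `P_{δ,D,3,k} σ_{c_k ε Q*}(a) M_{δ,D,3,k}`, where
`c_k = k₃² δ⁴ D² e^{r(k₁+k₂)} / 2` and `r` stands for `r_δ`. -/
def sigmaTerm (ε r δ D : ℝ) (a : CStarG) (k : ℤ × ℤ × ℤ) : L2G0 →L[ℂ] L2G0 :=
  mulInd volume (setR r δ D k) (measurableSet_setR r δ D k) ∘L
    sigma (Qstar ((k.2.2 : ℝ) ^ 2 * δ ^ 4 * D ^ 2 * Real.exp (r * (k.1 + k.2.1)) / 2 * ε)) a ∘L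
      mulInd volume (setS r δ D k) (measurableSet_setS r δ D k)

open Classical in
/-- The operator `σ_{ε,δ,D}(a) = ∑_{k ∈ ℤ³} P_{δ,D,3,k} σ_{c_k ε Q*}(a) M_{δ,D,3,k}`, the sum being
unconditionally convergent in the strong operator topology (and `0` if the sum does not define a
bounded operator). -/
def sigmaDelta (ε r δ D : ℝ) (a : CStarG) : L2G0 →L[ℂ] L2G0 :=
  if h : ∃ T : L2G0 →L[ℂ] L2G0, ∀ ξ, HasSum (fun k => sigmaTerm ε r δ D a k ξ) (T ξ) then
    h.choose
  else 0

end N628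

end

/-! The terms of the sum cut on the right by disjoint sets S and on the left by sets R of which at
most 27 contain a given point. Such a sum is almost orthogonal: it converges strongly and
unconditionally, with norm at most √27 ‖a‖ whatever `δ` is. The elements `a` for which the limit
holds therefore form a closed subspace, and it is enough to treat the indicator of a box in G₀ times
a window in span(Q, R, S), since these are total in L¹(G).

For such an indicator, integrating first over the window gives σ_l(a) = L ∘ M_l (`sigma_boxElt`).
Here L averages left translations over the box and does not depend on l, and M_l multiplies by the
Fourier transform of the window at the point l ∘ Ad(v⁻¹) of the coadjoint orbit. Put y = p
e^{-(x+b)/2} and e = e^{-x/2}. The orbit point of εS* is ε(y²/2, -ye, e²), and that of c_k εQ* is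
ε(z²/2, 0, 0), where |y - z| ≤ Dδ² and e ≤ δ³ on the k-th set S. The orbit points need not be
uniformly close, because y is unbounded, but the two multipliers are (`norm_mult_sub_le`): for large
y and z both are small by Riemann–Lebesgue, and otherwise both variables are bounded and the
Lipschitz estimate applies. Moreover a translate of S by an element of the box stays in R unless it
leaves the half space X = {e^{-x} ≤ δ⁶} (`mul_mem_setR_iff`), because e^{r}δ tends to 0. Hence
σ_{ε,δ,D}(a) is norm close to the compression 1_X L ψ 1_X, where ψ is the multiplier of εS*
(`norm_sigmaDelta_boxElt_sub_le`).

It remains to compare Lψ with that compression modulo C₀(ℝ, 𝒦) (`infDist_L_sub_compression_le`).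
Deep inside X the compression changes nothing. Outside that region either ψ is small, or the point
lies over a bounded part of the (x, p)-plane. The bounded part gives an element of C₀(ℝ, 𝒦): the
orbit point of S* does not depend on b in the coordinates exp(xX)exp(pP)exp(bB), so multiplication
by a function of it is a constant field of operators under U, while a left translation becomes
e^{-2πi b s} times a fixed unitary of L²(ℝ²). Averaging over (x, p) makes the fibre operator
Hilbert–Schmidt, and averaging over b is a Fourier transform of an integrable norm-continuous
family, so Riemann–Lebesgue gives continuity and decay in s. -/

noncomputable section

namespace N628

/-! ### Vector-valued integrals in L², computed pointwise -/

section LpIntegral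

variable {Y α E : Type*} [MeasurableSpace Y] [MeasurableSpace α] [NormedAddCommGroup E]

/-- Cauchy–Schwarz against the indicator of `A`. It makes L² functions integrable on sets of finite
measure, which is where pointwise identities of L² elements are tested. -/
theorem integral_norm_restrict_le {μ : Measure α} (A : Set α) (hA : μ A ≠ ∞)
    {f : α → E} (hf : MemLp f 2 μ) :
    IntegrableOn f A μ ∧
      ∫ x in A, ‖f x‖ ∂μ ≤ (eLpNorm f 2 μ).toReal * ((μ A) ^ (1 / 2 : ℝ)).toReal := by
  have h1 : eLpNorm f 1 (μ.restrict A) ≤ eLpNorm f 2 μ * (μ A) ^ (1 / 2 : ℝ) := by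
    have := eLpNorm_le_eLpNorm_mul_rpow_measure_univ (μ := μ.restrict A) (p := 1) (q := 2)
      (f := f) (by norm_num) hf.1.restrict
    rw [Measure.restrict_apply_univ] at this
    norm_num at this
    refine this.trans ?_
    rw [one_div]
    exact mul_le_mul_left (eLpNorm_restrict_le f 2 μ A) _
  have h2 : eLpNorm f 2 μ * (μ A) ^ (1 / 2 : ℝ) ≠ ∞ :=
    ENNReal.mul_ne_top hf.2.ne (ENNReal.rpow_ne_top_of_nonneg (by norm_num) hA)
  have hi : MemLp f 1 (μ.restrict A) := ⟨hf.1.restrict, h1.trans_lt h2.lt_top⟩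
  refine ⟨memLp_one_iff_integrable.1 hi, ?_⟩
  rw [integral_norm_eq_lintegral_enorm hf.1.restrict, ← eLpNorm_one_eq_lintegral_enorm,
    ← ENNReal.toReal_mul]
  exact ENNReal.toReal_mono h2 h1

variable [NormedSpace ℂ E]

/-- The functional `f ↦ ∫_A f` on `L²`, for a set `A` of finite measure. -/
def setIntegralCLM [CompleteSpace E] (μ : Measure α) (A : Set α) (hA : μ A ≠ ∞) :
    Lp E 2 μ →L[ℂ] E :=
  LinearMap.mkContinuous
    { toFun := fun f => ∫ x in A, f x ∂μ
      map_add' := fun f g => by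
        rw [← integral_add (integral_norm_restrict_le A hA (Lp.memLp f)).1
          (integral_norm_restrict_le A hA (Lp.memLp g)).1]
        exact integral_congr_ae (ae_restrict_of_ae (Lp.coeFn_add f g))
      map_smul' := fun c f => by
        rw [RingHom.id_apply, ← integral_smul]
        exact integral_congr_ae (ae_restrict_of_ae (Lp.coeFn_smul c f)) }
    ((μ A) ^ (1 / 2 : ℝ)).toReal (fun f => by
      rw [mul_comm, Lp.norm_def]
      exact (norm_integral_le_integral_norm _).trans
        (integral_norm_restrict_le A hA (Lp.memLp f)).2)

theorem setIntegralCLM_apply [CompleteSpace E] (μ : Measure α) (A : Set α) (hA : μ A ≠ ∞)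
    (f : Lp E 2 μ) : setIntegralCLM μ A hA f = ∫ x in A, f x ∂μ := rfl

/-- A Bochner integral of `L²` functions can be computed pointwise. -/
theorem integral_Lp_coeFn [CompleteSpace E] {ν : Measure Y} [SFinite ν] {μ : Measure α}
    [SigmaFinite μ] {G : Y → Lp E 2 μ} (hG : Integrable G ν) {Ψ : Y → α → E}
    (hΨ : AEStronglyMeasurable (Function.uncurry Ψ) (ν.prod μ))
    (h : ∀ᵐ y ∂ν, G y =ᵐ[μ] Ψ y) :
    (∫ y, G y ∂ν : Lp E 2 μ) =ᵐ[μ] fun x => ∫ y, Ψ y x ∂ν := by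
  -- Integrability on the product is available only after cutting to a set of finite measure. That
  -- is enough for Fubini, and such sets determine a function almost everywhere when `μ` is
  -- σ-finite.
  have key : ∀ A : Set α, MeasurableSet A → μ A < ∞ →
      Integrable (Function.uncurry Ψ) (ν.prod (μ.restrict A)) := fun A hA hA' => by
    have hm : AEStronglyMeasurable (Function.uncurry Ψ) (ν.prod (μ.restrict A)) :=
      hΨ.mono_ac (Measure.AbsolutelyContinuous.rfl.prod Measure.restrict_le_self.absolutelyContinuous)
    rw [integrable_prod_iff hm]
    have hb := fun y => integral_norm_restrict_le A hA'.ne (Lp.memLp (G y))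
    refine ⟨?_, ?_⟩
    · filter_upwards [h] with y hy
      exact (hb y).1.congr (ae_restrict_of_ae hy)
    · refine (hG.norm.mul_const ((μ A) ^ (1 / 2 : ℝ)).toReal).mono
        hm.norm.integral_prod_right' ?_
      filter_upwards [h] with y hy
      rw [Real.norm_of_nonneg (integral_nonneg fun _ => norm_nonneg _),
        Real.norm_of_nonneg (by positivity), Lp.norm_def]
      refine (le_of_eq (integral_congr_ae ?_)).trans (hb y).2
      filter_upwards [ae_restrict_of_ae hy] with x hx
      rw [hx]; rfl
  refine ae_eq_of_forall_setIntegral_eq_of_sigmaFinite (fun A hA hA' => ?_)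
    (fun A hA hA' => ?_) (fun A hA hA' => ?_)
  · exact (integral_norm_restrict_le A hA'.ne (Lp.memLp _)).1
  · exact (key A hA hA').integral_prod_right
  · have e1 : ∫ x in A, (∫ y, G y ∂ν : Lp E 2 μ) x ∂μ = ∫ y, ∫ x in A, Ψ y x ∂μ ∂ν := by
      rw [← setIntegralCLM_apply μ A hA'.ne, ← ContinuousLinearMap.integral_comp_comm _ hG]
      refine integral_congr_ae ?_
      filter_upwards [h] with y hy
      rw [setIntegralCLM_apply]
      exact integral_congr_ae (ae_restrict_of_ae hy)
    rw [e1]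
    exact integral_integral_swap (key A hA hA')

end LpIntegral

/-! ### A pointwise criterion for Hilbert–Schmidt operators -/

section HilbertSchmidt

theorem norm_sq_eq_integral {α : Type*} [MeasurableSpace α] {μ : Measure α} (f : Lp ℂ 2 μ) :
    ‖f‖ ^ 2 = ∫ x, ‖f x‖ ^ 2 ∂μ := by
  have h2 := inner_self_eq_norm_sq_to_K (𝕜 := ℂ) f
  rw [L2.inner_def] at h2
  simp only [inner_self_eq_norm_sq_to_K] at h2
  have h3 : ∫ x, (((‖f x‖ ^ 2 : ℝ)) : ℂ) ∂μ = ((‖f‖ ^ 2 : ℝ) : ℂ) := by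
    simpa using h2
  have h4 := h3.symm.trans (integral_ofReal (𝕜 := ℂ) (μ := μ) (f := fun x => ‖f x‖ ^ 2))
  exact Complex.ofReal_injective h4

theorem integrable_norm_sq {α : Type*} [MeasurableSpace α] {μ : Measure α} (f : Lp ℂ 2 μ) :
    Integrable (fun x => ‖f x‖ ^ 2) μ :=
  (Lp.memLp f).integrable_norm_pow (by norm_num)

variable {α H : Type*} [MeasurableSpace α] [NormedAddCommGroup H] [InnerProductSpace ℂ H]

/-- An operator with values in `L²` dominated pointwise is Hilbert–Schmidt. -/
theorem sum_norm_sq_le_of_pointwise {μ : Measure α} (T : H →L[ℂ] Lp ℂ 2 μ) {g : α → ℝ}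
    (hg : MemLp g 2 μ) (hT : ∀ ζ : H, ∀ᵐ x ∂μ, ‖T ζ x‖ ≤ g x * ‖ζ‖)
    {ι : Type*} (e : ι → H) (he : Orthonormal ℂ e) (s : Finset ι) :
    ∑ i ∈ s, ‖T (e i)‖ ^ 2 ≤ ∫ x, g x ^ 2 ∂μ := by
  classical
  have hnorm : ∀ c : s → ℂ, ‖∑ i : s, c i • e i‖ ^ 2 = ∑ i, ‖c i‖ ^ 2 := fun c => by
    have := (he.comp _ Subtype.val_injective : Orthonormal ℂ fun i : s => e i).inner_sum c c
      Finset.univ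
    have h2 := inner_self_eq_norm_sq_to_K (𝕜 := ℂ) (∑ i : s, c i • e i)
    simp only [Function.comp_apply] at this
    rw [this] at h2
    have h3 : ∀ i : s, (starRingEnd ℂ) (c i) * c i = ((‖c i‖ ^ 2 : ℝ) : ℂ) := fun i => by
      rw [Complex.conj_mul']; norm_cast
    simp only [h3] at h2
    refine Complex.ofReal_injective (Eq.trans ?_ (h2.symm.trans ?_))
    · push_cast; rfl
    · push_cast; rfl
  have hlin : ∀ c : s → ℂ, ∀ᵐ x ∂μ,
      ‖∑ i : s, c i * T (e i) x‖ ≤ g x * Real.sqrt (∑ i, ‖c i‖ ^ 2) := fun c => by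
    have h1 : ∀ᵐ x ∂μ, T (∑ i : s, c i • e i) x = ∑ i : s, c i * T (e i) x := by
      rw [map_sum]
      have h2 := Lp.coeFn_finsetSum (Finset.univ : Finset s) (fun i : s => T (c i • e i))
      have h3 : ∀ᵐ x ∂μ, ∀ i : s, T (c i • e i) x = c i * T (e i) x := by
        rw [ae_all_iff]
        intro i
        rw [map_smul]
        exact Lp.coeFn_smul _ _
      filter_upwards [h2, h3] with x hx hx'
      rw [hx, Finset.sum_apply]
      exact Finset.sum_congr rfl fun i _ => hx' i
    filter_upwards [h1, hT (∑ i : s, c i • e i)] with x hx hx'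
    rw [← hx, ← hnorm, Real.sqrt_sq (norm_nonneg _)]
    exact hx'
  -- The exceptional null set of `hlin` depends on the coefficients `c`. A countable dense set of
  -- coefficient vectors gives one null set, and both sides are continuous in `c`.
  have hall : ∀ᵐ x ∂μ, ∑ i : s, ‖T (e i) x‖ ^ 2 ≤ g x ^ 2 := by
    have h1 : ∀ᵐ x ∂μ, ∀ n : ℕ, ‖∑ i : s, TopologicalSpace.denseSeq (s → ℂ) n i * T (e i) x‖
        ≤ g x * Real.sqrt (∑ i, ‖TopologicalSpace.denseSeq (s → ℂ) n i‖ ^ 2) := by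
      rw [ae_all_iff]
      exact fun n => hlin _
    filter_upwards [h1] with x hx
    have h2 : ∀ c : s → ℂ, ‖∑ i : s, c i * T (e i) x‖ ≤ g x * Real.sqrt (∑ i, ‖c i‖ ^ 2) := by
      intro c
      refine DenseRange.induction_on (p := fun c : s → ℂ =>
        ‖∑ i : s, c i * T (e i) x‖ ≤ g x * Real.sqrt (∑ i, ‖c i‖ ^ 2))
        (TopologicalSpace.denseRange_denseSeq (s → ℂ)) c ?_ hx
      exact isClosed_le (by fun_prop) (by fun_prop)
    -- Conjugate coefficients are the extremal choice: the estimate becomes S ≤ g(x)√S, where S is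
    -- the sum to be bounded.
    have h3 := h2 fun i => (starRingEnd ℂ) (T (e i) x)
    have h4 : ∑ i : s, (starRingEnd ℂ) (T (e i) x) * T (e i) x
        = ((∑ i : s, ‖T (e i) x‖ ^ 2 : ℝ) : ℂ) := by
      push_cast
      exact Finset.sum_congr rfl fun i _ => by rw [Complex.conj_mul']
    have h0 : 0 ≤ ∑ i : s, ‖T (e i) x‖ ^ 2 := Finset.sum_nonneg fun _ _ => sq_nonneg _
    rw [h4, Complex.norm_real, Real.norm_of_nonneg h0] at h3
    simp only [RCLike.norm_conj] at h3
    set S := ∑ i : s, ‖T (e i) x‖ ^ 2 with hS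
    have h5 := Real.sq_sqrt h0
    rcases (Real.sqrt_nonneg S).eq_or_lt with h6 | h6
    · rw [← h5, ← h6]; simpa using sq_nonneg (g x)
    · have : Real.sqrt S ≤ g x := by
        refine le_of_mul_le_mul_right ?_ h6
        rw [← sq, h5]; exact h3
      rw [← h5]; gcongr
  rw [← Finset.sum_coe_sort]
  simp only [norm_sq_eq_integral]
  rw [← integral_finsetSum _ fun i _ => integrable_norm_sq _]
  refine integral_mono_ae (integrable_finsetSum _ fun i _ => integrable_norm_sq _) ?_ hall
  simpa [Real.norm_eq_abs, sq_abs] using hg.integrable_norm_pow (by norm_num)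

/-- The squared norms of `T` along a Hilbert basis are summable, so the finite-rank truncations
converge to `T` in norm and `T` is a norm limit of compact operators. -/
theorem isCompactOperator_of_pointwise [CompleteSpace H] {μ : Measure α} (T : H →L[ℂ] Lp ℂ 2 μ) {g : α → ℝ}
    (hg : MemLp g 2 μ) (hT : ∀ ζ : H, ∀ᵐ x ∂μ, ‖T ζ x‖ ≤ g x * ‖ζ‖) :
    IsCompactOperator T := by
  classical
  obtain ⟨w, b, hb⟩ := exists_hilbertBasis ℂ H
  have hsum : Summable fun i => ‖T (b i)‖ ^ 2 :=
    summable_of_sum_le (fun _ => sq_nonneg _)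
      (sum_norm_sq_le_of_pointwise T hg hT b b.orthonormal)
  let P : Finset w → H →L[ℂ] Lp ℂ 2 μ := fun s =>
    ∑ i ∈ s, (innerSL ℂ (b i)).smulRight (T (b i))
  have hP : ∀ s, IsCompactOperator (P s) := fun s => by
    have : P s ∈ compactOperator (RingHom.id ℂ) H (Lp ℂ 2 μ) := by
      refine Submodule.sum_mem _ fun i _ => ?_
      change IsCompactOperator _
      have h1 : IsCompactOperator (ContinuousLinearMap.toSpanSingleton ℂ (T (b i))) :=
        ⟨_, (isCompact_closedBall (0 : ℂ) 1).image
          (ContinuousLinearMap.toSpanSingleton ℂ (T (b i))).continuous,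
          Filter.mem_of_superset (Metric.closedBall_mem_nhds 0 one_pos)
            (Set.subset_preimage_image _ _)⟩
      exact h1.comp_clm (innerSL ℂ (b i))
    exact this
  have hbound : ∀ s : Finset w, ‖T - P s‖ ≤ Real.sqrt (∑' i : {i // i ∉ s}, ‖T (b i)‖ ^ 2) := by
    intro s
    refine ContinuousLinearMap.opNorm_le_bound _ (Real.sqrt_nonneg _) fun ζ => ?_
    have h1 : HasSum (fun i => b.repr ζ i • T (b i)) (T ζ) := by
      simpa using (b.hasSum_repr ζ).mapL T
    -- The remainder is a limit of finite sums off `s`. Each of them is estimated by Cauchy–Schwarz,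
    -- with Bessel for the coefficients and the tail of the Hilbert–Schmidt sum for the rest.
    have h2 : Tendsto (fun t : Finset w => ∑ i ∈ t \ s, b.repr ζ i • T (b i)) atTop
        (𝓝 ((T - P s) ζ)) := by
      have h3 : P s ζ = ∑ i ∈ s, b.repr ζ i • T (b i) := by
        simp only [P, sum_apply]
        refine Finset.sum_congr rfl fun i _ => ?_
        simp [b.repr_apply_apply]
      rw [sub_apply, h3]
      refine (Tendsto.sub_const h1 _).congr' ?_
      filter_upwards [eventually_ge_atTop s] with t ht
      rw [Finset.sum_sdiff_eq_sub ht]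
    refine le_of_tendsto h2.norm (Eventually.of_forall fun t => ?_)
    calc ‖∑ i ∈ t \ s, b.repr ζ i • T (b i)‖
        ≤ ∑ i ∈ t \ s, ‖b.repr ζ i‖ * ‖T (b i)‖ :=
          (norm_sum_le _ _).trans (Finset.sum_le_sum fun i _ => norm_smul_le _ _)
      _ ≤ Real.sqrt (∑ i ∈ t \ s, ‖b.repr ζ i‖ ^ 2) * Real.sqrt (∑ i ∈ t \ s, ‖T (b i)‖ ^ 2) :=
          Real.sum_mul_le_sqrt_mul_sqrt _ _ _
      _ ≤ ‖ζ‖ * Real.sqrt (∑' i : {i // i ∉ s}, ‖T (b i)‖ ^ 2) := by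
          gcongr
          · have h4 := b.orthonormal.sum_inner_products_le ζ (s := t \ s)
            simp only [← b.repr_apply_apply] at h4
            calc _ ≤ Real.sqrt (‖ζ‖ ^ 2) := Real.sqrt_le_sqrt h4
              _ = ‖ζ‖ := Real.sqrt_sq (norm_nonneg _)
          · have h5 : Summable fun i : {i // i ∉ s} => ‖T (b i)‖ ^ 2 := hsum.subtype _
            have h6 : ∑ i ∈ t \ s, ‖T (b i)‖ ^ 2
                = ∑ i ∈ (t \ s).subtype (fun i => i ∉ s), ‖T (b i)‖ ^ 2 := by
              rw [Finset.sum_subtype_of_mem (fun i => ‖T (b i)‖ ^ 2)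
                fun i hi => (Finset.mem_sdiff.1 hi).2]
            rw [h6]
            exact h5.sum_le_tsum _ fun _ _ => sq_nonneg _
      _ = _ := mul_comm _ _
  have hlim : Tendsto P atTop (𝓝 T) := by
    rw [tendsto_iff_norm_sub_tendsto_zero]
    have h1 := (tendsto_tsum_compl_atTop_zero fun i => ‖T (b i)‖ ^ 2).sqrt
    rw [Real.sqrt_zero] at h1
    refine squeeze_zero (fun _ => norm_nonneg _) (fun s => ?_) h1
    rw [norm_sub_rev]
    exact hbound s
  exact isCompactOperator_of_tendsto hlim (Eventually.of_forall hP)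

end HilbertSchmidt

/-! ### From strong to norm continuity through compactness -/

section StrongNorm

variable {Y H : Type*} [TopologicalSpace Y] [NormedAddCommGroup H] [NormedSpace ℂ H]

/-- A strongly continuous family of contractions becomes norm continuous after composition with a
compact operator. -/
theorem continuous_comp_of_isCompactOperator {D : Y → H →L[ℂ] H} (hD : ∀ ζ, Continuous fun y => D y ζ)
    (hD1 : ∀ y ζ, ‖D y ζ‖ ≤ ‖ζ‖) {K : H →L[ℂ] H} (hK : IsCompactOperator K) :
    Continuous fun y => D y ∘L K := by
  have htb : TotallyBounded (K '' Metric.closedBall 0 1) :=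
    ((hK.isCompact_closure_image_closedBall 1).totallyBounded).subset subset_closure
  rw [continuous_iff_continuousAt]
  intro y₀
  rw [ContinuousAt, Metric.tendsto_nhds]
  intro ε hε
  -- Strong convergence is uniform on a finite net of the image of the unit ball. The net costs ε/4
  -- for each of the two operators and the convergence another ε/4, hence 3ε/4 below.
  obtain ⟨t, ht, hcov⟩ := Metric.totallyBounded_iff.1 htb (ε / 4) (by positivity)
  have h1 : ∀ᶠ y in 𝓝 y₀, ∀ c ∈ t, dist (D y c) (D y₀ c) < ε / 4 :=
    (ht.eventually_all).2 fun c _ => Metric.tendsto_nhds.1 ((hD c).tendsto y₀) _ (by positivity)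
  filter_upwards [h1] with y hy
  rw [dist_eq_norm]
  refine lt_of_le_of_lt (?_ : _ ≤ 3 * ε / 4) (by linarith)
  refine ContinuousLinearMap.opNorm_le_of_unit_norm (by positivity) fun ζ hζ => ?_
  obtain ⟨c, hc, hcd⟩ := Set.mem_iUnion₂.1 (hcov ⟨ζ, by simp [hζ], rfl⟩)
  rw [Metric.mem_ball, dist_eq_norm] at hcd
  have e : (D y ∘L K - D y₀ ∘L K) ζ
      = D y (K ζ - c) + (D y c - D y₀ c) - D y₀ (K ζ - c) := by
    simp
  rw [e]
  have h2 := hy c hc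
  rw [dist_eq_norm] at h2
  have h3 := hD1 y (K ζ - c)
  have h4 := hD1 y₀ (K ζ - c)
  have := norm_sub_le (D y (K ζ - c) + (D y c - D y₀ c)) (D y₀ (K ζ - c))
  have := norm_add_le (D y (K ζ - c)) (D y c - D y₀ c)
  linarith

end StrongNorm

/-! ### Indicators of a generating π-system span L¹ -/

section Density

variable {α : Type*} [mα : MeasurableSpace α] {μ : Measure α}

/-- Continuity from above for `A \ B n`: these sets decrease to the empty set and have finite
measure, so the indicators converge in L¹. -/
theorem indicatorConstLp_mem_of_monotone {𝒮 : Submodule ℂ (Lp ℂ 1 μ)}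
    (hcl : IsClosed (𝒮 : Set (Lp ℂ 1 μ))) {B : ℕ → Set α} {A : Set α}
    (hBm : ∀ n, MeasurableSet (B n)) (hA : MeasurableSet A) (hμ : μ A ≠ ∞) (hmono : Monotone B)
    (hU : ⋃ n, B n = A)
    (h : ∀ n (hμ : μ (B n) ≠ ∞), indicatorConstLp 1 (hBm n) hμ (1 : ℂ) ∈ 𝒮) :
    indicatorConstLp 1 hA hμ (1 : ℂ) ∈ 𝒮 := by
  have hsub : ∀ n, B n ⊆ A := fun n => hU ▸ Set.subset_iUnion B n
  have hfin : ∀ n, μ (B n) ≠ ∞ := fun n => measure_ne_top_of_subset (hsub n) hμ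
  refine hcl.mem_of_tendsto (b := atTop) (tendsto_indicatorConstLp_set (ht := hBm) (hμt := hfin)
    (by simp) ?_) (Eventually.of_forall fun n => h n (hfin n))
  have e3 : ∀ n, symmDiff (B n) A = A \ B n := fun n => by
    rw [Set.symmDiff_def, Set.sdiff_eq_empty.2 (hsub n), Set.empty_union]
  simp only [e3]
  have h1 := tendsto_measure_iInter_atTop (μ := μ) (s := fun n => A \ B n)
    (fun n => (hA.diff (hBm n)).nullMeasurableSet)
    (fun a b hab => Set.sdiff_subset_sdiff_right (hmono hab))
    ⟨0, measure_ne_top_of_subset Set.sdiff_subset hμ⟩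
  rw [← Set.sdiff_iUnion, hU, Set.sdiff_self, measure_empty] at h1
  exact h1

/-- A closed subspace of `L¹` that contains the indicators of the sets of a generating π-system,
cut by an exhausting sequence of sets of finite measure, is everything. -/
theorem submodule_eq_top_of_indicator_mem (𝒮 : Submodule ℂ (Lp ℂ 1 μ))
    (hcl : IsClosed (𝒮 : Set (Lp ℂ 1 μ))) {C : Set (Set α)}
    (hgen : mα = MeasurableSpace.generateFrom C) (hpi : IsPiSystem C) (huniv : Set.univ ∈ C)
    {K : ℕ → Set α} (hKm : ∀ n, MeasurableSet (K n)) (hKμ : ∀ n, μ (K n) ≠ ∞) (hmono : Monotone K)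
    (hK : ⋃ n, K n = Set.univ)
    (h : ∀ n, ∀ A ∈ C, ∀ (hA : MeasurableSet (A ∩ K n)) (hμ : μ (A ∩ K n) ≠ ∞),
      indicatorConstLp 1 hA hμ (1 : ℂ) ∈ 𝒮) : 𝒮 = ⊤ := by
  have hfin : ∀ n (A : Set α), μ (A ∩ K n) ≠ ∞ := fun n A =>
    measure_ne_top_of_subset Set.inter_subset_right (hKμ n)
  have step1 : ∀ n (A : Set α) (hA : MeasurableSet A),
      indicatorConstLp 1 (hA.inter (hKm n)) (hfin n A) (1 : ℂ) ∈ 𝒮 := by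
    intro n A hA
    induction A, hA using MeasurableSpace.induction_on_inter hgen hpi with
    | empty =>
      have : indicatorConstLp 1 (MeasurableSet.empty.inter (hKm n)) (hfin n ∅) (1 : ℂ) = 0 := by
        simp only [Set.empty_inter]
        exact indicatorConstLp_empty
      rw [this]
      exact 𝒮.zero_mem
    | basic A hA => exact h n A hA _ _
    | compl A hA ih =>
      -- Complements are taken relative to `K n`, whose own indicator is in the subspace because the
      -- π-system contains the whole space.
      have h0 : indicatorConstLp 1 (MeasurableSet.univ.inter (hKm n)) (hfin n Set.univ) (1 : ℂ) ∈ 𝒮 :=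
        h n _ huniv _ _
      have e := indicatorConstLp_disjoint_union (p := 1) (hA.inter (hKm n)) (hA.compl.inter (hKm n))
        (hfin n _) (hfin n _) (disjoint_compl_right.mono Set.inter_subset_left Set.inter_subset_left)
        (1 : ℂ)
      simp only [← Set.union_inter_distrib_right, Set.union_compl_self] at e
      have := 𝒮.sub_mem h0 ih
      rwa [e, add_sub_cancel_left] at this
    | iUnion f hd hf ih =>
      have hU : ∀ m, MeasurableSet (⋃ i ∈ Finset.range m, f i) := fun m =>
        Finset.measurableSet_biUnion _ fun i _ => hf i
      have h1 : ∀ m, indicatorConstLp 1 ((hU m).inter (hKm n)) (hfin n _) (1 : ℂ) ∈ 𝒮 := by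
        intro m
        induction m with
        | zero =>
          have : indicatorConstLp 1 ((hU 0).inter (hKm n)) (hfin n _) (1 : ℂ) = 0 := by
            simp only [Finset.range_zero, Finset.notMem_empty, Set.iUnion_of_empty,
              Set.iUnion_empty, Set.empty_inter]
            exact indicatorConstLp_empty
          rw [this]
          exact 𝒮.zero_mem
        | succ m ihm =>
          have hdis : Disjoint (⋃ i ∈ Finset.range m, f i) (f m) := by
            simp only [Set.disjoint_iUnion_left, Finset.mem_range]
            exact fun i hi => hd hi.ne
          have e := indicatorConstLp_disjoint_union (p := 1) ((hU m).inter (hKm n))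
            ((hf m).inter (hKm n)) (hfin n _) (hfin n _)
            (hdis.mono Set.inter_subset_left Set.inter_subset_left) (1 : ℂ)
          have e2 : (⋃ i ∈ Finset.range (m + 1), f i) = (⋃ i ∈ Finset.range m, f i) ∪ f m := by
            rw [Finset.range_add_one, Finset.set_biUnion_insert, Set.union_comm]
          simp only [← Set.union_inter_distrib_right] at e
          simp only [e2]
          rw [e]
          exact 𝒮.add_mem ihm (ih m)
      refine indicatorConstLp_mem_of_monotone hcl (fun m => (hU m).inter (hKm n)) _ _
        (fun a b hab => Set.inter_subset_inter_left _ (Set.biUnion_subset_biUnion_left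
          fun i hi => ?_)) ?_ (fun m _ => h1 m)
      · simp only [Finset.coe_range, Set.mem_Iio] at hi ⊢
        exact lt_of_lt_of_le hi hab
      · rw [← Set.iUnion_inter]
        congr 1
        ext x
        simp only [Set.mem_iUnion, Finset.mem_range]
        exact ⟨fun ⟨_, i, _, hi⟩ => ⟨i, hi⟩, fun ⟨i, hi⟩ => ⟨i + 1, i, Nat.lt_succ_self i, hi⟩⟩
  have step2 : ∀ (A : Set α) (hA : MeasurableSet A) (hμ : μ A ≠ ∞),
      indicatorConstLp 1 hA hμ (1 : ℂ) ∈ 𝒮 := fun A hA hμ =>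
    indicatorConstLp_mem_of_monotone hcl (fun n => hA.inter (hKm n)) hA hμ
      (fun a b hab => Set.inter_subset_inter_right _ (hmono hab))
      (by rw [← Set.inter_iUnion, hK, Set.inter_univ]) (fun n _ => step1 n A hA)
  rw [eq_top_iff]
  rintro f -
  refine Lp.induction (by simp) (motive := fun f => f ∈ 𝒮) (fun c s hs hμ => ?_)
    (fun f g hf hg _ h1 h2 => 𝒮.add_mem h1 h2) hcl f
  have : (Lp.simpleFunc.indicatorConst 1 hs hμ.ne c : Lp ℂ 1 μ)
      = c • indicatorConstLp 1 hs hμ.ne (1 : ℂ) := by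
    rw [Lp.simpleFunc.coe_indicatorConst]
    refine Lp.ext ?_
    filter_upwards [indicatorConstLp_coeFn (p := 1) (hs := hs) (hμs := hμ.ne) (c := c),
      indicatorConstLp_coeFn (p := 1) (hs := hs) (hμs := hμ.ne) (c := (1 : ℂ)),
      Lp.coeFn_smul c (indicatorConstLp 1 hs hμ.ne (1 : ℂ))] with x h1 h2 h3
    rw [h1, h3, Pi.smul_apply, h2]
    by_cases hx : x ∈ s <;> simp [hx]
  rw [this]
  exact 𝒮.smul_mem c (step2 s hs hμ.ne)

end Density

/-! ### Almost orthogonal sums and bounded multipliers -/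

section AlmostOrthogonal

variable {α ι : Type} [MeasurableSpace α] {μ : Measure α}

theorem mulInd_coeFn (S : Set α) (hS : MeasurableSet S) (ξ : Lp ℂ 2 μ) :
    mulInd μ S hS ξ =ᵐ[μ] S.indicator ξ := by
  filter_upwards [mulOp_coeFn (S.indicator fun _ => (1 : ℂ)) (measurable_const.indicator hS)
    (fun x => by by_cases hx : x ∈ S <;> simp [hx]) ξ] with x hx
  refine hx.trans ?_
  by_cases h : x ∈ S <;> simp [h]

theorem norm_mulInd_le (S : Set α) (hS : MeasurableSet S) (ξ : Lp ℂ 2 μ) :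
    ‖mulInd μ S hS ξ‖ ≤ ‖ξ‖ := by
  refine Lp.norm_le_norm_of_ae_le ?_
  filter_upwards [mulInd_coeFn S hS ξ] with x hx
  rw [hx]
  exact norm_indicator_le_norm_self _ _

/-- At each point at most `N` summands are nonzero, so Cauchy–Schwarz for `N` terms applies
pointwise and can be integrated. -/
theorem norm_sq_sum_mulInd_le {R : ι → Set α} (hR : ∀ k, MeasurableSet (R k)) {N : ℕ}
    (hN : ∀ x (s : Finset ι), (∀ k ∈ s, x ∈ R k) → s.card ≤ N) (η : ι → Lp ℂ 2 μ) (s : Finset ι) :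
    ‖∑ k ∈ s, mulInd μ (R k) (hR k) (η k)‖ ^ 2 ≤ N * ∑ k ∈ s, ‖η k‖ ^ 2 := by
  classical
  simp only [norm_sq_eq_integral]
  rw [← integral_finsetSum _ fun i _ => integrable_norm_sq _, ← integral_const_mul]
  refine integral_mono_ae (integrable_norm_sq _)
    ((integrable_finsetSum _ fun i _ => integrable_norm_sq _).const_mul _) ?_
  have h1 : ∀ᵐ x ∂μ, ∀ k ∈ s, mulInd μ (R k) (hR k) (η k) x = (R k).indicator (η k) x :=
    (ae_ball_iff s.countable_toSet).2 fun k _ => mulInd_coeFn _ _ _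
  filter_upwards [h1, Lp.coeFn_finsetSum s fun k => mulInd μ (R k) (hR k) (η k)] with x hx hx'
  rw [hx', Finset.sum_apply, Finset.sum_congr rfl hx]
  have e : ∑ k ∈ s, (R k).indicator (η k) x = ∑ k ∈ s with x ∈ R k, η k x := by
    rw [Finset.sum_filter]
    rfl
  rw [e]
  calc ‖∑ k ∈ s with x ∈ R k, η k x‖ ^ 2
      ≤ (∑ k ∈ s with x ∈ R k, ‖η k x‖) ^ 2 := by gcongr; exact norm_sum_le _ _
    _ ≤ (s.filter (x ∈ R ·)).card * ∑ k ∈ s with x ∈ R k, ‖η k x‖ ^ 2 :=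
        sq_sum_le_card_mul_sum_sq
    _ ≤ N * ∑ k ∈ s, ‖η k x‖ ^ 2 := by
        refine mul_le_mul ?_ ?_ (Finset.sum_nonneg fun _ _ => sq_nonneg _) (Nat.cast_nonneg N)
        · exact_mod_cast hN x _ fun k hk => (Finset.mem_filter.1 hk).2
        · exact Finset.sum_le_sum_of_subset_of_nonneg (Finset.filter_subset _ _)
            fun _ _ _ => sq_nonneg _

theorem sum_norm_sq_mulInd_le {S : ι → Set α} (hS : ∀ k, MeasurableSet (S k))
    (hd : Pairwise fun i j => Disjoint (S i) (S j)) (ξ : Lp ℂ 2 μ) (s : Finset ι) :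
    ∑ k ∈ s, ‖mulInd μ (S k) (hS k) ξ‖ ^ 2 ≤ ‖ξ‖ ^ 2 := by
  classical
  simp only [norm_sq_eq_integral]
  rw [← integral_finsetSum _ fun i _ => integrable_norm_sq _]
  refine integral_mono_ae (integrable_finsetSum _ fun i _ => integrable_norm_sq _)
    (integrable_norm_sq _) ?_
  have h1 : ∀ᵐ x ∂μ, ∀ k ∈ s, mulInd μ (S k) (hS k) ξ x = (S k).indicator ξ x :=
    (ae_ball_iff s.countable_toSet).2 fun k _ => mulInd_coeFn _ _ _
  filter_upwards [h1] with x hx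
  have e : ∑ k ∈ s, ‖mulInd μ (S k) (hS k) ξ x‖ ^ 2
      = ∑ k ∈ s with x ∈ S k, ‖ξ x‖ ^ 2 := by
    rw [Finset.sum_filter]
    refine Finset.sum_congr rfl fun k hk => ?_
    rw [hx k hk]
    by_cases h : x ∈ S k <;> simp [h]
  rw [e, Finset.sum_const, nsmul_eq_mul]
  refine mul_le_of_le_one_left (sq_nonneg _) ?_
  have : (s.filter (x ∈ S ·)).card ≤ 1 := Finset.card_le_one.2 fun i hi j hj => by
    by_contra hij
    exact Set.disjoint_left.1 (hd hij) (Finset.mem_filter.1 hi).2 (Finset.mem_filter.1 hj).2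
  exact_mod_cast this

/-- A sum `∑ 1_{R k} T k 1_{S k}` with `S` disjoint, `R` of finite overlap and `T` bounded converges
unconditionally in the strong topology. -/
theorem summable_almostOrthogonal {S R : ι → Set α} (hS : ∀ k, MeasurableSet (S k))
    (hd : Pairwise fun i j => Disjoint (S i) (S j)) (hR : ∀ k, MeasurableSet (R k)) {N : ℕ}
    (hN : ∀ x (s : Finset ι), (∀ k ∈ s, x ∈ R k) → s.card ≤ N)
    {T : ι → Lp ℂ 2 μ →L[ℂ] Lp ℂ 2 μ} {c : ℝ} (hT : ∀ k ξ,
      ‖T k (mulInd μ (S k) (hS k) ξ)‖ ≤ c * ‖mulInd μ (S k) (hS k) ξ‖) (ξ : Lp ℂ 2 μ) :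
    Summable fun k => mulInd μ (R k) (hR k) (T k (mulInd μ (S k) (hS k) ξ)) := by
  have hsum : Summable fun k => ‖mulInd μ (S k) (hS k) ξ‖ ^ 2 :=
    summable_of_sum_le (fun _ => sq_nonneg _) (sum_norm_sq_mulInd_le hS hd ξ)
  rw [summable_iff_vanishing_norm]
  intro ε hε
  -- Almost orthogonality controls squared norms, so a tail below ε² is requested; the factor N c²
  -- absorbs the overlap and the bound of the operators.
  obtain ⟨s, hs⟩ := summable_iff_vanishing_norm.1 (hsum.mul_left (N * c ^ 2)) (ε ^ 2) (by positivity)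
  refine ⟨s, fun t ht => ?_⟩
  have h1 := (le_abs_self _).trans_lt (hs t ht)
  refine lt_of_pow_lt_pow_left₀ 2 hε.le (lt_of_le_of_lt ?_ h1)
  refine (norm_sq_sum_mulInd_le hR hN _ t).trans ?_
  rw [← Finset.mul_sum, mul_assoc]
  refine mul_le_mul_of_nonneg_left ?_ (Nat.cast_nonneg N)
  rw [Finset.mul_sum]
  refine Finset.sum_le_sum fun k _ => ?_
  rw [← mul_pow]
  exact pow_le_pow_left₀ (norm_nonneg _) (hT k ξ) 2

theorem norm_hasSum_almostOrthogonal_le {S R : ι → Set α} (hS : ∀ k, MeasurableSet (S k))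
    (hd : Pairwise fun i j => Disjoint (S i) (S j)) (hR : ∀ k, MeasurableSet (R k)) {N : ℕ}
    (hN : ∀ x (s : Finset ι), (∀ k ∈ s, x ∈ R k) → s.card ≤ N)
    {T : ι → Lp ℂ 2 μ →L[ℂ] Lp ℂ 2 μ} {c : ℝ} (hc : 0 ≤ c) (hT : ∀ k ξ,
      ‖T k (mulInd μ (S k) (hS k) ξ)‖ ≤ c * ‖mulInd μ (S k) (hS k) ξ‖) {ξ η : Lp ℂ 2 μ}
    (hη : HasSum (fun k => mulInd μ (R k) (hR k) (T k (mulInd μ (S k) (hS k) ξ))) η) :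
    ‖η‖ ≤ Real.sqrt N * c * ‖ξ‖ := by
  refine le_of_tendsto hη.norm (Eventually.of_forall fun s => ?_)
  refine le_of_sq_le_sq ?_ (by positivity)
  refine (norm_sq_sum_mulInd_le hR hN _ s).trans ?_
  rw [mul_pow, mul_pow, Real.sq_sqrt (Nat.cast_nonneg N), mul_assoc]
  gcongr
  calc ∑ k ∈ s, ‖T k (mulInd μ (S k) (hS k) ξ)‖ ^ 2
      ≤ ∑ k ∈ s, (c * ‖mulInd μ (S k) (hS k) ξ‖) ^ 2 := by
        gcongr with k; exact hT k ξ
    _ = c ^ 2 * ∑ k ∈ s, ‖mulInd μ (S k) (hS k) ξ‖ ^ 2 := by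
        rw [Finset.mul_sum]; exact Finset.sum_congr rfl fun _ _ => mul_pow _ _ _
    _ ≤ c ^ 2 * ‖ξ‖ ^ 2 := by gcongr; exact sum_norm_sq_mulInd_le hS hd ξ s

theorem mulInd_mulInd (S R : Set α) (hS : MeasurableSet S) (hR : MeasurableSet R) (ξ : Lp ℂ 2 μ) :
    mulInd μ S hS (mulInd μ R hR ξ) = mulInd μ (S ∩ R) (hS.inter hR) ξ := by
  refine Lp.ext ?_
  filter_upwards [mulInd_coeFn S hS (mulInd μ R hR ξ), mulInd_coeFn R hR ξ,
    mulInd_coeFn (S ∩ R) (hS.inter hR) ξ] with x h1 h2 h3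
  rw [h1, h3]
  by_cases hx : x ∈ S <;> by_cases hx' : x ∈ R <;> simp [hx, hx', h2]

/-- The case of identity operators in `summable_almostOrthogonal` gives a limit; it is then
identified by cutting it to each piece and to the union. -/
theorem hasSum_mulInd [Countable ι] {S : ι → Set α} (hS : ∀ k, MeasurableSet (S k))
    (hd : Pairwise fun i j => Disjoint (S i) (S j)) {X : Set α} (hX : MeasurableSet X)
    (hU : ⋃ k, S k = X) (ξ : Lp ℂ 2 μ) :
    HasSum (fun k => mulInd μ (S k) (hS k) ξ) (mulInd μ X hX ξ) := by
  have hN : ∀ x (s : Finset ι), (∀ k ∈ s, x ∈ S k) → s.card ≤ 1 := fun x s h =>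
    Finset.card_le_one.2 fun i hi j hj => by
      by_contra hij
      exact Set.disjoint_left.1 (hd hij) (h i hi) (h j hj)
  have hcomp : ∀ k, mulInd μ (S k) (hS k) (mulInd μ (S k) (hS k) ξ) = mulInd μ (S k) (hS k) ξ :=
    fun k => by rw [mulInd_mulInd]; simp only [Set.inter_self]
  have h1 := summable_almostOrthogonal hS hd hS hN (T := fun _ => ContinuousLinearMap.id ℂ _)
    (c := 1) (fun k ξ => by simp) ξ
  simp only [ContinuousLinearMap.id_apply, hcomp] at h1
  obtain ⟨η, hη⟩ := h1
  have h2 : ∀ j, mulInd μ (S j) (hS j) η = mulInd μ (S j) (hS j) ξ := fun j => by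
    refine (hη.mapL (mulInd μ (S j) (hS j))).unique ?_
    have := hasSum_single (f := fun k => mulInd μ (S j) (hS j) (mulInd μ (S k) (hS k) ξ)) j
      fun k hk => by
        rw [mulInd_mulInd]
        refine Lp.ext ?_
        filter_upwards [mulInd_coeFn (S j ∩ S k) ((hS j).inter (hS k)) ξ,
          Lp.coeFn_zero ℂ 2 μ] with x hx h0
        rw [hx, h0, (hd hk.symm).inter_eq]
        simp
    rwa [hcomp] at this
  have h3 : mulInd μ X hX η = η := by
    have h4 : ∀ k, mulInd μ X hX (mulInd μ (S k) (hS k) ξ) = mulInd μ (S k) (hS k) ξ := fun k => by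
      rw [mulInd_mulInd]
      simp only [Set.inter_eq_right.2 (hU ▸ Set.subset_iUnion S k : S k ⊆ X)]
    have h5 := hη.mapL (mulInd μ X hX)
    simp only [h4] at h5
    exact h5.unique hη
  have h4 : η = mulInd μ X hX ξ := by
    refine Lp.ext ?_
    have h5 : ∀ᵐ x ∂μ, ∀ j, (S j).indicator η x = (S j).indicator ξ x := by
      rw [ae_all_iff]
      intro j
      filter_upwards [mulInd_coeFn (S j) (hS j) ξ, mulInd_coeFn (S j) (hS j) η] with x hx hx'
      rw [← hx, ← hx', h2]
    filter_upwards [h5, mulInd_coeFn X hX ξ, mulInd_coeFn X hX η] with x h6 h7 h8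
    rw [h7]
    rw [h3] at h8
    by_cases hx : x ∈ X
    · obtain ⟨j, hj⟩ := Set.mem_iUnion.1 (hU ▸ hx : x ∈ ⋃ k, S k)
      simpa [hx, hj] using h6 j
    · rw [h8]; simp [hx]
  exact h4 ▸ hη

/-- A bounded measurable function. -/
structure BddMeas (m : α → ℂ) : Prop where
  meas : Measurable m
  bdd : ∃ C, ∀ x, ‖m x‖ ≤ C

theorem BddMeas.indicator {m : α → ℂ} (h : BddMeas m) {S : Set α} (hS : MeasurableSet S) :
    BddMeas (S.indicator m) :=
  ⟨h.meas.indicator hS, h.bdd.imp fun _ hC x => (norm_indicator_le_norm_self _ _).trans (hC x)⟩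

theorem BddMeas.sub {m n : α → ℂ} (h : BddMeas m) (k : BddMeas n) :
    BddMeas fun x => m x - n x :=
  ⟨h.meas.sub k.meas, by
    obtain ⟨C, hC⟩ := h.bdd
    obtain ⟨C', hC'⟩ := k.bdd
    exact ⟨C + C', fun x => (norm_sub_le _ _).trans (add_le_add (hC x) (hC' x))⟩⟩

section Bmul

variable {E : Type*} [NormedAddCommGroup E] [NormedSpace ℂ E]

theorem BddMeas.memLp {m : α → ℂ} (h : BddMeas m) (ξ : Lp E 2 μ) :
    MemLp (fun x => m x • ξ x) 2 μ := by
  obtain ⟨C, hC⟩ := h.bdd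
  refine MemLp.of_le_mul (c := C) (Lp.memLp ξ)
    (h.meas.aestronglyMeasurable.smul (Lp.aestronglyMeasurable ξ)) (ae_of_all _ fun x => ?_)
  rw [norm_smul]
  exact mul_le_mul_of_nonneg_right (hC x) (norm_nonneg _)

/-- Multiplication by a bounded measurable function on `L²`. -/
def bmul (μ : Measure α) {m : α → ℂ} (h : BddMeas m) : Lp E 2 μ →L[ℂ] Lp E 2 μ :=
  LinearMap.mkContinuousOfExistsBound
    { toFun := fun ξ => (h.memLp ξ).toLp _
      map_add' := fun ξ η => by
        rw [← MemLp.toLp_add]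
        refine MemLp.toLp_congr _ _ ?_
        filter_upwards [Lp.coeFn_add ξ η] with x hx
        rw [hx, Pi.add_apply]
        exact smul_add _ _ _
      map_smul' := fun c ξ => by
        rw [RingHom.id_apply, ← MemLp.toLp_const_smul]
        refine MemLp.toLp_congr _ _ ?_
        filter_upwards [Lp.coeFn_smul c ξ] with x hx
        rw [hx, Pi.smul_apply]
        exact smul_comm _ _ _ }
    (h.bdd.imp fun C hC ξ => Lp.norm_le_mul_norm_of_ae_le_mul (by
      filter_upwards [(h.memLp ξ).coeFn_toLp] with x hx
      simp only [LinearMap.coe_mk, AddHom.coe_mk]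
      rw [hx, norm_smul]
      exact mul_le_mul_of_nonneg_right (hC x) (norm_nonneg _)))

theorem bmul_coeFn {m : α → ℂ} (h : BddMeas m) (ξ : Lp E 2 μ) :
    bmul μ h ξ =ᵐ[μ] fun x => m x • ξ x :=
  (h.memLp ξ).coeFn_toLp

theorem norm_bmul_apply_le {m : α → ℂ} (h : BddMeas m) {C : ℝ} (hC : ∀ x, ‖m x‖ ≤ C)
    (ξ : Lp E 2 μ) : ‖bmul μ h ξ‖ ≤ C * ‖ξ‖ :=
  Lp.norm_le_mul_norm_of_ae_le_mul (by
    filter_upwards [bmul_coeFn h ξ] with x hx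
    rw [hx, norm_smul]
    exact mul_le_mul_of_nonneg_right (hC x) (norm_nonneg _))

end Bmul

end AlmostOrthogonal

/-! ### Integrals of strongly measurable operator families -/

section StrongIntegral

variable {Y H H' : Type*} [MeasurableSpace Y] [NormedAddCommGroup H] [NormedSpace ℂ H]
  [NormedAddCommGroup H'] [NormedSpace ℂ H']

theorem integrable_strong (ν : Measure Y) [IsFiniteMeasure ν] {T : Y → H →L[ℂ] H'}
    (hm : ∀ ξ, AEStronglyMeasurable (fun y => T y ξ) ν) (hb : ∀ y ξ, ‖T y ξ‖ ≤ ‖ξ‖) (ξ : H) :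
    Integrable (fun y => T y ξ) ν :=
  (integrable_const ‖ξ‖).mono' (hm ξ) (ae_of_all _ fun y => hb y ξ)

/-- The strong integral of a measurable family of contractions. -/
def strongInt (ν : Measure Y) [IsFiniteMeasure ν] {T : Y → H →L[ℂ] H'}
    (hm : ∀ ξ, AEStronglyMeasurable (fun y => T y ξ) ν) (hb : ∀ y ξ, ‖T y ξ‖ ≤ ‖ξ‖) :
    H →L[ℂ] H' :=
  LinearMap.mkContinuous
    { toFun := fun ξ => ∫ y, T y ξ ∂ν
      map_add' := fun ξ η => by
        simp only [map_add]
        exact integral_add (integrable_strong ν hm hb ξ) (integrable_strong ν hm hb η)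
      map_smul' := fun c ξ => by
        simp only [map_smul]
        exact integral_smul _ _ }
    (ν.real Set.univ) (fun ξ => by
      rw [mul_comm]
      exact norm_integral_le_of_norm_le_const (ae_of_all _ fun y => hb y ξ))

theorem strongInt_apply (ν : Measure Y) [IsFiniteMeasure ν] {T : Y → H →L[ℂ] H'}
    (hm : ∀ ξ, AEStronglyMeasurable (fun y => T y ξ) ν) (hb : ∀ y ξ, ‖T y ξ‖ ≤ ‖ξ‖) (ξ : H) :
    strongInt ν hm hb ξ = ∫ y, T y ξ ∂ν := rfl

end StrongIntegral

/-! ### The action of `G₀` on `L²(ℝ²)` -/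

/-- The inverse action of `g ∈ G₀` on the plane `G₀ / exp(ℝ B)`. -/
def planeAct (g : G0) (y : ℝ × ℝ) : ℝ × ℝ := (y.1 - g.x, Real.exp (g.b / 2) * y.2 - g.p)

theorem continuous_planeAct (g : G0) : Continuous (planeAct g) := by
  unfold planeAct; fun_prop

/-- The action translates x and maps p affinely with slope e^{b/2}. That Jacobian is why `planeRep`
carries the factor e^{b/4}. -/
theorem lintegral_planeAct (g : G0) {f : ℝ × ℝ → ℝ≥0∞} (hf : Measurable f) :
    ∫⁻ y, ENNReal.ofReal (Real.exp (g.b / 2)) * f (planeAct g y) = ∫⁻ y, f y := by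
  have e1 := lintegral_prod (μ := (volume : Measure ℝ)) (ν := (volume : Measure ℝ))
    (fun y => ENNReal.ofReal (Real.exp (g.b / 2)) * f (planeAct g y))
    ((hf.comp (continuous_planeAct g).measurable).const_mul _).aemeasurable
  have e2 := lintegral_prod (μ := (volume : Measure ℝ)) (ν := (volume : Measure ℝ)) f
    hf.aemeasurable
  refine e1.trans (Eq.trans ?_ e2.symm)
  have e3 : ∀ x : ℝ, ∫⁻ p : ℝ, ENNReal.ofReal (Real.exp (g.b / 2)) * f (planeAct g (x, p))
      = ∫⁻ p : ℝ, f (x - g.x, p) := fun x => by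
    have h1 : Measurable fun p : ℝ => f (x - g.x, p - g.p) := hf.comp (by fun_prop)
    exact (lintegral_mul_left_real h1 (Real.exp_pos (g.b / 2))).trans
      (lintegral_sub_right_eq_self (fun p => f (x - g.x, p)) g.p)
  simp only [e3]
  exact lintegral_sub_right_eq_self (fun x => ∫⁻ p : ℝ, f (x, p)) g.x

theorem quasiMeasurePreserving_planeAct (g : G0) :
    Measure.QuasiMeasurePreserving (planeAct g) := by
  have hc := (continuous_planeAct g).measurable
  refine ⟨hc, Measure.AbsolutelyContinuous.mk fun A hA h0 => ?_⟩
  rw [Measure.map_apply hc hA]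
  have h1 := lintegral_planeAct g (measurable_const.indicator hA : Measurable
    (A.indicator fun _ => (1 : ℝ≥0∞)))
  rw [lintegral_indicator_const hA, h0, mul_zero] at h1
  replace h1 := (lintegral_const_mul (ENNReal.ofReal (Real.exp (g.b / 2)))
    ((measurable_const.indicator hA).comp hc)).symm.trans h1
  have h2 : ∫⁻ y, (planeAct g ⁻¹' A).indicator (fun _ => (1 : ℝ≥0∞)) y = 0 := by
    rcases mul_eq_zero.1 h1 with h | h
    · exact absurd (ENNReal.ofReal_eq_zero.1 h) (not_le.2 (Real.exp_pos _))
    · exact h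
  rwa [lintegral_indicator_const (hc hA), one_mul] at h2

theorem eLpNorm_planeAct (g : G0) (ζ : L2R2) :
    eLpNorm (fun y => (Real.exp (g.b / 4) : ℂ) * ζ (planeAct g y)) 2 volume
      = eLpNorm ζ 2 volume := by
  rw [eLpNorm_two, eLpNorm_two, ← lintegral_planeAct g
    ((Lp.stronglyMeasurable ζ).enorm.pow_const _)]
  congr 1
  refine lintegral_congr fun z => ?_
  rw [enorm_mul, ENNReal.mul_rpow_of_nonneg _ _ (by norm_num)]
  congr 1
  rw [← ofReal_norm, Complex.norm_real, Real.norm_of_nonneg (Real.exp_pos _).le,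
    ENNReal.ofReal_rpow_of_pos (Real.exp_pos _), ← Real.exp_mul]
  congr 2; ring

theorem memLp_planeAct (g : G0) (ζ : L2R2) :
    MemLp (fun y => (Real.exp (g.b / 4) : ℂ) * ζ (planeAct g y)) 2 volume := by
  refine ⟨?_, by rw [eLpNorm_planeAct]; exact (Lp.memLp ζ).2⟩
  exact (measurable_const.mul ((Lp.stronglyMeasurable ζ).measurable.comp
    (continuous_planeAct g).measurable)).aestronglyMeasurable

/-- The unitary action of `G₀` on `L²(ℝ²)`, induced from the trivial character of `exp(ℝ B)`. -/
def planeRep (g : G0) : L2R2 →ₗᵢ[ℂ] L2R2 where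
  toFun ζ := (memLp_planeAct g ζ).toLp _
  map_add' ζ η := by
    rw [← MemLp.toLp_add]
    refine MemLp.toLp_congr _ _ ?_
    filter_upwards [(quasiMeasurePreserving_planeAct g).ae (Lp.coeFn_add ζ η)] with z hz
    simp only [Pi.add_apply]
    rw [hz, Pi.add_apply, mul_add]
  map_smul' c ζ := by
    rw [RingHom.id_apply, ← MemLp.toLp_const_smul]
    refine MemLp.toLp_congr _ _ ?_
    filter_upwards [(quasiMeasurePreserving_planeAct g).ae (Lp.coeFn_smul c ζ)] with z hz
    simp only [Pi.smul_apply]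
    rw [hz, Pi.smul_apply, smul_eq_mul, smul_eq_mul, mul_left_comm]
  norm_map' ζ := by
    change ‖(memLp_planeAct g ζ).toLp _‖ = ‖ζ‖
    rw [Lp.norm_toLp, eLpNorm_planeAct, Lp.norm_def]

theorem planeRep_coeFn (g : G0) (ζ : L2R2) :
    planeRep g ζ =ᵐ[volume] fun y => (Real.exp (g.b / 4) : ℂ) * ζ (planeAct g y) :=
  (memLp_planeAct g ζ).coeFn_toLp

theorem planeRep_mul (g h : G0) (ζ : L2R2) : planeRep (g * h) ζ = planeRep g (planeRep h ζ) := by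
  refine Lp.ext ?_
  filter_upwards [planeRep_coeFn (g * h) ζ, planeRep_coeFn g (planeRep h ζ),
    (quasiMeasurePreserving_planeAct g).ae (planeRep_coeFn h ζ)] with y h1 h2 h3
  rw [h1, h2, h3, ← mul_assoc, ← Complex.ofReal_mul, ← Real.exp_add]
  congr 2
  · rw [G0.b_mul]; congr 2; ring
  · simp only [planeAct, G0.x_mul, G0.b_mul, G0.p_mul, add_div, Real.exp_add]
    ext
    · simp only; ring
    · simp only; ring

/-! ### Intertwining -/

/-- The isometry `L²(G₀) → L²(ℝ, L²(ℝ²))` underlying `U`, before the Fourier transform. -/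
def disintegrate : L2G0 →ₗᵢ[ℂ] HTau := curryL2.comp dilateL2

theorem disintegrate_coeFn (ξ : L2G0) :
    ∀ᵐ b : ℝ, ∀ᵐ y : ℝ × ℝ,
      disintegrate ξ b y = (Real.exp (b / 4) : ℂ) * ξ (reorder (b, y)) := by
  have h2 : ∀ᵐ b : ℝ, ∀ᵐ y : ℝ × ℝ, dilateL2 ξ (b, y) = dilate ξ (b, y) :=
    Measure.ae_ae_of_ae_prod (memLp_dilate ξ).coeFn_toLp
  filter_upwards [curryL2_coeFn (dilateL2 ξ), h2] with b h1 h2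
  filter_upwards [h1, h2] with y h1 h2
  exact h1.trans h2

/-- Translation on `L²(ℝ, L²(ℝ²))`. -/
def fiberTr (t : ℝ) : HTau →ₗᵢ[ℂ] HTau :=
  Lp.compMeasurePreservingₗᵢ ℂ (fun b : ℝ => b - t) (measurePreserving_sub_right volume t)

theorem fiberTr_coeFn (t : ℝ) (η : HTau) : fiberTr t η =ᵐ[volume] fun b => η (b - t) :=
  Lp.coeFn_compMeasurePreserving η (measurePreserving_sub_right volume t)

/-- The constant field of operators `A` on `L²(ℝ, L²(ℝ²))`. -/
def constField (A : L2R2 →L[ℂ] L2R2) : HTau →L[ℂ] HTau := A.compLpL 2 volume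

theorem constField_coeFn (A : L2R2 →L[ℂ] L2R2) (η : HTau) :
    constField A η =ᵐ[volume] fun b => A (η b) := A.coeFn_compLpL η

/-- In the coordinates exp(xX)exp(pP)exp(bB), left translation moves b by a constant and acts on the
plane independently of b. This separation of variables lets a Fourier transform in b decompose the
translations. -/
theorem reorder_planeAct (g : G0) (b : ℝ) (y : ℝ × ℝ) :
    reorder (b - g.b, planeAct g y) = g⁻¹ * reorder (b, y) := by
  have e : Real.exp ((b - g.b) / 2) = Real.exp (b / 2) * Real.exp (-g.b / 2) := by
    rw [← Real.exp_add]; congr 1; ring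
  have e2 : Real.exp (-g.b / 2) * Real.exp (g.b / 2) = 1 := by
    rw [← Real.exp_add, ← Real.exp_zero]; congr 1; ring
  ext
  · simp only [reorder, planeAct, G0.x_mk, G0.x_mul, G0.x_inv]; ring
  · simp only [reorder, planeAct, G0.b_mk, G0.b_mul, G0.b_inv]; ring
  · simp only [reorder, planeAct, G0.p_mk, G0.p_mul, G0.p_inv, G0.b_mk, e]
    linear_combination Real.exp (b / 2) * y.2 * e2

/-- The factor e^{b/4} of `dilate` splits as e^{(b - g.b)/4} e^{g.b/4}; the second part is exactly
the normalisation of `planeRep`. -/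
theorem disintegrate_leftTr (g : G0) (ξ : L2G0) :
    disintegrate (leftTr g ξ)
      = fiberTr g.b (constField (planeRep g).toContinuousLinearMap (disintegrate ξ)) := by
  refine Lp.ext ?_
  have h1 : ∀ᵐ b : ℝ, ∀ᵐ y : ℝ × ℝ,
      leftTr g ξ (reorder (b, y)) = ξ (g⁻¹ * reorder (b, y)) :=
    Measure.ae_ae_of_ae_prod (quasiMeasurePreserving_reorder.ae (leftTr_coeFn g ξ))
  have hq := (measurePreserving_sub_right (volume : Measure ℝ) g.b).quasiMeasurePreserving
  filter_upwards [disintegrate_coeFn (leftTr g ξ), h1, fiberTr_coeFn g.b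
    (constField (planeRep g).toContinuousLinearMap (disintegrate ξ)),
    hq.ae (constField_coeFn (planeRep g).toContinuousLinearMap (disintegrate ξ)),
    hq.ae (disintegrate_coeFn ξ)] with b h1 h2 h3 h4 h5
  rw [h3, h4]
  refine Lp.ext ?_
  filter_upwards [h1, h2, planeRep_coeFn g (disintegrate ξ (b - g.b)),
    (quasiMeasurePreserving_planeAct g).ae h5] with y h1 h2 h6 h7
  rw [h1, h2]
  refine Eq.trans ?_ h6.symm
  rw [h7, reorder_planeAct, ← mul_assoc, ← Complex.ofReal_mul, ← Real.exp_add]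
  congr 4; ring

theorem disintegrate_bmul {θ : G0 → ℂ} (hθ : BddMeas θ) {θ' : ℝ × ℝ → ℂ} (hθ' : BddMeas θ')
    (h : ∀ b y, θ (reorder (b, y)) = θ' y) (ξ : L2G0) :
    disintegrate (bmul volume hθ ξ) = constField (bmul volume hθ') (disintegrate ξ) := by
  refine Lp.ext ?_
  have h1 : ∀ᵐ b : ℝ, ∀ᵐ y : ℝ × ℝ,
      bmul volume hθ ξ (reorder (b, y)) = θ (reorder (b, y)) • ξ (reorder (b, y)) :=
    Measure.ae_ae_of_ae_prod (quasiMeasurePreserving_reorder.ae (bmul_coeFn hθ ξ))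
  filter_upwards [disintegrate_coeFn (bmul volume hθ ξ), h1,
    constField_coeFn (bmul volume hθ') (disintegrate ξ), disintegrate_coeFn ξ] with b h1 h2 h3 h4
  rw [h3]
  refine Lp.ext ?_
  filter_upwards [h1, h2, h4, bmul_coeFn hθ' (disintegrate ξ b)] with y h1 h2 h4 h5
  rw [h1, h2, h5, h4, h, smul_eq_mul, smul_eq_mul]
  ring

theorem dilateL2_surjective : Function.Surjective dilateL2 := by
  intro η
  have hc : Continuous fun u : G0 => ((u.b, u.x, Real.exp (-u.b / 2) * u.p) : ℝ × (ℝ × ℝ)) := by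
    fun_prop
  -- The pointwise inverse of `dilate`: solve p' = e^{b/2} p for p and divide by e^{b/4}.
  let f : G0 → ℂ := fun u => (Real.exp (-u.b / 4) : ℂ) * η (u.b, u.x, Real.exp (-u.b / 2) * u.p)
  have hf : Measurable f := by
    have h1 : Measurable fun u : G0 => (Real.exp (-u.b / 4) : ℂ) := by
      have : Continuous fun u : G0 => (Real.exp (-u.b / 4) : ℂ) := by fun_prop
      exact this.measurable
    exact h1.mul ((Lp.stronglyMeasurable η).measurable.comp hc.measurable)
  have hd : ∀ z, dilate f z = η z := fun z => by
    have e1 : (Real.exp (z.1 / 4) : ℂ) * (Real.exp (-z.1 / 4) : ℂ) = 1 := by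
      rw [← Complex.ofReal_mul, ← Real.exp_add, ← Complex.ofReal_one, ← Real.exp_zero]
      congr 2; ring
    have e2 : Real.exp (-z.1 / 2) * (Real.exp (z.1 / 2) * z.2.2) = z.2.2 := by
      rw [← mul_assoc, ← Real.exp_add]
      have : -z.1 / 2 + z.1 / 2 = 0 := by ring
      rw [this, Real.exp_zero, one_mul]
    simp only [dilate, f, reorder, G0.b_mk, G0.x_mk, G0.p_mk, e2, Prod.mk.eta]
    rw [← mul_assoc, e1, one_mul]
  have hfL : MemLp f 2 volume := by
    refine ⟨hf.aestronglyMeasurable, ?_⟩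
    have h1 : ∫⁻ u, ‖f u‖ₑ ^ (2 : ℝ) = ∫⁻ z, ‖η z‖ₑ ^ (2 : ℝ) := by
      rw [← lintegral_reorder (hf.enorm.pow_const _)]
      refine lintegral_congr fun z => ?_
      rw [← hd z, dilate, enorm_mul (Real.exp (z.1 / 4) : ℂ) (f (reorder z)),
        ENNReal.mul_rpow_of_nonneg _ _ (by norm_num)]
      congr 1
      rw [← ofReal_norm, Complex.norm_real, Real.norm_of_nonneg (Real.exp_pos _).le,
        ENNReal.ofReal_rpow_of_pos (Real.exp_pos _), ← Real.exp_mul]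
      congr 2; ring
    rw [eLpNorm_two, h1, ← eLpNorm_two]
    exact (Lp.memLp η).2
  refine ⟨hfL.toLp f, Lp.ext ?_⟩
  have h1 : dilateL2 (hfL.toLp f) =ᵐ[volume] dilate (hfL.toLp f) := (memLp_dilate _).coeFn_toLp
  filter_upwards [h1, quasiMeasurePreserving_reorder.ae hfL.coeFn_toLp] with z h1 h2
  rw [h1, ← hd z, dilate, dilate, h2]

/-- An isometry has closed range, and this range contains every indicator of a set of finite measure
times a fixed vector. These generate L²(ℝ, L²(ℝ²)). -/
theorem curryL2_surjective : Function.Surjective curryL2 := by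
  have hcl : IsClosed (LinearMap.range curryL2.toLinearMap : Set HTau) := by
    have : (LinearMap.range curryL2.toLinearMap : Set HTau) = Set.range curryL2 := rfl
    rw [this]
    exact curryL2.isometry.isClosedEmbedding.isClosed_range
  intro η
  change η ∈ LinearMap.range curryL2.toLinearMap
  refine Lp.induction (by simp) (motive := fun η => η ∈ LinearMap.range curryL2.toLinearMap)
    (fun c s hs hμ => ?_) (fun f g hf hg _ h1 h2 => Submodule.add_mem _ h1 h2) hcl η
  let f : ℝ × (ℝ × ℝ) → ℂ := fun z => s.indicator (fun _ => (1 : ℂ)) z.1 * c z.2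
  have hf : StronglyMeasurable f :=
    ((measurable_const.indicator hs).stronglyMeasurable.comp_measurable measurable_fst).mul
      ((Lp.stronglyMeasurable c).comp_measurable measurable_snd)
  have hfL : MemLp f 2 volume := by
    refine ⟨hf.aestronglyMeasurable, ?_⟩
    have h1 := lintegral_enorm_sq_prod hf
    have h2 : ∀ b, ∫⁻ y, ‖f (b, y)‖ₑ ^ (2 : ℝ)
        = s.indicator (fun _ => eLpNorm c 2 volume ^ (2 : ℝ)) b := fun b => by
      by_cases hb : b ∈ s
      · simp only [f, Set.indicator_of_mem hb, one_mul, eLpNorm_two_sq]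
      · simp [f, Set.indicator_of_notMem hb]
    simp only [h2] at h1
    rw [lintegral_indicator_const hs] at h1
    have h3 : eLpNorm f 2 volume ^ (2 : ℝ) < ∞ := by
      rw [← h1]
      exact ENNReal.mul_lt_top (ENNReal.rpow_lt_top_of_nonneg (by norm_num) (Lp.memLp c).2.ne) hμ
    by_contra h4
    rw [not_lt, top_le_iff] at h4
    rw [h4] at h3
    simp at h3
  refine ⟨hfL.toLp f, Lp.ext ?_⟩
  have h1 : ∀ᵐ b : ℝ, ∀ᵐ y : ℝ × ℝ, hfL.toLp f (b, y) = f (b, y) :=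
    Measure.ae_ae_of_ae_prod hfL.coeFn_toLp
  rw [Lp.simpleFunc.coe_indicatorConst]
  filter_upwards [curryL2_coeFn (hfL.toLp f), h1,
    indicatorConstLp_coeFn (p := 2) (hs := hs) (hμs := hμ.ne) (c := c)] with b h1 h2 h3
  rw [h3]
  refine Lp.ext ?_
  filter_upwards [h1, h2, Lp.coeFn_zero ℂ 2 (volume : Measure (ℝ × ℝ))] with y h1 h2 h0
  refine h1.trans (h2.trans ?_)
  by_cases hb : b ∈ s
  · simp [f, hb]
  · simp only [f, Set.indicator_of_notMem hb, zero_mul]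
    rw [h0]; rfl

theorem disintegrate_surjective : Function.Surjective disintegrate :=
  curryL2_surjective.comp dilateL2_surjective

/-- With surjectivity an operator ρ(T) is determined by its values on vectors Uξ, so every identity
and norm bound for ρ can be checked there. -/
theorem U_surjective : Function.Surjective U :=
  (Lp.fourierTransformₗᵢ ℝ L2R2).surjective.comp disintegrate_surjective

/-- Strong continuity is inherited from the left regular representation, rather than proved by
another density argument: embed L²(ℝ²) isometrically in the disintegrated space and undo the
translation in b. -/
theorem continuous_planeRep (ζ : L2R2) : Continuous fun g => planeRep g ζ := by
  have hμ : (volume (Set.Icc (0 : ℝ) 1)) ≠ ∞ := by simp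
  -- The interval has length one, so `J` is isometric and continuity can be tested after applying
  -- it.
  let J : L2R2 → HTau := fun c => indicatorConstLp 2 measurableSet_Icc hμ c
  have hJ : ∀ c d, dist (J c) (J d) = dist c d := fun c d => by
    rw [dist_eq_norm, dist_eq_norm]
    simp only [J]
    rw [indicatorConstLp_sub, norm_indicatorConstLp (by simp) (by simp)]
    simp
  obtain ⟨ξ, hξ⟩ := disintegrate_surjective (J ζ)
  have h1 : ∀ g : G0, J (planeRep g ζ) = fiberTr (-g.b) (disintegrate (leftTr g ξ)) := fun g => by
    rw [disintegrate_leftTr, hξ]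
    have hq := (measurePreserving_sub_right (volume : Measure ℝ) (-g.b)).quasiMeasurePreserving
    refine Lp.ext ?_
    filter_upwards [fiberTr_coeFn (-g.b) (fiberTr g.b
      (constField (planeRep g).toContinuousLinearMap (J ζ))),
      hq.ae (fiberTr_coeFn g.b (constField (planeRep g).toContinuousLinearMap (J ζ))),
      constField_coeFn (planeRep g).toContinuousLinearMap (J ζ),
      indicatorConstLp_coeFn (p := 2) (hs := measurableSet_Icc) (hμs := hμ) (c := ζ),
      indicatorConstLp_coeFn (p := 2) (hs := measurableSet_Icc) (hμs := hμ) (c := planeRep g ζ)]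
      with b h1 h2 h3 h4 h5
    rw [h1, h2, sub_neg_eq_add, add_sub_cancel_right, h3]
    refine h5.trans ?_
    simp only [J]
    rw [h4]
    by_cases hb : b ∈ Set.Icc (0 : ℝ) 1
    · simp [Set.indicator_of_mem hb]
    · simp [Set.indicator_of_notMem hb]
  have h2 : Continuous fun g : G0 => fiberTr (-g.b) (disintegrate (leftTr g ξ)) := by
    let f : G0 → C(ℝ, ℝ) := fun g => ⟨fun b => b - -g.b, by fun_prop⟩
    have hf : Continuous f :=
      ContinuousMap.continuous_of_continuous_uncurry f
        (by fun_prop : Continuous fun z : G0 × ℝ => z.2 - -z.1.b)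
    exact (disintegrate.continuous.comp (continuous_leftTr ξ)).compMeasurePreservingLp hf
      (fun g => measurePreserving_sub_right volume _) (by simp)
  simp only [← h1] at h2
  exact (Isometry.of_dist_eq hJ).isEmbedding.continuous_iff.2 h2

/-! ### The Fourier transform -/

section Fourier

variable {F : Type*} [NormedAddCommGroup F] [InnerProductSpace ℂ F] [CompleteSpace F]

theorem bddMeas_fourierChar (t : ℝ) : BddMeas fun s : ℝ => (𝐞 (-(t * s)) : ℂ) :=
  ⟨(continuous_induced_dom.comp (Real.continuous_fourierChar.comp (by fun_prop))).measurable,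
    1, fun _ => (Circle.norm_coe _).le⟩

/-- Both sides are continuous in `η`, so Schwartz functions suffice. For them the transform is an
honest integral, and the substitution v ↦ v + t applies. -/
theorem fourier_translate (t : ℝ) (η : Lp F 2 (volume : Measure ℝ)) :
    Lp.fourierTransformₗᵢ ℝ F (Lp.compMeasurePreservingₗᵢ ℂ (fun b : ℝ => b - t)
        (measurePreserving_sub_right volume t) η)
      = bmul volume (bddMeas_fourierChar t) (Lp.fourierTransformₗᵢ ℝ F η) := by
  let τ := Lp.compMeasurePreservingₗᵢ (E := F) (p := 2) ℂ (fun b : ℝ => b - t)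
        (measurePreserving_sub_right volume t)
  refine DenseRange.induction_on (p := fun η => Lp.fourierTransformₗᵢ ℝ F (τ η)
      = bmul volume (bddMeas_fourierChar t) (Lp.fourierTransformₗᵢ ℝ F η))
    (SchwartzMap.denseRange_toLpCLM (E := ℝ) (p := 2) (μ := (volume : Measure ℝ)) (F := F)
      ENNReal.ofNat_ne_top) η ?_ ?_
  · exact isClosed_eq (by fun_prop) (by fun_prop)
  intro f
  have h1 : τ (f.toLp 2 volume) = (SchwartzMap.compSubConstCLM ℂ t f).toLp 2 volume := by
    refine Lp.ext ?_
    filter_upwards [Lp.coeFn_compMeasurePreserving (f.toLp 2 volume)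
      (measurePreserving_sub_right (volume : Measure ℝ) t), SchwartzMap.coeFn_toLp
      (SchwartzMap.compSubConstCLM ℂ t f) 2 volume,
      (measurePreserving_sub_right (volume : Measure ℝ) t).quasiMeasurePreserving.ae
        (SchwartzMap.coeFn_toLp f 2 volume)] with b h1 h2 h3
    rw [h2]
    exact h1.trans h3
  have h2 := SchwartzMap.toLp_fourier_eq f
  have h3 := SchwartzMap.toLp_fourier_eq (SchwartzMap.compSubConstCLM ℂ t f)
  rw [SchwartzMap.toLpCLM_apply, h1]
  refine h3.trans ?_
  refine Eq.trans ?_ (congrArg (bmul volume (bddMeas_fourierChar t)) h2.symm)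
  refine Lp.ext ?_
  filter_upwards [SchwartzMap.coeFn_toLp (𝓕 (SchwartzMap.compSubConstCLM ℂ t f)) 2 volume,
    SchwartzMap.coeFn_toLp (𝓕 f) 2 volume, bmul_coeFn (bddMeas_fourierChar t)
      ((𝓕 f).toLp 2 volume)] with s h4 h5 h6
  rw [h4, h6, h5]
  rw [SchwartzMap.fourier_coe, SchwartzMap.fourier_coe, Real.fourier_real_eq, Real.fourier_real_eq,
    ← integral_smul, ← integral_add_right_eq_self _ t]
  refine integral_congr_ae (ae_of_all _ fun v => ?_)
  simp only [SchwartzMap.compSubConstCLM_apply, add_sub_cancel_right, Circle.smul_def, smul_smul]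
  rw [← Circle.coe_mul, ← AddChar.map_add_eq_mul]
  congr 4; ring

/-- On Schwartz functions a bounded operator passes through the Fourier integral; density does the
rest. It is needed because the fibre operators act on the values and not on the variable. -/
theorem fourier_compLpL (A : F →L[ℂ] F) (η : Lp F 2 (volume : Measure ℝ)) :
    Lp.fourierTransformₗᵢ ℝ F (A.compLpL 2 volume η)
      = A.compLpL 2 volume (Lp.fourierTransformₗᵢ ℝ F η) := by
  refine DenseRange.induction_on (p := fun η => Lp.fourierTransformₗᵢ ℝ F (A.compLpL 2 volume η)
      = A.compLpL 2 volume (Lp.fourierTransformₗᵢ ℝ F η))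
    (SchwartzMap.denseRange_toLpCLM (E := ℝ) (p := 2) (μ := (volume : Measure ℝ)) (F := F)
      ENNReal.ofNat_ne_top) η ?_ ?_
  · exact isClosed_eq (by fun_prop) (by fun_prop)
  intro f
  have h1 : A.compLpL 2 volume (f.toLp 2 volume) = (f.postcompCLM A).toLp 2 volume := by
    refine Lp.ext ?_
    filter_upwards [A.coeFn_compLpL (f.toLp 2 volume), SchwartzMap.coeFn_toLp
      (f.postcompCLM A) 2 volume, SchwartzMap.coeFn_toLp f 2 volume] with b h1 h2 h3
    rw [h1, h2, h3]; rfl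
  have h2 := SchwartzMap.toLp_fourier_eq f
  have h3 := SchwartzMap.toLp_fourier_eq (f.postcompCLM A)
  rw [SchwartzMap.toLpCLM_apply, h1]
  refine h3.trans ?_
  refine Eq.trans ?_ (congrArg (A.compLpL 2 volume) h2.symm)
  refine Lp.ext ?_
  filter_upwards [SchwartzMap.coeFn_toLp (𝓕 (f.postcompCLM A)) 2 volume,
    SchwartzMap.coeFn_toLp (𝓕 f) 2 volume, A.coeFn_compLpL
      ((𝓕 f).toLp 2 volume)] with s h4 h5 h6
  rw [h4, h6, h5]
  have hi : Integrable fun v : ℝ => 𝐞 (-(v * s)) • f v := by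
    have hf : Integrable f := f.integrable
    refine hf.mono ?_ (ae_of_all _ fun v => by rw [Circle.norm_smul])
    exact ((Real.continuous_fourierChar.comp (by fun_prop)).smul f.continuous).aestronglyMeasurable
  rw [SchwartzMap.fourier_coe, SchwartzMap.fourier_coe, Real.fourier_real_eq, Real.fourier_real_eq,
    ← A.integral_comp_comm hi]
  refine integral_congr_ae (ae_of_all _ fun v => ?_)
  simp only [SchwartzMap.postcompCLM_apply, Circle.smul_def, map_smul]

end Fourier

theorem fourier_fiberTr (t : ℝ) (η : HTau) :
    Lp.fourierTransformₗᵢ ℝ L2R2 (fiberTr t η)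
      = bmul volume (bddMeas_fourierChar t) (Lp.fourierTransformₗᵢ ℝ L2R2 η) :=
  fourier_translate t η

theorem fourier_constField (A : L2R2 →L[ℂ] L2R2) (η : HTau) :
    Lp.fourierTransformₗᵢ ℝ L2R2 (constField A η)
      = constField A (Lp.fourierTransformₗᵢ ℝ L2R2 η) :=
  fourier_compLpL A η

theorem U_apply (ξ : L2G0) : U ξ = Lp.fourierTransformₗᵢ ℝ L2R2 (disintegrate ξ) := rfl

/-- `U` carries left translations to decomposable operators. -/
theorem U_leftTr_coeFn (g : G0) (ξ : L2G0) :
    U (leftTr g ξ) =ᵐ[volume] fun s => (𝐞 (-(g.b * s)) : ℂ) • planeRep g (U ξ s) := by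
  rw [U_apply, disintegrate_leftTr, fourier_fiberTr, fourier_constField, ← U_apply]
  filter_upwards [bmul_coeFn (bddMeas_fourierChar g.b)
      (constField (planeRep g).toContinuousLinearMap (U ξ)),
    constField_coeFn (planeRep g).toContinuousLinearMap (U ξ)] with s h1 h2
  rw [h1, h2]; rfl

theorem U_bmul {θ : G0 → ℂ} (hθ : BddMeas θ) {θ' : ℝ × ℝ → ℂ} (hθ' : BddMeas θ')
    (h : ∀ b y, θ (reorder (b, y)) = θ' y) (ξ : L2G0) :
    U (bmul volume hθ ξ) = constField (bmul volume hθ') (U ξ) := by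
  rw [U_apply, disintegrate_bmul hθ hθ' h, fourier_constField, ← U_apply]

theorem rho_apply_U (T : L2G0 →L[ℂ] L2G0) (ξ : L2G0) : rho T (U ξ) = U (T ξ) := by
  have h : ContinuousLinearMap.adjoint U.toContinuousLinearMap (U ξ) = ξ := by
    refine ext_inner_left ℂ fun v => ?_
    rw [ContinuousLinearMap.adjoint_inner_right]
    exact U.inner_map_map v ξ
  simp only [rho, ContinuousLinearMap.comp_apply, h]
  rfl

theorem norm_rho_le (T : L2G0 →L[ℂ] L2G0) : ‖rho T‖ ≤ ‖T‖ := by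
  refine ContinuousLinearMap.opNorm_le_bound _ (norm_nonneg _) fun η => ?_
  obtain ⟨ξ, rfl⟩ := U_surjective η
  rw [rho_apply_U, U.norm_map, U.norm_map]
  exact T.le_opNorm ξ

/-! ### `C₀(ℝ, 𝒦)` -/

theorem zero_mem_C0K : (0 : HTau →L[ℂ] HTau) ∈ C0K := by
  refine ⟨0, fun t => isCompactOperator_zero, by simp, fun ξ => ?_⟩
  filter_upwards [Lp.coeFn_zero L2R2 2 (volume : Measure ℝ)] with t ht using by simp

theorem add_mem_C0K {S T : HTau →L[ℂ] HTau} (hS : S ∈ C0K) (hT : T ∈ C0K) : S + T ∈ C0K := by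
  obtain ⟨φ, h1, h2, h3⟩ := hS
  obtain ⟨ψ, k1, k2, k3⟩ := hT
  refine ⟨φ + ψ, fun t => (h1 t).add (k1 t), ?_, fun ξ => ?_⟩
  · refine squeeze_zero (fun _ => norm_nonneg _) (fun t => norm_add_le (φ t) (ψ t)) ?_
    simpa using h2.add k2
  · filter_upwards [h3 ξ, k3 ξ, Lp.coeFn_add (S ξ) (T ξ)] with t e1 e2 e3
    rw [add_apply, e3, Pi.add_apply, e1, e2]; rfl

theorem smul_mem_C0K (c : ℂ) {T : HTau →L[ℂ] HTau} (hT : T ∈ C0K) : c • T ∈ C0K := by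
  obtain ⟨ψ, k1, k2, k3⟩ := hT
  refine ⟨c • ψ, fun t => (k1 t).smul c, ?_, fun ξ => ?_⟩
  · have : Tendsto (fun t => ‖c‖ * ‖ψ t‖) (cocompact ℝ) (𝓝 0) := by simpa using k2.const_mul ‖c‖
    exact this.congr fun t => (norm_smul c (ψ t)).symm
  · filter_upwards [k3 ξ, Lp.coeFn_smul c (T ξ)] with t e2 e3
    rw [smul_apply, e3, Pi.smul_apply, e2]; rfl

/-- A constant field acts as a multiplier of C₀(ℝ, 𝒦), since the compact operators form an ideal.
This allows left multiplication by the cut-off to the half space. -/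
theorem constField_comp_mem_C0K (A : L2R2 →L[ℂ] L2R2) {T : HTau →L[ℂ] HTau} (hT : T ∈ C0K) :
    constField A ∘L T ∈ C0K := by
  obtain ⟨ψ, k1, k2, k3⟩ := hT
  refine ⟨⟨fun t => A ∘L ψ t, by fun_prop⟩, fun t => (k1 t).clm_comp A, ?_, fun ξ => ?_⟩
  · refine squeeze_zero (fun _ => norm_nonneg _) (fun t => A.opNorm_comp_le (ψ t)) ?_
    simpa using k2.const_mul ‖A‖
  · filter_upwards [k3 ξ, constField_coeFn A (T ξ)] with t e2 e3
    rw [ContinuousLinearMap.comp_apply, e3, e2]; rfl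

theorem infDist_C0K_add_le (S T : HTau →L[ℂ] HTau) :
    Metric.infDist (S + T) C0K ≤ Metric.infDist S C0K + Metric.infDist T C0K := by
  refine le_of_forall_pos_le_add fun ε hε => ?_
  obtain ⟨S', hS', hS⟩ := (Metric.infDist_lt_iff ⟨0, zero_mem_C0K⟩).1
    (lt_add_of_pos_right (Metric.infDist S C0K) (half_pos hε))
  obtain ⟨T', hT', hT⟩ := (Metric.infDist_lt_iff ⟨0, zero_mem_C0K⟩).1
    (lt_add_of_pos_right (Metric.infDist T C0K) (half_pos hε))
  refine (Metric.infDist_le_dist_of_mem (add_mem_C0K hS' hT')).trans ?_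
  refine (dist_add_add_le _ _ _ _).trans ?_
  linarith

theorem infDist_C0K_smul_le (c : ℂ) (T : HTau →L[ℂ] HTau) :
    Metric.infDist (c • T) C0K ≤ ‖c‖ * Metric.infDist T C0K := by
  refine le_of_forall_pos_le_add fun ε hε => ?_
  obtain ⟨T', hT', hT⟩ := (Metric.infDist_lt_iff ⟨0, zero_mem_C0K⟩).1
    (lt_add_of_pos_right (Metric.infDist T C0K) (div_pos hε (by positivity : 0 < ‖c‖ + 1)))
  refine (Metric.infDist_le_dist_of_mem (smul_mem_C0K c hT')).trans ?_
  have h0 : dist (c • T) (c • T') = ‖c‖ * dist T T' := by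
    rw [dist_eq_norm, dist_eq_norm, ← smul_sub, norm_smul]
  rw [h0]
  have h1 : ‖c‖ * (ε / (‖c‖ + 1)) ≤ ε := by
    rw [mul_div_assoc', div_le_iff₀ (by positivity)]
    nlinarith [norm_nonneg c]
  nlinarith [mul_le_mul_of_nonneg_left hT.le (norm_nonneg c)]

theorem infDist_C0K_le_norm (T : HTau →L[ℂ] HTau) : Metric.infDist T C0K ≤ ‖T‖ := by
  simpa using Metric.infDist_le_dist_of_mem (x := T) zero_mem_C0K

/-! ### Fields of compact operators -/

section Field

variable {H : Type*} [NormedAddCommGroup H] [NormedSpace ℂ H]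

/-- The Fourier transform of `t ↦ D t ∘ K` over a bounded set is a `C₀` field of compact operators
if `D` is a strongly continuous family of contractions and `K` is compact. -/
theorem exists_fourier_field {D : ℝ → H →L[ℂ] H} (hD : ∀ ζ, Continuous fun t => D t ζ)
    (hD1 : ∀ t ζ, ‖D t ζ‖ ≤ ‖ζ‖) {K : H →L[ℂ] H} (hK : IsCompactOperator K) {a : Set ℝ}
    (ha : MeasurableSet a) [IsFiniteMeasure (volume.restrict a)] :
    ∃ φ : C(ℝ, H →L[ℂ] H), (∀ s, IsCompactOperator (φ s)) ∧
      Tendsto (fun s => ‖φ s‖) (cocompact ℝ) (𝓝 0) ∧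
      ∀ s c, φ s c = ∫ t in a, (𝐞 (-(t * s)) : ℂ) • D t (K c) := by
  have hcont := continuous_comp_of_isCompactOperator hD hD1 hK
  have hint : IntegrableOn (fun t => D t ∘L K) a := by
    refine (integrable_const ‖K‖).mono' hcont.aestronglyMeasurable (ae_of_all _ fun t => ?_)
    refine ContinuousLinearMap.opNorm_le_bound _ (norm_nonneg _) fun ζ => ?_
    exact (hD1 t _).trans (K.le_opNorm ζ)
  -- Norm continuity of `D t ∘L K`, which comes from compactness of `K`, makes `f` Bochner
  -- integrable as an operator-valued function. Riemann–Lebesgue in operator norm then gives the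
  -- decay.
  let f : ℝ → H →L[ℂ] H := a.indicator fun t => D t ∘L K
  have hf : Integrable f := (integrable_indicator_iff (f := fun t => D t ∘L K) (μ := volume) ha).2 hint
  have hval : ∀ s, 𝓕 f s = ∫ t in a, (𝐞 (-(t * s)) : ℂ) • (D t ∘L K) := fun s => by
    rw [Real.fourier_real_eq, ← integral_indicator ha]
    refine integral_congr_ae (ae_of_all _ fun t => ?_)
    by_cases ht : t ∈ a
    · simp [f, ht, Circle.smul_def]
    · simp [f, ht]
  have hint2 : ∀ s, IntegrableOn (fun t => (𝐞 (-(t * s)) : ℂ) • (D t ∘L K)) a := fun s => by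
    have hc : Continuous fun t : ℝ => (𝐞 (-(t * s)) : ℂ) :=
      continuous_induced_dom.comp (Real.continuous_fourierChar.comp (by fun_prop))
    refine Integrable.mono hint (hc.smul hcont).aestronglyMeasurable (ae_of_all _ fun t => ?_)
    rw [norm_smul, Circle.norm_coe, one_mul]
  have happ : ∀ s c, 𝓕 f s c = ∫ t in a, (𝐞 (-(t * s)) : ℂ) • D t (K c) := fun s c => by
    rw [hval, ContinuousLinearMap.integral_apply (hint2 s)]
    rfl
  refine ⟨⟨𝓕 f, VectorFourier.fourierIntegral_continuous Real.continuous_fourierChar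
    (by exact continuous_inner) hf⟩, fun s => ?_, ?_, happ⟩
  · have hm : ∀ ζ, AEStronglyMeasurable (fun t => ((𝐞 (-(t * s)) : ℂ) • D t) ζ)
        (volume.restrict a) := fun ζ => by
      have hc : Continuous fun t : ℝ => (𝐞 (-(t * s)) : ℂ) :=
        continuous_induced_dom.comp (Real.continuous_fourierChar.comp (by fun_prop))
      exact (hc.smul (hD ζ)).aestronglyMeasurable
    have hb : ∀ t ζ, ‖((𝐞 (-(t * s)) : ℂ) • D t) ζ‖ ≤ ‖ζ‖ := fun t ζ => by
      rw [smul_apply, norm_smul, Circle.norm_coe, one_mul]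
      exact hD1 t ζ
    -- Compactness of the transform: the compact factor comes out on the right of the strong
    -- integral.
    have h1 : 𝓕 f s = strongInt (volume.restrict a) hm hb ∘L K := by
      ext c
      rw [happ, ContinuousLinearMap.comp_apply, strongInt_apply]
      rfl
    change IsCompactOperator (𝓕 f s)
    rw [h1]
    exact hK.clm_comp (strongInt (volume.restrict a) hm hb)
  · have := (Real.zero_at_infty_fourier f).norm
    simpa using this

end Field

/-! ### Averages of translations over boxes -/

/-- A bounded measurable box in `G₀`. -/
structure Box where
  /-- The range of `x`. -/
  X : Set ℝ
  /-- The range of `b`. -/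
  B : Set ℝ
  /-- The range of `p`. -/
  P : Set ℝ
  measX : MeasurableSet X
  measB : MeasurableSet B
  measP : MeasurableSet P
  /-- A bound for the coordinates. -/
  radius : ℝ
  subX : ∀ t ∈ X, |t| ≤ radius
  subB : ∀ t ∈ B, |t| ≤ radius
  subP : ∀ t ∈ P, |t| ≤ radius

namespace Box

variable (β : Box)

theorem isFiniteMeasure_restrict {a : Set ℝ} {M : ℝ} (h : ∀ t ∈ a, |t| ≤ M) :
    IsFiniteMeasure (volume.restrict a) :=
  ⟨by
    rw [Measure.restrict_apply_univ]
    exact (measure_mono fun t ht => abs_le.1 (h t ht)).trans_lt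
      (measure_Icc_lt_top : volume (Set.Icc (-M) M) < ∞)⟩

instance : IsFiniteMeasure (volume.restrict β.X) := isFiniteMeasure_restrict β.subX
instance : IsFiniteMeasure (volume.restrict β.B) := isFiniteMeasure_restrict β.subB
instance : IsFiniteMeasure (volume.restrict β.P) := isFiniteMeasure_restrict β.subP

/-- Haar measure restricted to the box. -/
def μ : Measure G0 :=
  ((volume.restrict β.X).prod ((volume.restrict β.B).prod (volume.restrict β.P)) :
    Measure (ℝ × ℝ × ℝ))

instance : IsFiniteMeasure β.μ :=
  inferInstanceAs (IsFiniteMeasure ((volume.restrict β.X).prod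
    ((volume.restrict β.B).prod (volume.restrict β.P))))

theorem ae_mem : ∀ᵐ g ∂β.μ, |g.x| ≤ β.radius ∧ |g.b| ≤ β.radius ∧ |g.p| ≤ β.radius := by
  have h : ∀ᵐ g ∂((volume.restrict β.X).prod ((volume.restrict β.B).prod (volume.restrict β.P)) :
      Measure (ℝ × ℝ × ℝ)), g ∈ β.X ×ˢ (β.B ×ˢ β.P) := by
    rw [Measure.prod_restrict, Measure.prod_restrict]
    exact ae_restrict_mem (β.measX.prod (β.measB.prod β.measP))
  filter_upwards [h] with g hg
  exact ⟨β.subX _ hg.1, β.subB _ hg.2.1, β.subP _ hg.2.2⟩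

theorem aestronglyMeasurable_leftTr (ξ : L2G0) :
    AEStronglyMeasurable (fun g => (leftTr g).toContinuousLinearMap ξ) β.μ :=
  (continuous_leftTr ξ).aestronglyMeasurable

/-- The average `∫ λ(g) dg` of the left translations over the box. -/
def L : L2G0 →L[ℂ] L2G0 :=
  strongInt β.μ β.aestronglyMeasurable_leftTr fun g ξ => ((leftTr g).norm_map ξ).le

theorem L_apply (ξ : L2G0) : β.L ξ = ∫ g, leftTr g ξ ∂β.μ := rfl

theorem aestronglyMeasurable_planeRep (ζ : L2R2) : AEStronglyMeasurable
    (fun n : ℝ × ℝ => (planeRep (G0.mk n.1 0 n.2)).toContinuousLinearMap ζ)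
    ((volume.restrict β.X).prod (volume.restrict β.P)) :=
  ((continuous_planeRep ζ).comp (G0.continuous_mk (f := fun n : ℝ × ℝ => n.1) (g := fun _ => 0)
    (h := fun n => n.2) (by fun_prop) (by fun_prop) (by fun_prop))).aestronglyMeasurable

/-- The average on `L²(ℝ²)` of the translations over the `(x, p)`-side of the box. -/
def planeAvg : L2R2 →L[ℂ] L2R2 :=
  strongInt ((volume.restrict β.X).prod (volume.restrict β.P)) β.aestronglyMeasurable_planeRep
    fun n ζ => ((planeRep (G0.mk n.1 0 n.2)).norm_map ζ).le

theorem planeAvg_apply (ζ : L2R2) : β.planeAvg ζ = ∫ n : ℝ × ℝ, planeRep (G0.mk n.1 0 n.2) ζ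
    ∂((volume.restrict β.X).prod (volume.restrict β.P)) := rfl

/-- Fubini with b outermost, so that the inner integral over (x, p) is `planeAvg` and the outer one
a Fourier integral in b. -/
theorem integral_μ {E : Type*} [NormedAddCommGroup E] [NormedSpace ℝ E] {f : G0 → E}
    (hf : Continuous f) {C : ℝ} (hC : ∀ g, ‖f g‖ ≤ C) :
    ∫ g, f g ∂β.μ = ∫ t in β.B, ∫ n, f (G0.mk n.1 t n.2)
      ∂((volume.restrict β.X).prod (volume.restrict β.P)) := by
  have hi : ∀ {Z : Type} [TopologicalSpace Z] [SecondCountableTopology Z] [MeasurableSpace Z]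
      [OpensMeasurableSpace Z] (ν : Measure Z) [IsFiniteMeasure ν] {h : Z → G0}
      (_ : Continuous h), Integrable (fun z => f (h z)) ν := fun ν _ h hh => by
    refine (integrable_const C).mono' ?_ (ae_of_all _ fun z => hC _)
    have : Continuous fun z => f (h z) := hf.comp hh
    exact this.aestronglyMeasurable
  have h1 : ∫ g, f g ∂β.μ = ∫ x in β.X, ∫ t in β.B, ∫ p in β.P, f (G0.mk x t p) := by
    refine (integral_prod (μ := volume.restrict β.X)
      (ν := (volume.restrict β.B).prod (volume.restrict β.P))
      (fun z : ℝ × ℝ × ℝ => f (G0.mk z.1 z.2.1 z.2.2)) (hi _ (G0.continuous_mk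
        (by fun_prop) (by fun_prop) (by fun_prop)))).trans ?_
    refine integral_congr_ae (ae_of_all _ fun x => ?_)
    exact integral_prod (μ := volume.restrict β.B) (ν := volume.restrict β.P)
      (fun z : ℝ × ℝ => f (G0.mk x z.1 z.2)) (hi _ (G0.continuous_mk
        (by fun_prop) (by fun_prop) (by fun_prop)))
  rw [h1, integral_integral_swap]
  · refine integral_congr_ae (ae_of_all _ fun t => ?_)
    exact (integral_prod (μ := volume.restrict β.X) (ν := volume.restrict β.P)
      (fun z : ℝ × ℝ => f (G0.mk z.1 t z.2)) (hi _ (G0.continuous_mk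
        (by fun_prop) (by fun_prop) (by fun_prop)))).symm
  · exact (hi (((volume.restrict β.X).prod (volume.restrict β.B)).prod (volume.restrict β.P))
      (h := fun z => G0.mk z.1.1 z.1.2 z.2) (G0.continuous_mk
        (by fun_prop) (by fun_prop) (by fun_prop))).integral_prod_left

/-- Averaging translations is convolution with the indicator of a bounded rectangle. After a
compactly supported cut-off its values are bounded by the L¹ norm of θζ and have bounded support, so
the pointwise Hilbert–Schmidt criterion applies. -/
theorem isCompactOperator_planeAvg {θ : ℝ × ℝ → ℂ} (hθ : BddMeas θ) {R : ℝ}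
    (hR : ∀ y, R < ‖y‖ → θ y = 0) :
    IsCompactOperator (β.planeAvg ∘L bmul volume hθ) := by
  obtain ⟨C, hC⟩ := hθ.bdd
  have hC0 : 0 ≤ C := (norm_nonneg _).trans (hC 0)
  let V : ℝ := ((volume (Metric.closedBall (0 : ℝ × ℝ) R)) ^ (1 / 2 : ℝ)).toReal
  have hV : 0 ≤ V := ENNReal.toReal_nonneg
  have hfin : volume (Metric.closedBall (0 : ℝ × ℝ) R) ≠ ∞ := measure_closedBall_lt_top.ne
  -- `C * V` is the Cauchy–Schwarz bound for the L¹ norm of θζ on the ball of radius `R`;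
  -- translations from the box enlarge the support by at most `β.radius`.
  refine isCompactOperator_of_pointwise (g := (Metric.closedBall (0 : ℝ × ℝ)
    (R + β.radius)).indicator fun _ => C * V) _ ?_ fun ζ => ?_
  · exact memLp_indicator_const 2 measurableSet_closedBall _
      (Or.inr measure_closedBall_lt_top.ne)
  let w : ℝ × ℝ → ℂ := fun y => θ y • ζ y
  have hw : StronglyMeasurable w := hθ.meas.stronglyMeasurable.smul (Lp.stronglyMeasurable ζ)
  have hwL : MemLp w 2 volume := hθ.memLp ζ
  have hw0 : ∀ y, y ∉ Metric.closedBall (0 : ℝ × ℝ) R → w y = 0 := fun y hy => by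
    simp only [Metric.mem_closedBall, dist_zero_right, not_le] at hy
    simp [w, hR y hy]
  have hwi : Integrable w ∧ ∫ y, ‖w y‖ ≤ C * V * ‖ζ‖ := by
    have h1 := integral_norm_restrict_le (Metric.closedBall (0 : ℝ × ℝ) R) hfin hwL
    have h2 : (eLpNorm w 2 volume).toReal ≤ C * ‖ζ‖ := by
      have := norm_bmul_apply_le (μ := volume) hθ hC ζ
      rwa [Lp.norm_def, eLpNorm_congr_ae (bmul_coeFn hθ ζ)] at this
    refine ⟨(integrableOn_iff_integrable_of_support_subset fun y hy => ?_).1 h1.1, ?_⟩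
    · by_contra h
      exact hy (hw0 y h)
    · rw [← setIntegral_eq_integral_of_forall_compl_eq_zero
        (s := Metric.closedBall (0 : ℝ × ℝ) R) fun y hy => by rw [hw0 y hy, norm_zero]]
      refine h1.2.trans ?_
      calc _ ≤ C * ‖ζ‖ * V := mul_le_mul_of_nonneg_right h2 hV
        _ = _ := by ring
  have key : (β.planeAvg ∘L bmul volume hθ) ζ =ᵐ[volume] fun y => ∫ n, w (y - n)
      ∂((volume.restrict β.X).prod (volume.restrict β.P)) := by
    rw [ContinuousLinearMap.comp_apply, planeAvg_apply]
    refine integral_Lp_coeFn (Ψ := fun n y => w (y - n)) (integrable_strong _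
      β.aestronglyMeasurable_planeRep (fun n ζ => ((planeRep (G0.mk n.1 0 n.2)).norm_map ζ).le) _)
      ?_ (ae_of_all _ fun n => ?_)
    · exact (hw.comp_measurable (measurable_snd.sub measurable_fst)).aestronglyMeasurable
    · filter_upwards [planeRep_coeFn (G0.mk n.1 0 n.2) (bmul volume hθ ζ),
        (quasiMeasurePreserving_planeAct (G0.mk n.1 0 n.2)).ae (bmul_coeFn hθ ζ)] with y h1 h2
      refine h1.trans ?_
      rw [h2]
      have : planeAct (G0.mk n.1 0 n.2) y = y - n := by
        simp [planeAct]; rfl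
      rw [this]
      simp [w]
  filter_upwards [key] with y hy
  rw [hy]
  have hn : ∀ᵐ n ∂((volume.restrict β.X).prod (volume.restrict β.P)), ‖n‖ ≤ β.radius := by
    rw [Measure.prod_restrict]
    filter_upwards [ae_restrict_mem (β.measX.prod β.measP)] with n hn
    exact norm_prod_le_iff.2 ⟨β.subX _ hn.1, β.subP _ hn.2⟩
  by_cases hyB : y ∈ Metric.closedBall (0 : ℝ × ℝ) (R + β.radius)
  · rw [Set.indicator_of_mem hyB]
    refine (norm_integral_le_integral_norm _).trans (le_trans ?_ hwi.2)
    rw [← integral_sub_left_eq_self (fun y => ‖w y‖) volume y, Measure.prod_restrict]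
    refine setIntegral_le_integral ?_ (ae_of_all _ fun _ => norm_nonneg _)
    exact (hwi.1.comp_sub_left y).norm
  · rw [Set.indicator_of_notMem hyB, zero_mul]
    have : ∫ n, w (y - n) ∂((volume.restrict β.X).prod (volume.restrict β.P)) = 0 := by
      refine integral_eq_zero_of_ae ?_
      filter_upwards [hn] with n hn
      refine hw0 _ fun h => hyB ?_
      simp only [Metric.mem_closedBall, dist_zero_right] at h ⊢
      calc ‖y‖ = ‖(y - n) + n‖ := by rw [sub_add_cancel]
        _ ≤ ‖y - n‖ + ‖n‖ := norm_add_le _ _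
        _ ≤ _ := add_le_add h hn
    rw [this, norm_zero]

theorem continuous_planeRep_uncurry :
    Continuous fun z : G0 × L2R2 => planeRep z.1 z.2 := by
  rw [continuous_iff_continuousAt]
  rintro ⟨g, ζ⟩
  have h1 : Tendsto (fun z : G0 × L2R2 => planeRep z.1 ζ) (𝓝 (g, ζ)) (𝓝 (planeRep g ζ)) :=
    ((continuous_planeRep ζ).comp continuous_fst).tendsto (g, ζ)
  have h2 : Tendsto (fun z : G0 × L2R2 => planeRep z.1 z.2 - planeRep z.1 ζ) (𝓝 (g, ζ)) (𝓝 0) := by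
    refine squeeze_zero_norm (a := fun z : G0 × L2R2 => ‖z.2 - ζ‖) (fun z => ?_) ?_
    · rw [← map_sub, LinearIsometry.norm_map]
    · have := ((continuous_snd (X := G0) (Y := L2R2)).sub
        (continuous_const (y := ζ))).norm.tendsto (g, ζ)
      simpa using this
  have := h2.add h1
  simp only [sub_add_cancel, zero_add] at this
  exact this

/-- Averages of translations times compactly supported functions on the plane belong to
`C₀(ℝ, 𝒦)`. -/
theorem rho_L_comp_bmul_mem_C0K {θ : G0 → ℂ} (hθ : BddMeas θ) {θ' : ℝ × ℝ → ℂ} (hθ' : BddMeas θ')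
    (h : ∀ b y, θ (reorder (b, y)) = θ' y) {R : ℝ} (hR : ∀ y, R < ‖y‖ → θ' y = 0) :
    rho (β.L ∘L bmul volume hθ) ∈ C0K := by
  have hD : ∀ ζ, Continuous fun t => (planeRep (G0.mk 0 t 0)).toContinuousLinearMap ζ := fun ζ =>
    (continuous_planeRep ζ).comp (G0.continuous_mk (f := fun _ : ℝ => 0) (g := fun t => t)
      (h := fun _ => 0) (by fun_prop) (by fun_prop) (by fun_prop))
  obtain ⟨φ, h1, h2, h3⟩ := exists_fourier_field hD
    (fun t ζ => ((planeRep (G0.mk 0 t 0)).norm_map ζ).le)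
    (β.isCompactOperator_planeAvg hθ' hR) β.measB
  refine ⟨φ, h1, h2, fun η => ?_⟩
  obtain ⟨ξ, rfl⟩ := U_surjective η
  rw [rho_apply_U, ContinuousLinearMap.comp_apply]
  set w := bmul volume hθ ξ with hw
  have hcont : Continuous fun g => U (leftTr g w) := U.continuous.comp (continuous_leftTr w)
  have e1 : U (β.L w) = ∫ g, U (leftTr g w) ∂β.μ := by
    rw [L_apply]
    exact (U.toContinuousLinearMap.integral_comp_comm
      (integrable_strong β.μ β.aestronglyMeasurable_leftTr
        (fun g ξ => ((leftTr g).norm_map ξ).le) w)).symm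
  have hi : Integrable (fun g => U (leftTr g w)) β.μ :=
    (integrable_const ‖w‖).mono' hcont.aestronglyMeasurable
      (ae_of_all _ fun g => by rw [U.norm_map, LinearIsometry.norm_map])
  have hchar : Continuous fun z : G0 × ℝ => (𝐞 (-(z.1.b * z.2)) : ℂ) :=
    continuous_induced_dom.comp (Real.continuous_fourierChar.comp (by fun_prop))
  have e2 := integral_Lp_coeFn (μ := (volume : Measure ℝ)) hi
    (Ψ := fun g s => (𝐞 (-(g.b * s)) : ℂ) • planeRep g (U w s)) (by
      have : StronglyMeasurable fun z : G0 × ℝ => (z.1, U w z.2) :=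
        measurable_fst.stronglyMeasurable.prodMk
          ((Lp.stronglyMeasurable (U w)).comp_measurable measurable_snd)
      exact (hchar.measurable.stronglyMeasurable.smul
        (continuous_planeRep_uncurry.comp_stronglyMeasurable this)).aestronglyMeasurable)
    (ae_of_all _ fun g => U_leftTr_coeFn g w)
  have e3 : U w =ᵐ[volume] fun s => bmul volume hθ' (U ξ s) := by
    rw [hw, U_bmul hθ hθ' h]
    exact constField_coeFn _ _
  filter_upwards [e2, e3] with s e2 e3
  rw [e1]
  refine e2.trans ?_
  rw [h3]
  refine Eq.trans (β.integral_μ (f := fun g => (𝐞 (-(g.b * s)) : ℂ) • planeRep g (U w s))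
    ((hchar.comp (by fun_prop : Continuous fun g : G0 => (g, s))).smul (continuous_planeRep _))
    (C := ‖U w s‖) (fun g => ?_)) ?_
  · rw [norm_smul, Circle.norm_coe, one_mul, LinearIsometry.norm_map]
  refine integral_congr_ae (ae_of_all _ fun t => ?_)
  simp only [G0.b_mk]
  rw [integral_smul]
  congr 1
  rw [ContinuousLinearMap.comp_apply, planeAvg_apply, ← e3]
  refine Eq.trans ?_ (ContinuousLinearMap.integral_comp_comm
    (planeRep (G0.mk 0 t 0)).toContinuousLinearMap (integrable_strong _
      β.aestronglyMeasurable_planeRep (fun n ζ => ((planeRep (G0.mk n.1 0 n.2)).norm_map ζ).le) _))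
  refine integral_congr_ae (ae_of_all _ fun n => ?_)
  -- Placing exp(tB) on the left moves its action out of the (x, p)-average, which leaves the form
  -- `D t ∘L K` of `exists_fourier_field`.
  have : G0.mk n.1 t n.2 = G0.mk 0 t 0 * G0.mk n.1 0 n.2 := by
    ext <;> simp
  simp only [this]
  exact planeRep_mul _ _ _

end Box

/-- A multiplier independent of b in the reordered coordinates commutes with the Fourier transform
in b, so it becomes a constant field. -/
theorem rho_comp_mem_C0K {θ : G0 → ℂ} (hθ : BddMeas θ) {θ' : ℝ × ℝ → ℂ} (hθ' : BddMeas θ')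
    (h : ∀ b y, θ (reorder (b, y)) = θ' y) {T : L2G0 →L[ℂ] L2G0} (hT : rho T ∈ C0K) :
    rho (bmul volume hθ ∘L T) ∈ C0K := by
  have : rho (bmul volume hθ ∘L T) = constField (bmul volume hθ') ∘L rho T := by
    ext1 η
    obtain ⟨ξ, rfl⟩ := U_surjective η
    rw [rho_apply_U, ContinuousLinearMap.comp_apply, ContinuousLinearMap.comp_apply, rho_apply_U,
      U_bmul hθ hθ' h]
  rw [this]
  exact constField_comp_mem_C0K _ hT

/-! ### The Fourier transform of a window in `span(Q, R, S)` -/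

/-- A bounded measurable set in the span of `Q, R, S`. -/
structure Window where
  /-- The underlying set. -/
  W : Set (ℝ × ℝ × ℝ)
  meas : MeasurableSet W
  /-- A bound for the coordinates. -/
  radius : ℝ
  sub : ∀ h ∈ W, ‖h‖ ≤ radius

theorem norm_fourierChar_sub_le (a b : ℝ) : ‖(𝐞 a : ℂ) - 𝐞 b‖ ≤ 2 * Real.pi * |a - b| := by
  have e : (𝐞 a : ℂ) - 𝐞 b = 𝐞 b * ((𝐞 (a - b) : ℂ) - 1) := by
    rw [mul_sub, ← Circle.coe_mul, ← AddChar.map_add_eq_mul, add_sub_cancel, mul_one]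
  rw [e, norm_mul, Circle.norm_coe, one_mul, Real.fourierChar_apply, mul_comm _ Complex.I]
  refine (Real.norm_exp_I_mul_ofReal_sub_one_le).trans ?_
  rw [Real.norm_eq_abs, abs_mul, abs_of_pos Real.two_pi_pos]

theorem norm_chi_sub_le (l m h : ℝ × ℝ × ℝ) :
    ‖chi l h - chi m h‖ ≤ 2 * Real.pi * (3 * (‖l - m‖ * ‖h‖)) := by
  refine (norm_fourierChar_sub_le _ _).trans ?_
  gcongr
  have h1 : ∀ k : ℝ × ℝ × ℝ, |k.1| ≤ ‖k‖ ∧ |k.2.1| ≤ ‖k‖ ∧ |k.2.2| ≤ ‖k‖ := fun k =>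
    ⟨norm_fst_le k, (norm_fst_le k.2).trans (norm_snd_le k), (norm_snd_le k.2).trans (norm_snd_le k)⟩
  obtain ⟨a1, a2, a3⟩ := h1 (l - m)
  obtain ⟨b1, b2, b3⟩ := h1 h
  have e : -(l.1 * h.1 + l.2.1 * h.2.1 + l.2.2 * h.2.2)
      - -(m.1 * h.1 + m.2.1 * h.2.1 + m.2.2 * h.2.2)
      = -((l - m).1 * h.1 + (l - m).2.1 * h.2.1 + (l - m).2.2 * h.2.2) := by
    simp only [Prod.fst_sub, Prod.snd_sub]; ring
  rw [e, abs_neg]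
  have c1 := mul_le_mul a1 b1 (abs_nonneg _) (norm_nonneg _)
  have c2 := mul_le_mul a2 b2 (abs_nonneg _) (norm_nonneg _)
  have c3 := mul_le_mul a3 b3 (abs_nonneg _) (norm_nonneg _)
  rw [← abs_mul] at c1 c2 c3
  have := abs_add_three ((l - m).1 * h.1) ((l - m).2.1 * h.2.1) ((l - m).2.2 * h.2.2)
  linarith

/-- The functional `l ∘ Ad(u⁻¹)`. -/
def coAd (l : ℝ × ℝ × ℝ) (u : G0) : ℝ × ℝ × ℝ :=
  (Real.exp (-u.x - u.b) * (l.1 - l.2.1 * u.p + l.2.2 * (u.p ^ 2 / 2)),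
    Real.exp (-u.x - u.b / 2) * (l.2.1 - l.2.2 * u.p), Real.exp (-u.x) * l.2.2)

theorem chi_adInv (l : ℝ × ℝ × ℝ) (u : G0) (h : ℝ × ℝ × ℝ) :
    chi l (adInv u h) = chi (coAd l u) h := by
  simp only [chi, adInv, coAd]
  congr 2; ring

theorem continuous_coAd (l : ℝ × ℝ × ℝ) : Continuous (coAd l) := by
  unfold coAd; fun_prop

namespace Window

variable (ω : Window)

theorem volume_ne_top : volume ω.W ≠ ∞ :=
  ((measure_mono fun h hh => mem_closedBall_zero_iff.2 (ω.sub h hh)).trans_lt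
    (measure_closedBall_lt_top : volume (Metric.closedBall (0 : ℝ × ℝ × ℝ) ω.radius) < ∞)).ne

instance : IsFiniteMeasure (volume.restrict ω.W) :=
  ⟨by rw [Measure.restrict_apply_univ]; exact ω.volume_ne_top.lt_top⟩

/-- The Fourier transform of the indicator of the window. -/
def ft (m : ℝ × ℝ × ℝ) : ℂ := ∫ h in ω.W, chi m h

theorem integrable_chi (m : ℝ × ℝ × ℝ) : Integrable (chi m) (volume.restrict ω.W) :=
  (integrable_const (1 : ℝ)).mono' (continuous_chi m).aestronglyMeasurable
    (ae_of_all _ fun h => (norm_chi m h).le)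

theorem norm_ft_le (m : ℝ × ℝ × ℝ) : ‖ω.ft m‖ ≤ (volume.restrict ω.W).real Set.univ := by
  have := norm_integral_le_of_norm_le_const (μ := volume.restrict ω.W) (f := chi m) (C := 1)
    (ae_of_all _ fun h => (norm_chi m h).le)
  rwa [one_mul] at this

/-- A Lipschitz constant of the Fourier transform of the window. -/
def lip : ℝ := 2 * Real.pi * (3 * |ω.radius|) * (volume.restrict ω.W).real Set.univ

theorem lip_nonneg : 0 ≤ ω.lip := by
  have := Real.pi_pos
  unfold lip
  positivity

theorem norm_ft_sub_le (l m : ℝ × ℝ × ℝ) : ‖ω.ft l - ω.ft m‖ ≤ ω.lip * ‖l - m‖ := by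
  rw [ft, ft, ← integral_sub (ω.integrable_chi l) (ω.integrable_chi m)]
  have := norm_integral_le_of_norm_le_const (μ := volume.restrict ω.W)
    (f := fun h => chi l h - chi m h) (C := 2 * Real.pi * (3 * (‖l - m‖ * |ω.radius|))) (by
      filter_upwards [ae_restrict_mem ω.meas] with h hh
      refine (norm_chi_sub_le l m h).trans ?_
      have := (ω.sub h hh).trans (le_abs_self _)
      have := Real.pi_pos
      gcongr)
  refine this.trans (le_of_eq ?_)
  unfold lip; ring

theorem continuous_ft : Continuous ω.ft := by
  have : LipschitzWith ω.lip.toNNReal ω.ft := LipschitzWith.of_dist_le_mul fun l m => by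
    rw [dist_eq_norm, dist_eq_norm, Real.coe_toNNReal _ ω.lip_nonneg]
    exact ω.norm_ft_sub_le l m
  exact this.continuous

/-- The linear functional with coordinates `m`. -/
def functional (m : ℝ × ℝ × ℝ) : StrongDual ℝ (ℝ × ℝ × ℝ) :=
  m.1 • ContinuousLinearMap.fst ℝ ℝ (ℝ × ℝ)
    + m.2.1 • (ContinuousLinearMap.fst ℝ ℝ ℝ ∘L ContinuousLinearMap.snd ℝ ℝ (ℝ × ℝ))
    + m.2.2 • (ContinuousLinearMap.snd ℝ ℝ ℝ ∘L ContinuousLinearMap.snd ℝ ℝ (ℝ × ℝ))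

theorem functional_apply (m h : ℝ × ℝ × ℝ) :
    functional m h = m.1 * h.1 + m.2.1 * h.2.1 + m.2.2 * h.2.2 := rfl

theorem norm_le_norm_functional (m : ℝ × ℝ × ℝ) : ‖m‖ ≤ ‖functional m‖ := by
  have h : ∀ e : ℝ × ℝ × ℝ, ‖e‖ ≤ 1 → |functional m e| ≤ ‖functional m‖ := fun e he =>
    (functional m).le_of_opNorm_le_of_le le_rfl he |>.trans (by rw [mul_one])
  refine norm_prod_le_iff.2 ⟨?_, norm_prod_le_iff.2 ⟨?_, ?_⟩⟩
  · simpa [functional_apply] using h (1, 0, 0) (by simp [Prod.norm_def])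
  · simpa [functional_apply] using h (0, 1, 0) (by simp [Prod.norm_def])
  · simpa [functional_apply] using h (0, 0, 1) (by simp [Prod.norm_def])

/-- Riemann–Lebesgue on the dual of span(Q, R, S), with `norm_le_norm_functional` passing from
coordinates to functionals. -/
theorem exists_norm_ft_le {η : ℝ} (hη : 0 < η) : ∃ N : ℝ, 0 < N ∧ ∀ m, N ≤ ‖m‖ → ‖ω.ft m‖ ≤ η := by
  have : (volume : Measure (ℝ × ℝ)).IsAddHaarMeasure := Measure.prod.instIsAddHaarMeasure _ _
  have : (volume : Measure (ℝ × ℝ × ℝ)).IsAddHaarMeasure := Measure.prod.instIsAddHaarMeasure _ _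
  have h1 := tendsto_integral_exp_smul_cocompact (ω.W.indicator fun _ => (1 : ℂ))
    (volume : Measure (ℝ × ℝ × ℝ))
  have h2 := h1.norm
  rw [norm_zero] at h2
  have h3 := h2.eventually (gt_mem_nhds hη)
  have : ProperSpace (StrongDual ℝ (ℝ × ℝ × ℝ)) := FiniteDimensional.proper ℝ _
  rw [← Metric.cobounded_eq_cocompact, hasBasis_cobounded_norm.eventually_iff] at h3
  obtain ⟨N, -, hN⟩ := h3
  refine ⟨max N 1, by positivity, fun m hm => ?_⟩
  have h4 := hN (((le_max_left N 1).trans hm).trans (norm_le_norm_functional m) :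
    functional m ∈ {x | N ≤ ‖x‖})
  refine le_of_eq_of_le ?_ h4.le
  rw [ft, ← integral_indicator ω.meas]
  congr 1
  refine integral_congr_ae (ae_of_all _ fun h => ?_)
  by_cases hh : h ∈ ω.W
  · simp [hh, chi, functional_apply, Circle.smul_def]
  · simp [hh]

/-- The multiplier `u ↦ ∫_W χ_l(Ad(u⁻¹) V) dV`. -/
def mult (l : ℝ × ℝ × ℝ) (u : G0) : ℂ := ω.ft (coAd l u)

theorem bddMeas_mult (l : ℝ × ℝ × ℝ) : BddMeas (ω.mult l) :=
  ⟨(ω.continuous_ft.comp (continuous_coAd l)).measurable, _, fun _ => ω.norm_ft_le _⟩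

end Window

/-! ### The images of the indicators of boxes -/

/-- The product of a box in `G₀` and a window, as a subset of `G`. -/
def boxSet (β : Box) (ω : Window) : Set G6 :=
  {g | (g.u.x ∈ β.X ∧ g.u.b ∈ β.B ∧ g.u.p ∈ β.P) ∧ g.h ∈ ω.W}

theorem volume_restrict_boxSet (β : Box) (ω : Window) :
    volume.restrict (boxSet β ω) = (β.μ.prod (volume.restrict ω.W) : Measure (G0 × (ℝ × ℝ × ℝ))) := by
  have h1 : (volume : Measure G0).restrict (β.X ×ˢ (β.B ×ˢ β.P) : Set (ℝ × ℝ × ℝ)) = β.μ := by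
    have e1 := Measure.prod_restrict (μ := (volume : Measure ℝ))
      (ν := (volume : Measure (ℝ × ℝ))) β.X (β.B ×ˢ β.P)
    have e2 := Measure.prod_restrict (μ := (volume : Measure ℝ))
      (ν := (volume : Measure ℝ)) β.B β.P
    rw [Box.μ, e2]
    exact e1.symm
  rw [← h1]
  exact (Measure.prod_restrict (μ := (volume : Measure G0))
    (ν := (volume : Measure (ℝ × ℝ × ℝ))) (β.X ×ˢ (β.B ×ˢ β.P) : Set (ℝ × ℝ × ℝ)) ω.W).symm

theorem measurableSet_boxSet (β : Box) (ω : Window) : MeasurableSet (boxSet β ω) :=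
  ((β.measX.prod (β.measB.prod β.measP)).prod ω.meas :
    MeasurableSet ((β.X ×ˢ (β.B ×ˢ β.P)) ×ˢ ω.W : Set ((ℝ × ℝ × ℝ) × (ℝ × ℝ × ℝ))))

theorem volume_boxSet_ne_top (β : Box) (ω : Window) : volume (boxSet β ω) ≠ ∞ := by
  rw [← Measure.restrict_apply_univ, volume_restrict_boxSet]
  exact measure_ne_top _ _

theorem bddMeas_chi_adInv (l h : ℝ × ℝ × ℝ) : BddMeas fun u : G0 => chi l (adInv u h) :=
  ⟨((continuous_chi l).comp (continuous_adInv.comp (by fun_prop :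
    Continuous fun u : G0 => (u, h)))).measurable, 1, fun _ => (norm_chi _ _).le⟩

/-- For g = u exp V the multiplication by the character comes first and the translation last, so
integrating over V affects only the multiplier. -/
theorem indOp_eq (l : ℝ × ℝ × ℝ) (u : G0) (h : ℝ × ℝ × ℝ) (ξ : L2G0) :
    indOp l (G6.mk u h) ξ = leftTr u (bmul volume (bddMeas_chi_adInv l h) ξ) := by
  refine Lp.ext ?_
  filter_upwards [indOp_coeFn l (G6.mk u h) ξ, leftTr_coeFn u (bmul volume (bddMeas_chi_adInv l h) ξ),
    (G0.measurePreserving_mul_left u⁻¹).quasiMeasurePreserving.ae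
      (bmul_coeFn (bddMeas_chi_adInv l h) ξ)] with v h1 h2 h3
  rw [h1, h2, h3]
  rfl

theorem integrable_bmul_chi (ω : Window) (l : ℝ × ℝ × ℝ) (ξ : L2G0) :
    Integrable (fun h => bmul volume (bddMeas_chi_adInv l h) ξ) (volume.restrict ω.W) := by
  have hc : Continuous fun h => bmul volume (bddMeas_chi_adInv l h) ξ := by
    have h1 : Continuous fun h => indOp l (G6.mk 1 h) ξ :=
      (continuous_indOp l ξ).comp (continuous_const.prodMk continuous_id :
        Continuous fun h : ℝ × ℝ × ℝ => ((1, h) : G0 × (ℝ × ℝ × ℝ)))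
    refine h1.congr fun h => ?_
    rw [indOp_eq]
    refine Lp.ext ?_
    filter_upwards [leftTr_coeFn 1 (bmul volume (bddMeas_chi_adInv l h) ξ)] with v hv
    rw [hv, inv_one, one_mul]
  exact (integrable_const ‖ξ‖).mono' hc.aestronglyMeasurable (ae_of_all _ fun h => by
    simpa using norm_bmul_apply_le (bddMeas_chi_adInv l h) (fun u => (norm_chi _ _).le) ξ)

theorem integral_bmul_chi (ω : Window) (l : ℝ × ℝ × ℝ) (ξ : L2G0) :
    ∫ h in ω.W, bmul volume (bddMeas_chi_adInv l h) ξ = bmul volume (ω.bddMeas_mult l) ξ := by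
  have hi := integrable_bmul_chi ω l ξ
  refine Lp.ext ?_
  have hm : Continuous fun z : (ℝ × ℝ × ℝ) × G0 => chi l (adInv z.2 z.1) :=
    (continuous_chi l).comp (continuous_adInv.comp (by fun_prop :
      Continuous fun z : (ℝ × ℝ × ℝ) × G0 => (z.2, z.1)))
  have h1 := integral_Lp_coeFn (μ := (volume : Measure G0)) hi
    (Ψ := fun h u => chi l (adInv u h) • ξ u)
    (hm.measurable.stronglyMeasurable.smul
      ((Lp.stronglyMeasurable ξ).comp_measurable measurable_snd)).aestronglyMeasurable
    (ae_of_all _ fun h => bmul_coeFn (bddMeas_chi_adInv l h) ξ)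
  filter_upwards [h1, bmul_coeFn (ω.bddMeas_mult l) ξ] with u h1 h2
  rw [h1, h2, integral_smul_const]
  simp only [chi_adInv]
  rfl

/-- The element of `C*(G)` given by the indicator of a box. -/
def boxElt (β : Box) (ω : Window) : CStarG :=
  ⟨universalRep volume (indicatorConstLp 1 (measurableSet_boxSet β ω) (volume_boxSet_ne_top β ω)
    (1 : ℂ)), subset_closure ⟨_, rfl⟩⟩

theorem integral_boxSet (β : Box) (ω : Window) (l : ℝ × ℝ × ℝ) (ξ : L2G0) :
    ∫ g in boxSet β ω, indOp l g ξ = β.L (bmul volume (ω.bddMeas_mult l) ξ) := by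
  have hc : Continuous fun z : G0 × (ℝ × ℝ × ℝ) => indOp l (G6.mk z.1 z.2) ξ :=
    continuous_indOp l ξ
  have hi : Integrable (fun z : G0 × (ℝ × ℝ × ℝ) => indOp l (G6.mk z.1 z.2) ξ)
      (β.μ.prod (volume.restrict ω.W)) :=
    (integrable_const ‖ξ‖).mono' hc.aestronglyMeasurable
      (ae_of_all _ fun z => (norm_indOp l _ ξ).le)
  rw [volume_restrict_boxSet]
  refine (integral_prod _ hi).trans ?_
  rw [Box.L_apply]
  refine integral_congr_ae (ae_of_all _ fun u => ?_)
  simp only [indOp_eq]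
  rw [← integral_bmul_chi]
  exact (leftTr u).toContinuousLinearMap.integral_comp_comm (integrable_bmul_chi ω l ξ)

theorem integral_indicatorConstLp_smul (β : Box) (ω : Window) (l : ℝ × ℝ × ℝ) (ξ : L2G0) :
    ∫ g : G6, (indicatorConstLp 1 (measurableSet_boxSet β ω) (volume_boxSet_ne_top β ω) (1 : ℂ) :
      Lp ℂ 1 (volume : Measure G6)) g • indOp l g ξ = ∫ g in boxSet β ω, indOp l g ξ := by
  rw [← integral_indicator (measurableSet_boxSet β ω)]
  refine integral_congr_ae ?_
  filter_upwards [indicatorConstLp_coeFn (p := 1) (hs := measurableSet_boxSet β ω)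
    (hμs := volume_boxSet_ne_top β ω) (c := (1 : ℂ))] with g hg
  rw [hg]
  by_cases h : g ∈ boxSet β ω
  · simp only [Set.indicator_of_mem h, one_smul]
  · simp only [Set.indicator_of_notMem h, zero_smul]

/-- The functional `l` enters only through a multiplication operator; the average of translations is
common to all `l`. Comparing the representations at εS* and c_k εQ* thus becomes a comparison of two
functions. -/
theorem sigma_boxElt (β : Box) (ω : Window) (l : ℝ × ℝ × ℝ) (ξ : L2G0) :
    sigma l (boxElt β ω) ξ = β.L (bmul volume (ω.bddMeas_mult l) ξ) :=
  (integral_indicatorConstLp_smul β ω l ξ).trans (integral_boxSet β ω l ξ)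

/-! ### The geometry of the sets `S` and `R` -/

theorem mem_I_iff {c : ℝ} (hc : 0 < c) {x : ℝ} {n : ℤ} : x ∈ I c n ↔ ⌊x / c⌋ = n := by
  rw [I, Set.mem_Ico, Int.floor_eq_iff, le_div_iff₀ hc, div_lt_iff₀ hc, add_mul, one_mul, mul_comm c]

theorem exists_mem_I_add {c x t : ℝ} {n : ℤ} (hx : x ∈ I c n) (ht : |t| ≤ c) :
    ∃ j : ℤ, |j| ≤ 1 ∧ t + x ∈ I c (n + j) := by
  rw [add_comm t x]
  obtain ⟨h1, h2⟩ := hx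
  obtain ⟨t1, t2⟩ := abs_le.1 ht
  by_cases ha : x + t < c * n
  · refine ⟨-1, by simp, ?_, ?_⟩ <;> push_cast <;> linarith
  · by_cases hb : x + t < c * n + c
    · exact ⟨0, by simp, by push_cast; linarith, by push_cast; linarith⟩
    · refine ⟨1, by simp, ?_, ?_⟩ <;> push_cast <;> linarith

theorem width_pos {D δ : ℝ} (hD : 0 < D) (hδ : 0 < δ) (t : ℝ) : 0 < D * δ ^ 2 * Real.exp t := by
  positivity

theorem eq_of_mem_setS {r δ D : ℝ} (hr : 0 < r) (hδ : 0 < δ) (hD : 0 < D) {u : G0}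
    {k l : ℤ × ℤ × ℤ} (hk : u ∈ setS r δ D k) (hl : u ∈ setS r δ D l) : k = l := by
  obtain ⟨-, k1, k2, k3⟩ := hk
  obtain ⟨-, l1, l2, l3⟩ := hl
  have e1 : k.1 = l.1 := ((mem_I_iff hr).1 k1).symm.trans ((mem_I_iff hr).1 l1)
  have e2 : k.2.1 = l.2.1 := ((mem_I_iff hr).1 k2).symm.trans ((mem_I_iff hr).1 l2)
  rw [e1, e2] at k3
  have e3 : k.2.2 = l.2.2 := ((mem_I_iff (width_pos hD hδ _)).1 k3).symm.trans
    ((mem_I_iff (width_pos hD hδ _)).1 l3)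
  exact Prod.ext e1 (Prod.ext e2 e3)

theorem pairwise_disjoint_setS {r δ D : ℝ} (hr : 0 < r) (hδ : 0 < δ) (hD : 0 < D) :
    Pairwise fun k l => Disjoint (setS r δ D k) (setS r δ D l) := fun _ _ hkl =>
  Set.disjoint_left.2 fun _ hk hl => hkl (eq_of_mem_setS hr hδ hD hk hl)

/-- The union of the sets `S`. -/
def halfSpace (δ : ℝ) : Set G0 := {u | Real.exp (-u.x) ≤ δ ^ 6}

theorem measurableSet_halfSpace (δ : ℝ) : MeasurableSet (halfSpace δ) :=
  measurableSet_le (by fun_prop : Continuous fun u : G0 => Real.exp (-u.x)).measurable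
    measurable_const

theorem iUnion_setS {r δ D : ℝ} (hr : 0 < r) (hδ : 0 < δ) (hD : 0 < D) :
    ⋃ k, setS r δ D k = halfSpace δ := by
  refine Set.Subset.antisymm (Set.iUnion_subset fun k u hu => hu.1) fun u hu => ?_
  exact Set.mem_iUnion.2 ⟨(⌊u.x / r⌋, ⌊u.b / r⌋,
    ⌊u.p / (D * δ ^ 2 * Real.exp (r / 2 * (⌊u.x / r⌋ + ⌊u.b / r⌋)))⌋), hu, (mem_I_iff hr).2 rfl,
    (mem_I_iff hr).2 rfl, (mem_I_iff (width_pos hD hδ _)).2 rfl⟩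

/-- For a fixed shift `j` the shifted cells form a disjoint family, so `u` and `j` determine `k`;
there are 3³ shifts. -/
theorem card_le_of_mem_setR {r δ D : ℝ} (hr : 0 < r) (hδ : 0 < δ) (hD : 0 < D) (u : G0)
    (s : Finset (ℤ × ℤ × ℤ)) (hs : ∀ k ∈ s, u ∈ setR r δ D k) : s.card ≤ 27 := by
  classical
  have h : ∀ k ∈ s, ∃ j : ℤ × ℤ × ℤ, (|j.1| ≤ 1 ∧ |j.2.1| ≤ 1 ∧ |j.2.2| ≤ 1) ∧
      u ∈ setS r δ (D * Real.exp (r / 2 * (-j.1 - j.2.1))) (k + j) := fun k hk => by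
    obtain ⟨j, hj, hu⟩ := Set.mem_iUnion₂.1 (hs k hk)
    exact ⟨j, hj, hu⟩
  choose! j hj hu using h
  have h1 : Set.InjOn j s := fun k hk l hl hkl => by
    have h1 := hu k hk
    have h2 := hu l hl
    rw [hkl] at h1
    exact add_right_cancel (eq_of_mem_setS hr hδ (by positivity) h1 h2)
  have h2 : ∀ k ∈ s, j k ∈ (Finset.Icc (-1 : ℤ) 1 ×ˢ (Finset.Icc (-1 : ℤ) 1 ×ˢ Finset.Icc (-1 : ℤ) 1)) :=
    fun k hk => by
      obtain ⟨h1, h2, h3⟩ := hj k hk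
      simp only [Finset.mem_product, Finset.mem_Icc]
      exact ⟨abs_le.1 h1, abs_le.1 h2, abs_le.1 h3⟩
  exact Finset.card_le_card_of_injOn j h2 h1

theorem setR_subset_halfSpace (r δ D : ℝ) (k : ℤ × ℤ × ℤ) : setR r δ D k ⊆ halfSpace δ :=
  Set.iUnion₂_subset fun _ _ _ hu => hu.1

/-- Small translates of points of `S` stay in `R`, unless they leave the half space. -/
theorem mul_mem_setR_iff {r δ D M : ℝ} (hδ : 0 < δ) (hM : M ≤ r)
    (hMD : M * Real.exp r * δ ≤ D) {g v : G0} {k : ℤ × ℤ × ℤ} (hv : v ∈ setS r δ D k)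
    (hg : |g.x| ≤ M ∧ |g.b| ≤ M ∧ |g.p| ≤ M) :
    g * v ∈ setR r δ D k ↔ g * v ∈ halfSpace δ := by
  refine ⟨fun h => setR_subset_halfSpace r δ D k h, fun h => ?_⟩
  obtain ⟨v0, v1, v2, v3⟩ := hv
  obtain ⟨g1, g2, g3⟩ := hg
  have hM0 : 0 ≤ M := (abs_nonneg _).trans g1
  obtain ⟨j1, hj1, h1⟩ := exists_mem_I_add v1 (g1.trans hM)
  obtain ⟨j2, hj2, h2⟩ := exists_mem_I_add v2 (g2.trans hM)
  -- Left translation by `g` moves p by e^{v.b/2} g.p, which may be large. The claim is that it does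
  -- not exceed one cell width.
  have hp : |Real.exp (v.b / 2) * g.p| ≤ D * δ ^ 2 * Real.exp (r / 2 * (k.1 + k.2.1)) := by
    rw [abs_mul, abs_of_pos (Real.exp_pos _)]
    have hb : Real.exp (v.b / 2) ≤ Real.exp (r / 2 * k.2.1) * Real.exp (r / 2) := by
      rw [← Real.exp_add]
      refine Real.exp_le_exp.2 ?_
      have := v2.2
      linarith
    -- The condition e^{-x} ≤ δ⁶ and x < r k₁ + r give this after a square root. Of the factor δ³,
    -- two powers make the cell width and one absorbs e^r in `hMD`.
    have hx : 1 ≤ δ ^ 3 * (Real.exp (r / 2 * k.1) * Real.exp (r / 2)) := by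
      have e1 : Real.exp (-(r * k.1 + r)) ≤ δ ^ 6 := by
        refine le_trans (Real.exp_le_exp.2 ?_) v0
        have := v1.2
        linarith
      have e2 : Real.exp (-(r * k.1 + r)) * (Real.exp (r / 2 * k.1) * Real.exp (r / 2)) ^ 2 = 1 := by
        rw [← Real.exp_add, ← Real.exp_nat_mul, ← Real.exp_add, ← Real.exp_zero]
        congr 1; push_cast; ring
      have e3 : (1 : ℝ) ^ 2 ≤ (δ ^ 3 * (Real.exp (r / 2 * k.1) * Real.exp (r / 2))) ^ 2 := by
        rw [one_pow, ← e2, mul_pow (δ ^ 3), ← pow_mul]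
        gcongr
      exact (pow_le_pow_iff_left₀ zero_le_one (by positivity) two_ne_zero).1 e3
    have hrr : Real.exp r = Real.exp (r / 2) * Real.exp (r / 2) := by
      rw [← Real.exp_add]; congr 1; ring
    have hkk : Real.exp (r / 2 * (k.1 + k.2.1)) = Real.exp (r / 2 * k.1) * Real.exp (r / 2 * k.2.1) := by
      rw [← Real.exp_add]; congr 1; ring
    calc Real.exp (v.b / 2) * |g.p|
        ≤ (Real.exp (r / 2 * k.2.1) * Real.exp (r / 2)) * M :=
          mul_le_mul hb g3 (abs_nonneg _) (by positivity)
      _ ≤ (Real.exp (r / 2 * k.2.1) * Real.exp (r / 2)) * M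
          * (δ ^ 3 * (Real.exp (r / 2 * k.1) * Real.exp (r / 2))) :=
          le_mul_of_one_le_right (by positivity) hx
      _ = (M * Real.exp r * δ) * (δ ^ 2 * Real.exp (r / 2 * (k.1 + k.2.1))) := by
          rw [hrr, hkk]; ring
      _ ≤ D * (δ ^ 2 * Real.exp (r / 2 * (k.1 + k.2.1))) := by gcongr
      _ = _ := by ring
  obtain ⟨j3, hj3, h3⟩ := exists_mem_I_add v3 hp
  refine Set.mem_iUnion₂.2 ⟨(j1, j2, j3), ⟨hj1, hj2, hj3⟩, h, ?_, ?_, ?_⟩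
  · exact h1
  · exact h2
  · have e : D * Real.exp (r / 2 * (-(j1 : ℝ) - j2)) * δ ^ 2
        * Real.exp (r / 2 * (((k.1 + j1 : ℤ) : ℝ) + ((k.2.1 + j2 : ℤ) : ℝ)))
        = D * δ ^ 2 * Real.exp (r / 2 * (k.1 + k.2.1)) := by
      have : Real.exp (r / 2 * (k.1 + k.2.1)) = Real.exp (r / 2 * (-(j1 : ℝ) - j2))
          * Real.exp (r / 2 * (((k.1 + j1 : ℤ) : ℝ) + ((k.2.1 + j2 : ℤ) : ℝ))) := by
        rw [← Real.exp_add]; congr 1; push_cast; ring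
      rw [this]; ring
    have h4 : (g * v).p ∈ I (D * Real.exp (r / 2 * (-(j1 : ℝ) - j2)) * δ ^ 2
        * Real.exp (r / 2 * (((k.1 + j1 : ℤ) : ℝ) + ((k.2.1 + j2 : ℤ) : ℝ)))) (k.2.2 + j3) := by
      rw [e]; exact h3
    exact h4

/-! ### Comparison of the multipliers -/

theorem norm_triple_le {a b c t : ℝ} (ha : |a| ≤ t) (hb : |b| ≤ t) (hc : |c| ≤ t) :
    ‖((a, b, c) : ℝ × ℝ × ℝ)‖ ≤ t :=
  norm_prod_le_iff.2 ⟨ha, norm_prod_le_iff.2 ⟨hb, hc⟩⟩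

/-- The two orbit points drift apart as y grows, so continuity alone fails. For large y and z the
first coordinate forces both transforms to be small; otherwise y and z are bounded and the Lipschitz
estimate applies. -/
theorem Window.norm_ft_sub_ft_le (ω : Window) {ε η N d τ y z e : ℝ} (hε : |ε| = 1)
    (hN : ∀ m, N ≤ ‖m‖ → ‖ω.ft m‖ ≤ η / 2) (hN0 : 0 < N) (hyz : |y - z| ≤ d) (hd : d ≤ 1)
    (he0 : 0 ≤ e) (he : e ≤ τ) (hτ : τ ≤ 1)
    (hsmall : ω.lip * ((2 * N + 2) * (d + τ)) ≤ η) :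
    ‖ω.ft (ε * (z ^ 2 / 2), 0, 0) - ω.ft (ε * (y ^ 2 / 2), -(ε * y * e), ε * e ^ 2)‖ ≤ η := by
  have hd0 : 0 ≤ d := (abs_nonneg _).trans hyz
  by_cases hcase : 2 * N ≤ z ^ 2 ∧ 2 * N ≤ y ^ 2
  · have h1 : ∀ t b c : ℝ, 2 * N ≤ t ^ 2 → ‖ω.ft (ε * (t ^ 2 / 2), b, c)‖ ≤ η / 2 := by
      intro t b c ht
      refine hN _ (le_trans ?_ (norm_fst_le (_ : ℝ × ℝ × ℝ)))
      rw [Real.norm_eq_abs, abs_mul, hε, one_mul, abs_of_nonneg (by positivity)]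
      linarith
    refine (norm_sub_le _ _).trans ?_
    linarith [h1 z 0 0 hcase.1, h1 y (-(ε * y * e)) (ε * e ^ 2) hcase.2]
  -- Only one of y, z is known to be bounded; the other follows from |y - z| ≤ d ≤ 1, at the price
  -- of one more unit.
  · have hb : ∀ t : ℝ, t ^ 2 < 2 * N → |t| ≤ 2 * N + 1 := fun t ht => by
      have h1 := sq_abs t
      nlinarith [sq_nonneg (|t| - 1), abs_nonneg t]
    have hyz1 : |y| ≤ |z| + d := by
      have := abs_sub_abs_le_abs_sub y z; linarith
    have hyz2 : |z| ≤ |y| + d := by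
      have := abs_sub_abs_le_abs_sub z y; rw [abs_sub_comm] at this; linarith
    have hK : |y| ≤ 2 * N + 2 ∧ |z| ≤ 2 * N + 2 := by
      rcases not_and_or.1 hcase with h | h
      · have := hb z (not_le.1 h); constructor <;> linarith
      · have := hb y (not_le.1 h); constructor <;> linarith
    refine (ω.norm_ft_sub_le _ _).trans (le_trans ?_ hsmall)
    refine mul_le_mul_of_nonneg_left ?_ ω.lip_nonneg
    have hτ0 : 0 ≤ τ := he0.trans he
    have hKK : 0 ≤ 2 * N + 2 := by linarith
    refine norm_triple_le ?_ ?_ ?_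
    · have e1 : ε * (z ^ 2 / 2) - ε * (y ^ 2 / 2) = -(ε * ((y - z) * ((y + z) / 2))) := by ring
      rw [e1, abs_neg, abs_mul, hε, one_mul, abs_mul, mul_comm]
      have h2 : |(y + z) / 2| ≤ 2 * N + 2 := by
        rw [abs_div, abs_two]
        have := abs_add_le y z
        linarith
      calc _ ≤ (2 * N + 2) * d := mul_le_mul h2 hyz (abs_nonneg _) hKK
        _ ≤ _ := by gcongr; linarith
    · simp only [zero_sub, neg_neg]
      rw [mul_assoc, abs_mul, hε, one_mul, abs_mul, abs_of_nonneg he0]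
      calc _ ≤ (2 * N + 2) * τ := mul_le_mul hK.1 he he0 hKK
        _ ≤ _ := by gcongr; linarith
    · rw [zero_sub, abs_neg, abs_mul, hε, one_mul, abs_of_nonneg (by positivity)]
      have : e ^ 2 ≤ 1 * τ := by rw [sq]; exact mul_le_mul (he.trans hτ) he he0 zero_le_one
      calc _ ≤ 1 * τ := this
        _ ≤ (2 * N + 2) * (d + τ) := by
          refine mul_le_mul ?_ ?_ hτ0 hKK <;> linarith

/-- The constant c_k is chosen so that √(2c_k) is the left endpoint of the p-cell up to sign. After
rescaling by `s` this endpoint is z, and p becomes y. -/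
theorem norm_mult_sub_le (ω : Window) {ε η N r δ D : ℝ} (hε : |ε| = 1)
    (hN : ∀ m, N ≤ ‖m‖ → ‖ω.ft m‖ ≤ η / 2) (hN0 : 0 < N) (hδ : 0 < δ) (hD : 0 < D)
    (hd : D * δ ^ 2 ≤ 1) (hτ : δ ^ 3 ≤ 1)
    (hsmall : ω.lip * ((2 * N + 2) * (D * δ ^ 2 + δ ^ 3)) ≤ η)
    {k : ℤ × ℤ × ℤ} {v : G0} (hv : v ∈ setS r δ D k) :
    ‖ω.mult (Qstar ((k.2.2 : ℝ) ^ 2 * δ ^ 4 * D ^ 2 * Real.exp (r * (k.1 + k.2.1)) / 2 * ε)) v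
      - ω.mult (Sstar ε) v‖ ≤ η := by
  obtain ⟨v0, v1, v2, v3⟩ := hv
  set W := Real.exp (r / 2 * (k.1 + k.2.1)) with hW
  set s := Real.exp (-(v.x + v.b) / 2) with hs
  set e := Real.exp (-v.x / 2) with he
  have hs2 : Real.exp (-v.x - v.b) = s ^ 2 := by
    rw [hs, ← Real.exp_nat_mul]; congr 1; push_cast; ring
  have hse : Real.exp (-v.x - v.b / 2) = s * e := by
    rw [hs, he, ← Real.exp_add]; congr 1; ring
  have he2 : Real.exp (-v.x) = e ^ 2 := by
    rw [he, ← Real.exp_nat_mul]; congr 1; push_cast; ring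
  have hW2 : Real.exp (r * (k.1 + k.2.1)) = W ^ 2 := by
    rw [hW, ← Real.exp_nat_mul]; congr 1; push_cast; ring
  have hs0 : 0 < s := Real.exp_pos _
  have heτ : e ≤ δ ^ 3 := by
    rw [he2] at v0
    refine (pow_le_pow_iff_left₀ (Real.exp_pos _).le (by positivity) two_ne_zero).1 ?_
    rw [← pow_mul]; exact v0
  -- From x ≥ r k₁ and b ≥ r k₂. Hence the cell width D δ² W shrinks to at most D δ² in the variable
  -- y = p s.
  have hsW : s * W ≤ 1 := by
    rw [hs, hW, ← Real.exp_add, Real.exp_le_one_iff]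
    have h1 := v1.1
    have h2 := v2.1
    linarith
  have hyz : |v.p * s - D * δ ^ 2 * W * k.2.2 * s| ≤ D * δ ^ 2 := by
    rw [← sub_mul, abs_mul, abs_of_pos hs0]
    have h1 : |v.p - D * δ ^ 2 * W * k.2.2| ≤ D * δ ^ 2 * W := by
      have a1 := v3.1
      have a2 := v3.2
      rw [abs_le]; constructor <;> linarith [width_pos hD hδ (r / 2 * (k.1 + k.2.1))]
    calc _ ≤ D * δ ^ 2 * W * s := by gcongr
      _ = D * δ ^ 2 * (s * W) := by ring
      _ ≤ D * δ ^ 2 * 1 := by gcongr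
      _ = _ := mul_one _
  have key := ω.norm_ft_sub_ft_le hε hN hN0 hyz hd (Real.exp_pos (-v.x / 2)).le heτ hτ hsmall
  have e1 : coAd (Qstar ((k.2.2 : ℝ) ^ 2 * δ ^ 4 * D ^ 2 * Real.exp (r * (k.1 + k.2.1)) / 2 * ε)) v
      = (ε * ((D * δ ^ 2 * W * k.2.2 * s) ^ 2 / 2), 0, 0) := by
    simp only [coAd, Qstar, hs2, hW2, Prod.mk.injEq]
    refine ⟨by ring, by ring, by ring⟩
  have e2 : coAd (Sstar ε) v = (ε * ((v.p * s) ^ 2 / 2), -(ε * (v.p * s) * e), ε * e ^ 2) := by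
    simp only [coAd, Sstar, hs2, hse, he2, Prod.mk.injEq]
    refine ⟨by ring, by ring, by ring⟩
  rw [Window.mult, Window.mult, e1, e2]
  exact key

/-! ### The operators `σ_{ε,δ,D}(a)` for general `a` -/

theorem norm_sigma_apply_le (l : ℝ × ℝ × ℝ) (a : CStarG) (ξ : L2G0) :
    ‖sigma l a ξ‖ ≤ ‖a‖ * ‖ξ‖ :=
  ((sigma l a).le_opNorm ξ).trans
    (mul_le_mul_of_nonneg_right (lp.norm_apply_le_norm (by simp) a.1 (sigmaRep l)) (norm_nonneg _))

theorem norm_sigma_le (l : ℝ × ℝ × ℝ) (a : CStarG) : ‖sigma l a‖ ≤ ‖a‖ :=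
  ContinuousLinearMap.opNorm_le_bound _ (norm_nonneg _) (norm_sigma_apply_le l a)

theorem sigma_add (l : ℝ × ℝ × ℝ) (a b : CStarG) : sigma l (a + b) = sigma l a + sigma l b := rfl

theorem norm_le_of_hasSum_sigmaTerm {ε r δ D : ℝ} (hr : 0 < r) (hδ : 0 < δ) (hD : 0 < D)
    {a : CStarG} {ξ η : L2G0} (h : HasSum (fun k => sigmaTerm ε r δ D a k ξ) η) :
    ‖η‖ ≤ Real.sqrt (27 : ℕ) * ‖a‖ * ‖ξ‖ :=
  norm_hasSum_almostOrthogonal_le (measurableSet_setS r δ D) (pairwise_disjoint_setS hr hδ hD)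
    (measurableSet_setR r δ D) (card_le_of_mem_setR hr hδ hD)
    (T := fun k => sigma (Qstar ((k.2.2 : ℝ) ^ 2 * δ ^ 4 * D ^ 2
      * Real.exp (r * (k.1 + k.2.1)) / 2 * ε)) a) (norm_nonneg a)
    (fun _ _ => norm_sigma_apply_le _ _ _) h

theorem exists_hasSum_sigmaTerm (ε : ℝ) {r δ D : ℝ} (hr : 0 < r) (hδ : 0 < δ) (hD : 0 < D)
    (a : CStarG) : ∃ T : L2G0 →L[ℂ] L2G0,
    ∀ ξ, HasSum (fun k => sigmaTerm ε r δ D a k ξ) (T ξ) := by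
  have hs : ∀ ξ, Summable fun k => sigmaTerm ε r δ D a k ξ := fun ξ =>
    summable_almostOrthogonal (measurableSet_setS r δ D) (pairwise_disjoint_setS hr hδ hD)
      (measurableSet_setR r δ D) (card_le_of_mem_setR hr hδ hD)
      (T := fun k => sigma (Qstar ((k.2.2 : ℝ) ^ 2 * δ ^ 4 * D ^ 2
        * Real.exp (r * (k.1 + k.2.1)) / 2 * ε)) a)
      (fun _ _ => norm_sigma_apply_le _ _ _) ξ
  refine ⟨LinearMap.mkContinuous
    { toFun := fun ξ => ∑' k, sigmaTerm ε r δ D a k ξ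
      map_add' := fun ξ η => by simp only [map_add, (hs ξ).tsum_add (hs η)]
      map_smul' := fun c ξ => by simp only [map_smul, (hs ξ).tsum_const_smul, RingHom.id_apply] }
    (Real.sqrt (27 : ℕ) * ‖a‖) fun ξ => norm_le_of_hasSum_sigmaTerm hr hδ hD (hs ξ).hasSum,
    fun ξ => (hs ξ).hasSum⟩

theorem hasSum_sigmaDelta (ε : ℝ) {r δ D : ℝ} (hr : 0 < r) (hδ : 0 < δ) (hD : 0 < D)
    (a : CStarG) (ξ : L2G0) :
    HasSum (fun k => sigmaTerm ε r δ D a k ξ) (sigmaDelta ε r δ D a ξ) := by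
  have h := exists_hasSum_sigmaTerm ε hr hδ hD a
  rw [sigmaDelta, dif_pos h]
  exact h.choose_spec ξ

theorem norm_sigmaDelta_le (ε : ℝ) {r δ D : ℝ} (hr : 0 < r) (hδ : 0 < δ) (hD : 0 < D)
    (a : CStarG) : ‖sigmaDelta ε r δ D a‖ ≤ Real.sqrt (27 : ℕ) * ‖a‖ :=
  ContinuousLinearMap.opNorm_le_bound _ (by positivity) fun ξ =>
    norm_le_of_hasSum_sigmaTerm hr hδ hD (hasSum_sigmaDelta ε hr hδ hD a ξ)

theorem sigmaDelta_add (ε : ℝ) {r δ D : ℝ} (hr : 0 < r) (hδ : 0 < δ) (hD : 0 < D)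
    (a b : CStarG) :
    sigmaDelta ε r δ D (a + b) = sigmaDelta ε r δ D a + sigmaDelta ε r δ D b := by
  ext1 ξ
  refine (hasSum_sigmaDelta ε hr hδ hD (a + b) ξ).unique ?_
  have h := (hasSum_sigmaDelta ε hr hδ hD a ξ).add (hasSum_sigmaDelta ε hr hδ hD b ξ)
  simpa only [sigmaTerm, sigma_add, ContinuousLinearMap.comp_apply, add_apply,
    map_add] using h

/-- The sum sees an element of C*(G) only through the operators σ_l, so proportionality of these is
all that is required. -/
theorem sigmaDelta_smul (ε : ℝ) {r δ D : ℝ} (hr : 0 < r) (hδ : 0 < δ) (hD : 0 < D)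
    {c : ℂ} {a b : CStarG} (hab : ∀ l, sigma l b = c • sigma l a) :
    sigmaDelta ε r δ D b = c • sigmaDelta ε r δ D a := by
  ext1 ξ
  refine (hasSum_sigmaDelta ε hr hδ hD b ξ).unique ?_
  have h := (hasSum_sigmaDelta ε hr hδ hD a ξ).const_smul c
  simpa only [sigmaTerm, hab, ContinuousLinearMap.comp_apply, smul_apply, map_smul] using h

/-! ### The operators `σ_{ε,δ,D}(a)` for boxes -/

theorem bmul_mulInd {m : G0 → ℂ} (h : BddMeas m) (S : Set G0) (hS : MeasurableSet S) (ξ : L2G0) :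
    bmul volume h (mulInd volume S hS ξ) = mulInd volume S hS (bmul volume h ξ) := by
  refine Lp.ext ?_
  filter_upwards [bmul_coeFn h (mulInd volume S hS ξ), mulInd_coeFn S hS ξ,
    mulInd_coeFn S hS (bmul volume h ξ), bmul_coeFn h ξ] with x h1 h2 h3 h4
  rw [h1, h3, h2]
  by_cases hx : x ∈ S <;> simp [hx, h4]

theorem bmul_sub {m n : G0 → ℂ} (h : BddMeas m) (k : BddMeas n) (ξ : L2G0) :
    bmul volume (h.sub k) ξ = bmul volume h ξ - bmul volume k ξ := by
  refine Lp.ext ?_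
  filter_upwards [bmul_coeFn (h.sub k) ξ, bmul_coeFn h ξ, bmul_coeFn k ξ,
    Lp.coeFn_sub (bmul volume h ξ) (bmul volume k ξ)] with x h1 h2 h3 h4
  rw [h1, h4, Pi.sub_apply, h2, h3, sub_smul]

/-- Two cut-offs of an average of translates agree when they agree on the translates of the support
by the elements of the box. -/
theorem mulInd_L_mulInd (β : Box) {S R X : Set G0} (hS : MeasurableSet S) (hR : MeasurableSet R)
    (hX : MeasurableSet X)
    (h : ∀ g : G0, |g.x| ≤ β.radius ∧ |g.b| ≤ β.radius ∧ |g.p| ≤ β.radius →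
      ∀ v ∈ S, (g * v ∈ R ↔ g * v ∈ X)) (ξ : L2G0) :
    mulInd volume R hR (β.L (mulInd volume S hS ξ))
      = mulInd volume X hX (β.L (mulInd volume S hS ξ)) := by
  have hi : Integrable (fun g => leftTr g (mulInd volume S hS ξ)) β.μ :=
    integrable_strong β.μ β.aestronglyMeasurable_leftTr (fun g ξ => ((leftTr g).norm_map ξ).le) _
  rw [Box.L_apply, ← ContinuousLinearMap.integral_comp_comm _ hi,
    ← ContinuousLinearMap.integral_comp_comm _ hi]
  refine integral_congr_ae ?_
  filter_upwards [β.ae_mem] with g hg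
  refine Lp.ext ?_
  filter_upwards [mulInd_coeFn R hR (leftTr g (mulInd volume S hS ξ)),
    mulInd_coeFn X hX (leftTr g (mulInd volume S hS ξ)),
    leftTr_coeFn g (mulInd volume S hS ξ),
    (G0.measurePreserving_mul_left g⁻¹).quasiMeasurePreserving.ae (mulInd_coeFn S hS ξ)]
    with u h1 h2 h3 h4
  rw [h1, h2]
  by_cases hu : g⁻¹ * u ∈ S
  · have := h g hg _ hu
    rw [mul_inv_cancel_left] at this
    by_cases hu' : u ∈ X
    · rw [Set.indicator_of_mem hu', Set.indicator_of_mem (this.2 hu')]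
    · rw [Set.indicator_of_notMem hu', Set.indicator_of_notMem (mt this.1 hu')]
  · have : leftTr g (mulInd volume S hS ξ) u = 0 := by
      rw [h3, h4, Set.indicator_of_notMem hu]
    have h0 : ∀ Y : Set G0, Y.indicator (leftTr g (mulInd volume S hS ξ)) u = 0 := fun Y => by
      by_cases hY : u ∈ Y
      · rw [Set.indicator_of_mem hY, this]
      · rw [Set.indicator_of_notMem hY]
    rw [h0, h0]

/-- On boxes, `σ_{ε,δ,D}` is close to the compression of `σ_{εS*}` to the half space. -/
theorem norm_sigmaDelta_boxElt_sub_le (β : Box) (ω : Window) {ε η N r δ D : ℝ} (hε : |ε| = 1)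
    (hη : 0 ≤ η) (hN : ∀ m, N ≤ ‖m‖ → ‖ω.ft m‖ ≤ η / 2) (hN0 : 0 < N) (hr : 0 < r) (hδ : 0 < δ)
    (hD : 0 < D) (hM : β.radius ≤ r) (hMD : β.radius * Real.exp r * δ ≤ D) (hd : D * δ ^ 2 ≤ 1)
    (hτ : δ ^ 3 ≤ 1) (hsmall : ω.lip * ((2 * N + 2) * (D * δ ^ 2 + δ ^ 3)) ≤ η) :
    ‖sigmaDelta ε r δ D (boxElt β ω)
      - mulInd volume (halfSpace δ) (measurableSet_halfSpace δ) ∘L β.L ∘L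
        bmul volume (ω.bddMeas_mult (Sstar ε)) ∘L
        mulInd volume (halfSpace δ) (measurableSet_halfSpace δ)‖
      ≤ Real.sqrt (27 : ℕ) * (‖β.L‖ * η) := by
  refine ContinuousLinearMap.opNorm_le_bound _ (by positivity) fun ξ => ?_
  set ψ := ω.bddMeas_mult (Sstar ε)
  have hψ := fun k : ℤ × ℤ × ℤ => ω.bddMeas_mult (Qstar ((k.2.2 : ℝ) ^ 2 * δ ^ 4 * D ^ 2
        * Real.exp (r * (k.1 + k.2.1)) / 2 * ε))
  -- The difference is itself an almost orthogonal sum, whose k-th operator is L times the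
  -- difference of the two multipliers. The latter is at most `η` on the k-th set S.
  refine norm_hasSum_almostOrthogonal_le (measurableSet_setS r δ D)
    (pairwise_disjoint_setS hr hδ hD) (measurableSet_setR r δ D) (card_le_of_mem_setR hr hδ hD)
    (T := fun k => β.L ∘L bmul volume ((hψ k).sub ψ)) (by positivity) (fun k ζ => ?_) ?_
  · refine le_of_le_of_eq ?_ (mul_assoc _ _ _).symm
    refine (β.L.le_opNorm _).trans (mul_le_mul_of_nonneg_left ?_ (norm_nonneg _))
    refine Lp.norm_le_mul_norm_of_ae_le_mul ?_
    filter_upwards [bmul_coeFn ((hψ k).sub ψ) (mulInd volume _ (measurableSet_setS r δ D k) ζ),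
      mulInd_coeFn _ (measurableSet_setS r δ D k) ζ] with v h1 h2
    refine le_of_eq_of_le (congrArg norm h1) ?_
    rw [h2, norm_smul]
    by_cases hv : v ∈ setS r δ D k
    · exact mul_le_mul_of_nonneg_right
        (norm_mult_sub_le ω hε hN hN0 hδ hD hd hτ hsmall hv) (norm_nonneg _)
    · rw [Set.indicator_of_notMem hv, norm_zero, mul_zero, mul_zero]
  · have h1 := hasSum_sigmaDelta ε hr hδ hD (boxElt β ω) ξ
    have h2 := (hasSum_mulInd (measurableSet_setS r δ D) (pairwise_disjoint_setS hr hδ hD)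
      (measurableSet_halfSpace δ) (iUnion_setS hr hδ hD) ξ).mapL
        (mulInd volume (halfSpace δ) (measurableSet_halfSpace δ) ∘L β.L ∘L bmul volume ψ)
    refine Eq.mp (congrArg (fun f => HasSum f _) (funext fun k => ?_)) (h1.sub h2)
    -- On vectors supported in S, cutting the average to R or to the half space is the same. The
    -- compression therefore splits into terms with the same cut-offs as the sum.
    have h3 := mulInd_L_mulInd β (measurableSet_setS r δ D k) (measurableSet_setR r δ D k)
      (measurableSet_halfSpace δ) (fun g hg v hv => mul_mem_setR_iff hδ hM hMD hv hg)
      (bmul volume ψ ξ)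
    simp only [sigmaTerm, ContinuousLinearMap.comp_apply]
    rw [sigma_boxElt, bmul_mulInd ψ, ← h3, ← bmul_mulInd ψ, ← map_sub, ← map_sub]
    rw [← bmul_sub]

/-! ### Truncation of the averages -/

theorem rho_add (S T : L2G0 →L[ℂ] L2G0) : rho (S + T) = rho S + rho T := by
  ext1 η
  obtain ⟨ξ, rfl⟩ := U_surjective η
  simp only [add_apply, rho_apply_U, map_add]

theorem rho_smul (c : ℂ) (T : L2G0 →L[ℂ] L2G0) : rho (c • T) = c • rho T := by
  ext1 η
  obtain ⟨ξ, rfl⟩ := U_surjective η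
  simp only [smul_apply, rho_apply_U, map_smul]

theorem rho_sub (S T : L2G0 →L[ℂ] L2G0) : rho (S - T) = rho S - rho T := by
  ext1 η
  obtain ⟨ξ, rfl⟩ := U_surjective η
  simp only [sub_apply, rho_apply_U, map_sub]

theorem bddMeas_one : BddMeas (fun _ : G0 => (1 : ℂ)) :=
  ⟨measurable_const, 1, fun _ => by simp⟩

theorem bmul_indicator {m : G0 → ℂ} (h : BddMeas m) {S : Set G0} (hS : MeasurableSet S)
    (ξ : L2G0) : bmul volume (h.indicator hS) ξ = bmul volume h (mulInd volume S hS ξ) := by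
  refine Lp.ext ?_
  filter_upwards [bmul_coeFn (h.indicator hS) ξ, mulInd_coeFn S hS ξ,
    bmul_coeFn h (mulInd volume S hS ξ)] with x h1 h2 h3
  rw [h1, h3, h2]
  by_cases hx : x ∈ S <;> simp [hx]

theorem mulInd_eq_bmul {S : Set G0} (hS : MeasurableSet S) :
    mulInd volume S hS = bmul volume (bddMeas_one.indicator hS) := by
  ext1 ξ
  refine Lp.ext ?_
  filter_upwards [bmul_coeFn (bddMeas_one.indicator hS) ξ, mulInd_coeFn S hS ξ] with x h1 h2
  rw [h1, h2]
  by_cases hx : x ∈ S <;> simp [hx]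

theorem mulInd_univ (ξ : L2G0) : mulInd volume Set.univ MeasurableSet.univ ξ = ξ := by
  refine Lp.ext ?_
  filter_upwards [mulInd_coeFn Set.univ MeasurableSet.univ ξ] with x h1
  rw [h1, Set.indicator_univ]

theorem mulInd_union {S R : Set G0} (hS : MeasurableSet S) (hR : MeasurableSet R)
    (hd : Disjoint S R) (ξ : L2G0) :
    mulInd volume (S ∪ R) (hS.union hR) ξ = mulInd volume S hS ξ + mulInd volume R hR ξ := by
  refine Lp.ext ?_
  filter_upwards [mulInd_coeFn (S ∪ R) (hS.union hR) ξ, mulInd_coeFn S hS ξ, mulInd_coeFn R hR ξ,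
    Lp.coeFn_add (mulInd volume S hS ξ) (mulInd volume R hR ξ)] with x h1 h2 h3 h4
  rw [h1, h4, Pi.add_apply, h2, h3, Set.indicator_union_of_disjoint hd]

/-- The result has no b: since B commutes with S, the last factor exp(bB) fixes S* on this ideal.
The multiplier of εS* is therefore a function on the plane. -/
theorem coAd_Sstar_reorder (ε b : ℝ) (y : ℝ × ℝ) : coAd (Sstar ε) (reorder (b, y))
    = (Real.exp (-y.1) * (ε * (y.2 ^ 2 / 2)), -(Real.exp (-y.1) * (ε * y.2)),
      Real.exp (-y.1) * ε) := by
  have h1 : Real.exp (-y.1) = Real.exp (-y.1 - b) * (Real.exp (b / 2)) ^ 2 := by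
    rw [← Real.exp_nat_mul, ← Real.exp_add]; congr 1; push_cast; ring
  have h2 : Real.exp (-y.1) = Real.exp (-y.1 - b / 2) * Real.exp (b / 2) := by
    rw [← Real.exp_add]; congr 1; ring
  simp only [coAd, Sstar, reorder, G0.x_mk, G0.b_mk, G0.p_mk, Prod.mk.injEq]
  refine ⟨?_, ?_, trivial⟩
  · rw [h1]; ring
  · rw [h2]; ring

/-- The points at bounded height where `S*` has bounded coadjoint orbit. -/
def core (ε c N : ℝ) : Set G0 := {v | v.x < c ∧ ‖coAd (Sstar ε) v‖ < N}

theorem measurableSet_core (ε c N : ℝ) : MeasurableSet (core ε c N) :=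
  (measurableSet_lt G0.continuous_x.measurable measurable_const).inter
    (measurableSet_lt (continuous_coAd _).norm.measurable measurable_const)

theorem reorder_mem_core_iff {ε c N : ℝ} (b : ℝ) (y : ℝ × ℝ) :
    reorder (b, y) ∈ core ε c N ↔ reorder (0, y) ∈ core ε c N := by
  simp only [core, Set.mem_ofPred_eq, coAd_Sstar_reorder]
  rfl

/-- The S-coordinate of the orbit point bounds x from below by -log N, the cut-off `c` bounds it
from above, and the R-coordinate bounds p by N e^c. -/
theorem norm_le_of_reorder_mem_core {ε c N : ℝ} (hε : |ε| = 1) {b : ℝ} {y : ℝ × ℝ}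
    (h : reorder (b, y) ∈ core ε c N) : ‖y‖ ≤ |c| + |Real.log N| + |N| * Real.exp c := by
  obtain ⟨h1, h2⟩ := h
  have h1 : y.1 < c := h1
  rw [coAd_Sstar_reorder] at h2
  have h3 := (norm_fst_le _).trans ((norm_snd_le _).trans h2.le)
  have h4 := (norm_snd_le _).trans_lt ((norm_snd_le _).trans_lt h2)
  simp only [norm_neg, Real.norm_eq_abs, abs_mul, hε, one_mul, mul_one, Real.abs_exp] at h3 h4
  have hN : 0 < N := (Real.exp_pos _).trans h4
  have h5 : -y.1 < Real.log N := (Real.lt_log_iff_exp_lt hN).2 h4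
  have h6 : 0 ≤ |N| * Real.exp c := by positivity
  refine norm_prod_le_iff.2 ⟨?_, ?_⟩
  · rw [Real.norm_eq_abs, abs_le]
    have := le_abs_self c
    have := le_abs_self (Real.log N)
    have := abs_nonneg c
    have := abs_nonneg (Real.log N)
    constructor <;> linarith
  · have h7 : |y.2| = Real.exp (-y.1) * |y.2| * Real.exp y.1 := by
      have : Real.exp (-y.1) * Real.exp y.1 = 1 := by
        rw [← Real.exp_add, neg_add_cancel, Real.exp_zero]
      linear_combination (-|y.2|) * this
    have h8 : |y.2| ≤ |N| * Real.exp c := by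
      rw [h7]
      exact mul_le_mul (h3.trans (le_abs_self N)) (Real.exp_le_exp.2 h1.le) (Real.exp_pos _).le
        (abs_nonneg _)
    rw [Real.norm_eq_abs]
    have := abs_nonneg c
    have := abs_nonneg (Real.log N)
    linarith

theorem mult_reorder (ω : Window) (ε b : ℝ) (y : ℝ × ℝ) :
    ω.mult (Sstar ε) (reorder (b, y)) = ω.mult (Sstar ε) (reorder (0, y)) := by
  rw [Window.mult, Window.mult, coAd_Sstar_reorder, coAd_Sstar_reorder]

theorem reorder_mem_halfSpace_iff {δ : ℝ} (b : ℝ) (y : ℝ × ℝ) :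
    reorder (b, y) ∈ halfSpace δ ↔ reorder (0, y) ∈ halfSpace δ := Iff.rfl

theorem indicator_reorder {A : Set G0} (hA : ∀ b y, reorder (b, y) ∈ A ↔ reorder (0, y) ∈ A)
    {m : G0 → ℂ} (hm : ∀ b y, m (reorder (b, y)) = m (reorder (0, y))) (b : ℝ) (y : ℝ × ℝ) :
    A.indicator m (reorder (b, y)) = A.indicator m (reorder (0, y)) := by
  by_cases h : reorder (0, y) ∈ A
  · rw [Set.indicator_of_mem h, Set.indicator_of_mem ((hA b y).2 h), hm]
  · rw [Set.indicator_of_notMem h, Set.indicator_of_notMem (mt (hA b y).1 h)]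

theorem BddMeas.comp_reorder {m : G0 → ℂ} (h : BddMeas m) :
    BddMeas fun y : ℝ × ℝ => m (reorder (0, y)) :=
  ⟨h.meas.comp (measurable_reorder.comp measurable_prodMk_left), h.bdd.imp fun _ hC _ => hC _⟩

theorem rho_L_comp_bmul_indicator_mem_C0K (β : Box) (ω : Window) {ε c N : ℝ} (hε : |ε| = 1)
    {A : Set G0} (hAm : MeasurableSet A) (hA : ∀ b y, reorder (b, y) ∈ A ↔ reorder (0, y) ∈ A)
    (hc : A ⊆ core ε c N) :
    rho (β.L ∘L bmul volume ((ω.bddMeas_mult (Sstar ε)).indicator hAm)) ∈ C0K :=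
  β.rho_L_comp_bmul_mem_C0K _ ((ω.bddMeas_mult (Sstar ε)).indicator hAm).comp_reorder
    (indicator_reorder hA (mult_reorder ω ε)) (R := |c| + |Real.log N| + |N| * Real.exp c)
    fun _ hy => Set.indicator_of_notMem
      (fun h => hy.not_ge (norm_le_of_reorder_mem_core hε (hc h))) _

/-- On boxes, `σ_{εS*}` differs from its compression to a half space by an operator in
`C₀(ℝ, 𝒦)`. -/
theorem infDist_L_sub_compression_le (β : Box) (ω : Window) {ε η N δ : ℝ} (hε : |ε| = 1)
    (hη : 0 ≤ η) (hN : ∀ m, N ≤ ‖m‖ → ‖ω.ft m‖ ≤ η) (hδ : 0 < δ) :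
    Metric.infDist (rho (β.L ∘L bmul volume (ω.bddMeas_mult (Sstar ε))
      - mulInd volume (halfSpace δ) (measurableSet_halfSpace δ) ∘L β.L ∘L
        bmul volume (ω.bddMeas_mult (Sstar ε)) ∘L
        mulInd volume (halfSpace δ) (measurableSet_halfSpace δ))) C0K ≤ 2 * (‖β.L‖ * η) := by
  set X := halfSpace δ
  have hX : MeasurableSet X := measurableSet_halfSpace δ
  set ψ := ω.bddMeas_mult (Sstar ε)
  -- The half space is x ≥ -log δ⁶; the margin |radius| keeps every translate of `F` by the box
  -- inside it.
  set c : ℝ := -Real.log (δ ^ 6) + |β.radius|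
  set A := core ε c N
  have hA : MeasurableSet A := measurableSet_core ε c N
  set B : Set G0 := {v | v.x < c ∧ N ≤ ‖coAd (Sstar ε) v‖}
  have hB : MeasurableSet B :=
    (measurableSet_lt G0.continuous_x.measurable measurable_const).inter
      (measurableSet_le measurable_const (continuous_coAd _).norm.measurable)
  set F : Set G0 := {v | c ≤ v.x}
  have hF : MeasurableSet F := measurableSet_le measurable_const G0.continuous_x.measurable
  have hXx : ∀ v : G0, -Real.log (δ ^ 6) ≤ v.x → v ∈ X := fun v hv => by
    change Real.exp (-v.x) ≤ δ ^ 6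
    rw [← Real.le_log_iff_exp_le (by positivity)]
    linarith
  have hFX : F ∩ X = F := Set.inter_eq_left.2 fun v hv => hXx v (by
    have : c ≤ v.x := hv
    have := abs_nonneg β.radius
    linarith)
  have hdecomp : ∀ ξ : L2G0,
      ξ = mulInd volume A hA ξ + mulInd volume B hB ξ + mulInd volume F hF ξ := fun ξ => by
    have d1 : Disjoint A B := Set.disjoint_left.2 fun v h1 h2 => h2.2.not_gt h1.2
    have d2 : Disjoint (A ∪ B) F := Set.disjoint_left.2 fun v h1 h2 =>
      (show c ≤ v.x from h2).not_gt (h1.elim (fun h => h.1) fun h => h.1)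
    rw [← mulInd_union hA hB d1, ← mulInd_union (hA.union hB) hF d2]
    have hu : A ∪ B ∪ F = Set.univ := Set.eq_univ_of_forall fun v => by
      rcases le_or_gt c v.x with h | h
      · exact Or.inr h
      · rcases le_or_gt N ‖coAd (Sstar ε) v‖ with h' | h'
        · exact Or.inl (Or.inr ⟨h, h'⟩)
        · exact Or.inl (Or.inl ⟨h, h'⟩)
    simp only [hu]
    exact (mulInd_univ ξ).symm
  have hBnorm : ∀ ξ : L2G0, ‖bmul volume ψ (mulInd volume B hB ξ)‖ ≤ η * ‖ξ‖ := fun ξ => by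
    rw [← bmul_indicator]
    refine norm_bmul_apply_le _ (fun v => ?_) ξ
    by_cases hv : v ∈ B
    · rw [Set.indicator_of_mem hv]; exact hN _ hv.2
    · rw [Set.indicator_of_notMem hv, norm_zero]; exact hη
  have hFL : ∀ ζ : L2G0, mulInd volume X hX (β.L (bmul volume ψ (mulInd volume F hF ζ)))
      = β.L (bmul volume ψ (mulInd volume F hF ζ)) := fun ζ => by
    rw [bmul_mulInd, mulInd_L_mulInd β hF hX MeasurableSet.univ (fun g hg v hv => ?_), mulInd_univ]
    refine iff_of_true (hXx _ ?_) trivial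
    have h1 : c ≤ v.x := hv
    have h2 := (abs_le.1 hg.1).1
    have h3 := le_abs_self β.radius
    rw [G0.x_mul]
    linarith
  -- The approximant is the contribution of the bounded core to both the operator and its
  -- compression.
  set T₀ : L2G0 →L[ℂ] L2G0 := β.L ∘L bmul volume (ψ.indicator hA)
    - bmul volume (bddMeas_one.indicator hX) ∘L
      (β.L ∘L bmul volume (ψ.indicator (hA.inter hX)))
  have hT₀ : rho T₀ ∈ C0K := by
    have h1 := rho_L_comp_bmul_indicator_mem_C0K β ω hε hA
      (fun b y => reorder_mem_core_iff b y) subset_rfl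
    have h2 := rho_L_comp_bmul_indicator_mem_C0K β ω hε (hA.inter hX)
      (fun b y => and_congr (reorder_mem_core_iff b y) (reorder_mem_halfSpace_iff b y))
      Set.inter_subset_left
    have h3 := rho_comp_mem_C0K (bddMeas_one.indicator hX)
      (bddMeas_one.indicator hX).comp_reorder
      (indicator_reorder (fun b y => reorder_mem_halfSpace_iff b y) fun _ _ => rfl) h2
    have h4 := add_mem_C0K h1 (smul_mem_C0K (-1) h3)
    rwa [neg_one_smul, ← sub_eq_add_neg, ← rho_sub] at h4
  refine (Metric.infDist_le_dist_of_mem hT₀).trans ?_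
  rw [dist_eq_norm, ← rho_sub]
  refine (norm_rho_le _).trans (ContinuousLinearMap.opNorm_le_bound _ (by positivity) fun ξ => ?_)
  have key : ∀ ζ : L2G0, β.L (bmul volume ψ ζ) = β.L (bmul volume ψ (mulInd volume A hA ζ))
      + β.L (bmul volume ψ (mulInd volume B hB ζ))
      + β.L (bmul volume ψ (mulInd volume F hF ζ)) := fun ζ => by
    conv_lhs => rw [hdecomp ζ]
    simp only [map_add]
  have hF' : mulInd volume F hF (mulInd volume X hX ξ) = mulInd volume F hF ξ := by
    rw [mulInd_mulInd]
    simp only [hFX]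
  -- The `A` parts are removed by `T₀`, and the `F` parts cancel by `hF'` and `hFL`. What remains is
  -- the `B` part, where ψ is at most `η`.
  have heq : (β.L ∘L bmul volume ψ - mulInd volume X hX ∘L β.L ∘L bmul volume ψ ∘L
      mulInd volume X hX - T₀) ξ = β.L (bmul volume ψ (mulInd volume B hB ξ))
      - mulInd volume X hX (β.L (bmul volume ψ (mulInd volume B hB (mulInd volume X hX ξ)))) := by
    have h0 : T₀ ξ = β.L (bmul volume ψ (mulInd volume A hA ξ))
        - mulInd volume X hX (β.L (bmul volume ψ (mulInd volume A hA (mulInd volume X hX ξ)))) := by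
      rw [mulInd_mulInd A X hA hX, mulInd_eq_bmul hX, ← bmul_indicator, ← bmul_indicator]
      rfl
    rw [sub_apply, h0, sub_apply]
    simp only [ContinuousLinearMap.comp_apply]
    rw [key ξ, key (mulInd volume X hX ξ), map_add, map_add, hF', hFL]
    abel
  rw [heq]
  have h1 : ‖β.L (bmul volume ψ (mulInd volume B hB ξ))‖ ≤ ‖β.L‖ * (η * ‖ξ‖) :=
    (β.L.le_opNorm _).trans (mul_le_mul_of_nonneg_left (hBnorm ξ) (norm_nonneg _))
  have h2 : ‖mulInd volume X hX
      (β.L (bmul volume ψ (mulInd volume B hB (mulInd volume X hX ξ))))‖ ≤ ‖β.L‖ * (η * ‖ξ‖) :=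
    (norm_mulInd_le X hX _).trans ((β.L.le_opNorm _).trans (mul_le_mul_of_nonneg_left
      ((hBnorm _).trans (mul_le_mul_of_nonneg_left (norm_mulInd_le X hX ξ) hη)) (norm_nonneg _)))
  refine (norm_sub_le _ _).trans ((add_le_add h1 h2).trans (le_of_eq ?_))
  ring

/-! ### The limit for boxes -/

/-- The distance of `ρ(σ_{εS*}(a) - σ_{ε,δ,D}(a))` to `C₀(ℝ, 𝒦)`. -/
def defect (ε D : ℝ) (r : ℝ → ℝ) (a : CStarG) (δ : ℝ) : ℝ :=
  Metric.infDist (rho (sigma (Sstar ε) a - sigmaDelta ε (r δ) δ D a)) C0K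

theorem defect_nonneg (ε D : ℝ) (r : ℝ → ℝ) (a : CStarG) (δ : ℝ) : 0 ≤ defect ε D r a δ :=
  Metric.infDist_nonneg

theorem defect_boxElt_le (β : Box) (ω : Window) {ε η N δ D : ℝ} {r : ℝ → ℝ} (hε : |ε| = 1)
    (hη : 0 ≤ η) (hN : ∀ m, N ≤ ‖m‖ → ‖ω.ft m‖ ≤ η / 2) (hN0 : 0 < N) (hr : 0 < r δ) (hδ : 0 < δ)
    (hD : 0 < D) (hM : β.radius ≤ r δ) (hMD : β.radius * Real.exp (r δ) * δ ≤ D)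
    (hd : D * δ ^ 2 ≤ 1) (hτ : δ ^ 3 ≤ 1)
    (hsmall : ω.lip * ((2 * N + 2) * (D * δ ^ 2 + δ ^ 3)) ≤ η) :
    defect ε D r (boxElt β ω) δ ≤ (2 + Real.sqrt (27 : ℕ)) * ‖β.L‖ * η := by
  have h1 := norm_sigmaDelta_boxElt_sub_le β ω hε hη hN hN0 hr hδ hD hM hMD hd hτ hsmall
  have h2 := infDist_L_sub_compression_le β ω hε hη
    (fun m hm => (hN m hm).trans (half_le_self hη)) hδ
  have h3 : sigma (Sstar ε) (boxElt β ω) = β.L ∘L bmul volume (ω.bddMeas_mult (Sstar ε)) := by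
    ext1 ξ
    exact sigma_boxElt β ω (Sstar ε) ξ
  rw [defect, h3]
  set T := β.L ∘L bmul volume (ω.bddMeas_mult (Sstar ε))
  set K := mulInd volume (halfSpace δ) (measurableSet_halfSpace δ) ∘L β.L ∘L
        bmul volume (ω.bddMeas_mult (Sstar ε)) ∘L
        mulInd volume (halfSpace δ) (measurableSet_halfSpace δ)
  -- The compression `K` is the intermediate operator: `T - K` is close to C₀(ℝ, 𝒦), and the second
  -- bracket is small in norm.
  rw [show T - sigmaDelta ε (r δ) δ D (boxElt β ω)
    = (T - K) + (K - sigmaDelta ε (r δ) δ D (boxElt β ω)) by abel, rho_add]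
  rw [norm_sub_rev] at h1
  refine (infDist_C0K_add_le _ _).trans ((add_le_add h2
    ((infDist_C0K_le_norm _).trans ((norm_rho_le _).trans h1))).trans (le_of_eq ?_))
  ring

theorem tendsto_defect_boxElt (β : Box) (ω : Window) {ε D : ℝ} (hε : |ε| = 1) (hD : 0 < D)
    {r : ℝ → ℝ} (hr_pos : ∀ δ : ℝ, 0 < δ → 0 < r δ) (hr_top : Tendsto r (𝓝[>] 0) atTop)
    (hr_exp : Tendsto (fun δ : ℝ => Real.exp (r δ) * δ ^ (1 / 2 : ℝ)) (𝓝[>] 0) (𝓝 0)) :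
    Tendsto (defect ε D r (boxElt β ω)) (𝓝[>] 0) (𝓝 0) := by
  rw [Metric.tendsto_nhds]
  intro e he
  set C := (2 + Real.sqrt (27 : ℕ)) * ‖β.L‖
  have hC : 0 ≤ C := by positivity
  set η := e / (2 * (C + 1))
  have hη : 0 < η := by positivity
  have hCη : C * η < e := by
    have h1 : C * η ≤ (C + 1) * η := by linarith
    have h2 : (C + 1) * η = e / 2 := by
      have : C + 1 ≠ 0 := by positivity
      simp only [η]; field_simp
    linarith
  obtain ⟨N, hN0, hN⟩ := ω.exists_norm_ft_le (half_pos hη)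
  have hid : Tendsto (fun δ : ℝ => δ) (𝓝[>] 0) (𝓝 0) := tendsto_nhdsWithin_of_tendsto_nhds tendsto_id
  have hpos : ∀ᶠ δ : ℝ in 𝓝[>] 0, 0 < δ := eventually_mem_nhdsWithin
  -- Writing δ = δ^{1/2} δ^{1/2} gives e^r δ → 0, the rate needed for translates to stay in
  -- neighbouring cells.
  have t1 : Tendsto (fun δ : ℝ => β.radius * Real.exp (r δ) * δ) (𝓝[>] 0) (𝓝 0) := by
    have hsq : Tendsto (fun δ : ℝ => δ ^ (1 / 2 : ℝ)) (𝓝[>] 0) (𝓝 0) := by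
      have := hid.rpow_const (p := (1 / 2 : ℝ)) (Or.inr (by norm_num))
      rwa [Real.zero_rpow (by norm_num)] at this
    have := (hr_exp.mul hsq).const_mul β.radius
    simp only [mul_zero] at this
    refine this.congr' ?_
    filter_upwards [hpos] with δ hδ
    have : δ ^ (1 / 2 : ℝ) * δ ^ (1 / 2 : ℝ) = δ := by
      rw [← Real.rpow_add hδ]; norm_num
    linear_combination (β.radius * Real.exp (r δ)) * this
  have t2 : Tendsto (fun δ : ℝ => D * δ ^ 2) (𝓝[>] 0) (𝓝 0) := by
    simpa using (hid.pow 2).const_mul D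
  have t3 : Tendsto (fun δ : ℝ => δ ^ 3) (𝓝[>] 0) (𝓝 0) := by simpa using hid.pow 3
  have t4 : Tendsto (fun δ : ℝ => ω.lip * ((2 * N + 2) * (D * δ ^ 2 + δ ^ 3))) (𝓝[>] 0) (𝓝 0) := by
    simpa using ((t2.add t3).const_mul (2 * N + 2)).const_mul ω.lip
  filter_upwards [hpos, hr_top.eventually_ge_atTop β.radius, t1.eventually_le_const hD,
    t2.eventually_le_const one_pos, t3.eventually_le_const one_pos,
    t4.eventually_le_const hη] with δ hδ e1 e2 e3 e4 e5
  rw [Real.dist_0_eq_abs, abs_of_nonneg (defect_nonneg _ _ _ _ _)]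
  exact (defect_boxElt_le β ω hε hη.le hN hN0 (hr_pos δ hδ) hδ hD e1 e2 e3 e4 e5).trans_lt hCη

/-! ### Density -/

theorem defect_add_le {ε D δ : ℝ} {r : ℝ → ℝ} (hr : 0 < r δ) (hδ : 0 < δ) (hD : 0 < D)
    (a b : CStarG) : defect ε D r (a + b) δ ≤ defect ε D r a δ + defect ε D r b δ := by
  rw [defect, sigma_add, sigmaDelta_add ε hr hδ hD, add_sub_add_comm, rho_add]
  exact infDist_C0K_add_le _ _

theorem defect_le_of_smul {ε D δ : ℝ} {r : ℝ → ℝ} (hr : 0 < r δ) (hδ : 0 < δ) (hD : 0 < D)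
    {c : ℂ} {a b : CStarG} (hab : ∀ l, sigma l b = c • sigma l a) :
    defect ε D r b δ ≤ ‖c‖ * defect ε D r a δ := by
  rw [defect, hab, sigmaDelta_smul ε hr hδ hD hab, ← smul_sub, rho_smul]
  exact infDist_C0K_smul_le _ _

theorem defect_le_norm {ε D δ : ℝ} {r : ℝ → ℝ} (hr : 0 < r δ) (hδ : 0 < δ) (hD : 0 < D)
    (a : CStarG) : defect ε D r a δ ≤ (1 + Real.sqrt (27 : ℕ)) * ‖a‖ := by
  refine (infDist_C0K_le_norm _).trans ((norm_rho_le _).trans ((norm_sub_le _ _).trans ?_))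
  rw [add_mul, one_mul]
  exact add_le_add (norm_sigma_le _ _) (norm_sigmaDelta_le ε hr hδ hD a)

/-- The defect is subadditive and at most (1 + √27) times the norm, uniformly in `δ`, so an
approximation of `a` costs the same for every `δ`. -/
theorem tendsto_defect_of_approx {ε D : ℝ} {r : ℝ → ℝ} (hr_pos : ∀ δ : ℝ, 0 < δ → 0 < r δ)
    (hD : 0 < D) {a : CStarG} (h : ∀ e > 0, ∃ b : CStarG,
      Tendsto (defect ε D r b) (𝓝[>] 0) (𝓝 0) ∧ ‖a - b‖ < e) :
    Tendsto (defect ε D r a) (𝓝[>] 0) (𝓝 0) := by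
  rw [Metric.tendsto_nhds]
  intro e he
  set C := 1 + Real.sqrt (27 : ℕ)
  have hC : 0 < C := by positivity
  obtain ⟨b, hb, hab⟩ := h (e / 2 / C) (by positivity)
  filter_upwards [hb.eventually_lt_const (half_pos he), self_mem_nhdsWithin] with δ h1 hδ
  rw [Real.dist_0_eq_abs, abs_of_nonneg (defect_nonneg _ _ _ _ _)]
  have h2 := defect_add_le (ε := ε) (hr_pos δ hδ) hδ hD b (a - b)
  have h3 := defect_le_norm (ε := ε) (hr_pos δ hδ) hδ hD (a - b)
  rw [add_sub_cancel] at h2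
  rw [lt_div_iff₀ hC, mul_comm] at hab
  linarith

/-- The image of `L¹(G)` in `C*(G)`. -/
def ofL1 (F : Lp ℂ 1 (volume : Measure G6)) : CStarG :=
  ⟨universalRep volume F, subset_closure ⟨F, rfl⟩⟩

theorem ofL1_add (F F' : Lp ℂ 1 (volume : Measure G6)) : ofL1 (F + F') = ofL1 F + ofL1 F' :=
  Subtype.ext (map_add _ _ _)

theorem ofL1_sub (F F' : Lp ℂ 1 (volume : Measure G6)) : ofL1 (F - F') = ofL1 F - ofL1 F' :=
  Subtype.ext (map_sub _ _ _)

theorem sigma_ofL1_smul (c : ℂ) (F : Lp ℂ 1 (volume : Measure G6)) (l : ℝ × ℝ × ℝ) :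
    sigma l (ofL1 (c • F)) = c • sigma l (ofL1 F) :=
  congrFun (congrArg Subtype.val ((universalRep (volume : Measure G6)).map_smul c F)) (sigmaRep l)

theorem norm_ofL1_le (F : Lp ℂ 1 (volume : Measure G6)) : ‖ofL1 F‖ ≤ ‖F‖ :=
  lp.norm_le_of_forall_le (norm_nonneg F) fun π => π.norm_integrated_le volume F

/-- The functions in `L¹(G)` for which the limit holds. -/
def goodL1 (ε : ℝ) {D : ℝ} (hD : 0 < D) {r : ℝ → ℝ} (hr_pos : ∀ δ : ℝ, 0 < δ → 0 < r δ) :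
    Submodule ℂ (Lp ℂ 1 (volume : Measure G6)) where
  carrier := {F | Tendsto (defect ε D r (ofL1 F)) (𝓝[>] 0) (𝓝 0)}
  zero_mem' := by
    refine tendsto_const_nhds.congr' ?_
    filter_upwards [self_mem_nhdsWithin] with δ hδ
    refine le_antisymm (defect_nonneg _ _ _ _ _)
      ((defect_le_norm (hr_pos δ hδ) hδ hD _).trans_eq ?_)
    have : ‖ofL1 0‖ = 0 := le_antisymm ((norm_ofL1_le 0).trans_eq norm_zero) (norm_nonneg _)
    rw [this, mul_zero]
  add_mem' := fun {F F'} hF hF' => by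
    refine squeeze_zero' (Eventually.of_forall fun δ => defect_nonneg _ _ _ _ _) ?_
      (by simpa using Tendsto.add hF hF')
    filter_upwards [self_mem_nhdsWithin] with δ hδ
    rw [ofL1_add]
    exact defect_add_le (hr_pos δ hδ) hδ hD _ _
  smul_mem' := fun c F hF => by
    refine squeeze_zero' (Eventually.of_forall fun δ => defect_nonneg _ _ _ _ _) ?_
      (by simpa using Tendsto.const_mul ‖c‖ hF)
    filter_upwards [self_mem_nhdsWithin] with δ hδ
    exact defect_le_of_smul (hr_pos δ hδ) hδ hD (sigma_ofL1_smul c F)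

theorem isClosed_goodL1 (ε : ℝ) {D : ℝ} (hD : 0 < D) {r : ℝ → ℝ}
    (hr_pos : ∀ δ : ℝ, 0 < δ → 0 < r δ) :
    IsClosed (goodL1 ε hD hr_pos : Set (Lp ℂ 1 (volume : Measure G6))) := by
  refine isClosed_of_closure_subset fun F hF => ?_
  refine tendsto_defect_of_approx hr_pos hD fun e he => ?_
  obtain ⟨F', hF', h⟩ := Metric.mem_closure_iff.1 hF e he
  refine ⟨ofL1 F', hF', ?_⟩
  rw [← ofL1_sub]
  exact (norm_ofL1_le _).trans_lt (by rwa [← dist_eq_norm])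

/-- The part of a box in a ball. -/
def Box.cut {X B P : Set ℝ} (hX : MeasurableSet X) (hB : MeasurableSet B) (hP : MeasurableSet P)
    (n : ℕ) : Box where
  X := X ∩ {t | |t| ≤ n}
  B := B ∩ {t | |t| ≤ n}
  P := P ∩ {t | |t| ≤ n}
  measX := hX.inter (measurableSet_le measurable_norm measurable_const)
  measB := hB.inter (measurableSet_le measurable_norm measurable_const)
  measP := hP.inter (measurableSet_le measurable_norm measurable_const)
  radius := n
  subX _ h := h.2
  subB _ h := h.2
  subP _ h := h.2

/-- The part of a measurable set in a ball. -/
def Window.cut {W : Set (ℝ × ℝ × ℝ)} (hW : MeasurableSet W) (n : ℕ) : Window where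
  W := W ∩ {h | ‖h‖ ≤ n}
  meas := hW.inter (measurableSet_le measurable_norm measurable_const)
  radius := n
  sub _ h := h.2

/-- The measurable rectangles in the coordinates of `G`. -/
def rectangles : Set (Set G6) :=
  {S | ∃ X B P : Set ℝ, ∃ W : Set (ℝ × ℝ × ℝ), (MeasurableSet X ∧ MeasurableSet B ∧
    MeasurableSet P ∧ MeasurableSet W) ∧
    S = {g | (g.u.x ∈ X ∧ g.u.b ∈ B ∧ g.u.p ∈ P) ∧ g.h ∈ W}}

theorem univ_mem_rectangles : Set.univ ∈ rectangles :=
  ⟨Set.univ, Set.univ, Set.univ, Set.univ, by simp, by ext; simp⟩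

theorem isPiSystem_rectangles : IsPiSystem rectangles := by
  rintro _ ⟨X, B, P, W, ⟨hX, hB, hP, hW⟩, rfl⟩ _ ⟨X', B', P', W', ⟨hX', hB', hP', hW'⟩, rfl⟩ -
  refine ⟨X ∩ X', B ∩ B', P ∩ P', W ∩ W',
    ⟨hX.inter hX', hB.inter hB', hP.inter hP', hW.inter hW'⟩, ?_⟩
  ext g
  simp only [Set.mem_inter_iff, Set.mem_ofPred_eq]
  tauto

theorem generateFrom_rectangles :
    (inferInstance : MeasurableSpace G6) = MeasurableSpace.generateFrom rectangles := by
  refine le_antisymm ?_ (MeasurableSpace.generateFrom_le ?_)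
  · have hx : @Measurable G6 ℝ (MeasurableSpace.generateFrom rectangles) _ fun g => g.u.x :=
      fun X hX => MeasurableSpace.measurableSet_generateFrom
        ⟨X, Set.univ, Set.univ, Set.univ, by simp [hX], by ext; simp⟩
    have hb : @Measurable G6 ℝ (MeasurableSpace.generateFrom rectangles) _ fun g => g.u.b :=
      fun X hX => MeasurableSpace.measurableSet_generateFrom
        ⟨Set.univ, X, Set.univ, Set.univ, by simp [hX], by ext; simp⟩
    have hp : @Measurable G6 ℝ (MeasurableSpace.generateFrom rectangles) _ fun g => g.u.p :=
      fun X hX => MeasurableSpace.measurableSet_generateFrom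
        ⟨Set.univ, Set.univ, X, Set.univ, by simp [hX], by ext; simp⟩
    have hh : @Measurable G6 (ℝ × ℝ × ℝ) (MeasurableSpace.generateFrom rectangles) _
        fun g => g.h :=
      fun X hX => MeasurableSpace.measurableSet_generateFrom
        ⟨Set.univ, Set.univ, Set.univ, X, by simp [hX], by ext; simp⟩
    intro S hS
    exact (hx.prodMk (hb.prodMk hp)).prodMk hh hS
  · rintro _ ⟨X, B, P, W, ⟨hX, hB, hP, hW⟩, rfl⟩
    exact ((hX.prod (hB.prod hP)).prod hW :
      MeasurableSet ((X ×ˢ (B ×ˢ P)) ×ˢ W : Set ((ℝ × ℝ × ℝ) × (ℝ × ℝ × ℝ))))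

theorem goodL1_eq_top {ε D : ℝ} (hε : |ε| = 1) (hD : 0 < D) {r : ℝ → ℝ}
    (hr_pos : ∀ δ : ℝ, 0 < δ → 0 < r δ) (hr_top : Tendsto r (𝓝[>] 0) atTop)
    (hr_exp : Tendsto (fun δ : ℝ => Real.exp (r δ) * δ ^ (1 / 2 : ℝ)) (𝓝[>] 0) (𝓝 0)) :
    goodL1 ε hD hr_pos = ⊤ := by
  -- The exhausting sets are themselves boxes times windows, so intersecting one with a rectangle
  -- gives again a bounded box times a window.
  let K : ℕ → Set G6 := fun n => boxSet
    (Box.cut (X := Set.univ) (B := Set.univ) (P := Set.univ) .univ .univ .univ n)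
    (Window.cut (W := Set.univ) .univ n)
  have hK : ∀ n g, g ∈ K n ↔ (|g.u.x| ≤ n ∧ |g.u.b| ≤ n ∧ |g.u.p| ≤ n) ∧ ‖g.h‖ ≤ n := fun n g => by
    simp [K, boxSet, Box.cut, Window.cut]
  refine submodule_eq_top_of_indicator_mem _ (isClosed_goodL1 ε hD hr_pos)
    generateFrom_rectangles isPiSystem_rectangles univ_mem_rectangles (K := K)
    (fun n => measurableSet_boxSet _ _) (fun n => volume_boxSet_ne_top _ _) ?_ ?_ ?_
  · intro m n hmn g hg
    have h : (m : ℝ) ≤ n := Nat.cast_le.2 hmn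
    obtain ⟨⟨h1, h2, h3⟩, h4⟩ := (hK m g).1 hg
    exact (hK n g).2 ⟨⟨h1.trans h, h2.trans h, h3.trans h⟩, h4.trans h⟩
  · refine Set.eq_univ_of_forall fun g => ?_
    obtain ⟨n, hn⟩ := exists_nat_ge (|g.u.x| + |g.u.b| + |g.u.p| + ‖g.h‖)
    have h1 := abs_nonneg g.u.x
    have h2 := abs_nonneg g.u.b
    have h3 := abs_nonneg g.u.p
    have h4 := norm_nonneg g.h
    exact Set.mem_iUnion.2 ⟨n, (hK n g).2
      ⟨⟨by linarith, by linarith, by linarith⟩, by linarith⟩⟩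
  · rintro n _ ⟨X, B, P, W, ⟨hX, hB, hP, hW⟩, rfl⟩
    have h : {g : G6 | (g.u.x ∈ X ∧ g.u.b ∈ B ∧ g.u.p ∈ P) ∧ g.h ∈ W} ∩ K n
        = boxSet (Box.cut hX hB hP n) (Window.cut hW n) := by
      ext g
      rw [Set.mem_inter_iff, hK]
      simp only [boxSet, Box.cut, Window.cut, Set.mem_inter_iff, Set.mem_ofPred_eq]
      tauto
    rw [h]
    intro _ _
    exact tendsto_defect_boxElt (Box.cut hX hB hP n) (Window.cut hW n) hε hD hr_pos hr_top hr_exp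

theorem tendsto_defect {ε D : ℝ} (hε : |ε| = 1) (hD : 0 < D) {r : ℝ → ℝ}
    (hr_pos : ∀ δ : ℝ, 0 < δ → 0 < r δ) (hr_top : Tendsto r (𝓝[>] 0) atTop)
    (hr_exp : Tendsto (fun δ : ℝ => Real.exp (r δ) * δ ^ (1 / 2 : ℝ)) (𝓝[>] 0) (𝓝 0))
    (a : CStarG) : Tendsto (defect ε D r a) (𝓝[>] 0) (𝓝 0) := by
  refine tendsto_defect_of_approx hr_pos hD fun e he => ?_
  obtain ⟨_, ⟨F, rfl⟩, h⟩ := Metric.mem_closure_iff.1 a.2 e he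
  have hF : F ∈ goodL1 ε hD hr_pos := by
    rw [goodL1_eq_top hε hD hr_pos hr_top hr_exp]
    exact Submodule.mem_top
  exact ⟨ofL1 F, hF, by rwa [dist_eq_norm] at h⟩

end N628

end

theorem corollary5p12 (ε : ℝ) (hε : ε = 1 ∨ ε = -1) (D : ℝ) (hD : 0 < D) (r : ℝ → ℝ)
    (hr_pos : ∀ δ : ℝ, 0 < δ → 0 < r δ)
    (hr_top : Tendsto r (𝓝[>] 0) atTop)
    (hr_exp : Tendsto (fun δ : ℝ => Real.exp (r δ) * δ ^ (1 / 2 : ℝ)) (𝓝[>] 0) (𝓝 0))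
    (a : N628.CStarG) :
    (∀ δ : ℝ, 0 < δ → ∀ ξ : N628.L2G0,
      HasSum (fun k => N628.sigmaTerm ε (r δ) δ D a k ξ) (N628.sigmaDelta ε (r δ) δ D a ξ)) ∧
    Tendsto (fun δ : ℝ => Metric.infDist
        (N628.rho (N628.sigma (N628.Sstar ε) a - N628.sigmaDelta ε (r δ) δ D a)) N628.C0K)
      (𝓝[>] 0) (𝓝 0) := by
  refine ⟨fun δ hδ ξ => N628.hasSum_sigmaDelta ε (hr_pos δ hδ) hδ hD a ξ, ?_⟩
  have hε' : |ε| = 1 := by rcases hε with rfl | rfl <;> simp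
  exact N628.tendsto_defect hε' hD hr_pos hr_top hr_exp a
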